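/- Let $\mathbb K$ be a field of characteristic $0$, let $\mathfrak g,\mathfrak h$ be finite-dimensional Lie algebras over $\mathbb K$, let $\upsilon:\mathfrak g\to\operatorname{Der}(\mathfrak h)$ be a morphism of Lie algebras, and let $\phi:\mathfrak g\to\mathfrak h$ be an invertible crossed morphism relative to $\upsilon$, i.e. a linear bijection with $$\phi([x,y])=\upsilon_x(\phi(y))-\upsilon_y(\phi(x))+[\phi(x),\phi(y)]\qquad(x,y\in\mathfrak g).$$ Extend each $\upsilon_x$ to a derivation of the enveloping algebra $\mathcal U(\mathfrak h)$, let $M:\mathcal U(\mathfrak g)\to\operatorname{End}(\mathcal U(\mathfrak h))$ be the algebra morphism with $M(x)(X)=\upsilon_x(X)+\phi(x)X$ for $x\in\mathfrak g$, and put $\Theta(X)=M(X)(1)$, a linear map $\Theta:\mathcal U(\mathfrak g)\to\mathcal U(\mathfrak h)$. (1) Formal statement. Extend $\Theta$ and $\upsilon$ coefficientwise to formal power series in a central variable $t$. Let $\exp_{\mathfrak g}:t\mathfrak g[[t]]\to\mathcal U(\mathfrak g)[[t]]$ be the exponential series, $\log_{\mathfrak g}$ the logarithm series, $\operatorname{BCH}_{\mathfrak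 g}(x,y)=\log_{\mathfrak g}(\exp_{\mathfrak g}(x)\exp_{\mathfrak g}(y))$ for $x,y\in t\mathfrak g[[t]]$, similarly for $\mathfrak h$, and $\operatorname{Exp}(\upsilon_x)b=\sum_{k\ge 0}\frac1{k!}\upsilon_x^k(b)$. Then $\Theta$ is bijective, and $$\operatorname{BCH}_{\mathfrak g},\quad \operatorname{BCH}_{\mathfrak h},\quad \Phi=\log_{\mathfrak h}\circ\,\Theta\circ\exp_{\mathfrak g}\quad\text{and}\quad \chi=\log_{\mathfrak g}\circ\,\Theta^{-1}\circ\exp_{\mathfrak h}$$ (the last one being the post-Lie Magnus expansion) take values in $t\mathfrak g[[t]]$, $t\mathfrak h[[t]]$, $t\mathfrak h[[t]]$ and $t\mathfrak g[[t]]$ respectively. For all $a,b\in t\mathfrak h[[t]]$, $$\operatorname{BCH}_{\mathfrak g}(\chi(a),\chi(b))=\chi\big(\operatorname{BCH}_{\mathfrak h}(a,\operatorname{Exp}(\upsilon_{\chi(a)})b)\big).$$ Moreover $\Phi$ and $\chi$ are mutually inverse bijections between $t\mathfrak g[[t]]$ and $t\mathfrak h[[t]]$, and for all $x,y\in t\mathfrak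 g[[t]]$, $$\Phi(\operatorname{BCH}_{\mathfrak g}(x,y))=\operatorname{BCH}_{\mathfrak h}(\Phi(x),\operatorname{Exp}(\upsilon_x)\Phi(y)).$$ (2) Local statement. Let $\mathbb K=\mathbb R$ or $\mathbb C$. For $a\in\mathfrak h$ let $\chi_n(a)$ be the coefficient of $t^n$ in $\chi(ta)$ and read $\chi(a)$ as $\sum_n\chi_n(a)$; read $\Phi(x)$ and $\operatorname{BCH}(x,y)$ in the same way. Then $\chi$ and $\Phi$ are analytic near $0$ and inverse to each other near $0$. For all $(a,b)\in\mathfrak h\times\mathfrak h$ sufficiently close to $0$, all series occurring in $$\operatorname{BCH}_{\mathfrak g}(\chi(a),\chi(b))=\chi\big(\operatorname{BCH}_{\mathfrak h}(a,\operatorname{Exp}(\upsilon_{\chi(a)})b)\big)$$ converge and the identity holds; and for all $(x,y)\in\mathfrak g\times\mathfrak g$ sufficiently close to $0$, all series occurring in $$\Phi(\operatorname{BCH}_{\mathfrak g}(x,y))=\operatorname{BCH}_{\mathfrak h}(\Phi(x),\operatorname{Exp}(\upsilon_x)\Phi(y))$$ converge and the identity holds. That is, $\Phi=\chi^{-1}$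 is a crossed morphism, relative to $x\mapsto\operatorname{Exp}(\upsilon_x)$, between the local groups that the Baker-Campbell-Hausdorff series defines near $0$. -/

import Mathlib

noncomputable section

namespace PostLieMagnus

/-! ### Crossed morphisms of Lie algebras -/

/-- A crossed morphism `φ : 𝔤 → 𝔥` relative to a morphism of Lie algebras `υ : 𝔤 → Der(𝔥)`. -/
structure CrossedMorphism {K g h : Type*} [Field K] [LieRing g] [LieAlgebra K g]
    [LieRing h] [LieAlgebra K h] (υ : g →ₗ⁅K⁆ LieDerivation K h h) extends g →ₗ[K] h where
  crossed' : ∀ x y : g, toLinearMap ⁅x, y⁆ =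
    υ x (toLinearMap y) - υ y (toLinearMap x) + ⁅toLinearMap x, toLinearMap y⁆

/-! ### The action of `U(𝔤)` on `U(𝔥)` and the map `Θ` -/

section Enveloping

attribute [local instance 100] LieRing.ofAssociativeRing

variable {K g h : Type*} [Field K] [LieRing g] [LieAlgebra K g] [LieRing h] [LieAlgebra K h]

/-- The algebra morphism `U(𝔥) → U(𝔥)[ε]/(ε²)` with `x ↦ x + ε d(x)` for `x` in `𝔥`. -/
def dualLift (d : LieDerivation K h h) :
    UniversalEnvelopingAlgebra K h →ₐ[K]
      TrivSqZeroExt (UniversalEnvelopingAlgebra K h) (UniversalEnvelopingAlgebra K h) :=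
  UniversalEnvelopingAlgebra.lift K
    { toFun := fun x => TrivSqZeroExt.inl (UniversalEnvelopingAlgebra.ι K x) +
        TrivSqZeroExt.inr (UniversalEnvelopingAlgebra.ι K (d x))
      map_add' := fun x y => by
        ext <;> simp
      map_smul' := fun c x => by
        ext <;> simp
      map_lie' := fun {x y} => by
        have e1 := (UniversalEnvelopingAlgebra.ι K).map_lie x y
        have e2 := (UniversalEnvelopingAlgebra.ι K).map_lie x (d y)
        have e3 := (UniversalEnvelopingAlgebra.ι K).map_lie y (d x)
        rw [LieRing.of_associative_ring_bracket] at e1 e2 e3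
        ext
        · simp [-UniversalEnvelopingAlgebra.ι_apply, LieRing.of_associative_ring_bracket, e1]
        · simp [-UniversalEnvelopingAlgebra.ι_apply, LieRing.of_associative_ring_bracket, e2, e3]
          abel }

theorem dualLift_ι (d : LieDerivation K h h) (x : h) :
    dualLift d (UniversalEnvelopingAlgebra.ι K x) =
      TrivSqZeroExt.inl (UniversalEnvelopingAlgebra.ι K x) +
        TrivSqZeroExt.inr (UniversalEnvelopingAlgebra.ι K (d x)) :=
  UniversalEnvelopingAlgebra.lift_ι_apply K _ x

theorem fst_dualLift (d : LieDerivation K h h) (X : UniversalEnvelopingAlgebra K h) :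
    (dualLift d X).fst = X := by
  have : (TrivSqZeroExt.fstHom K (UniversalEnvelopingAlgebra K h)
      (UniversalEnvelopingAlgebra K h)).comp (dualLift d) = AlgHom.id K _ := by
    apply UniversalEnvelopingAlgebra.hom_ext
    ext x
    simp only [LieHom.coe_comp, Function.comp_apply, AlgHom.coe_toLieHom, AlgHom.comp_apply,
      dualLift_ι]
    simp
  exact congrArg (fun F => F X) this

/-- The extension of a derivation of the Lie algebra `𝔥` to a derivation of the algebra `U(𝔥)`. -/
def derivExt (d : LieDerivation K h h) : Module.End K (UniversalEnvelopingAlgebra K h) :=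
  (TrivSqZeroExt.sndHom (UniversalEnvelopingAlgebra K h)
    (UniversalEnvelopingAlgebra K h)).restrictScalars K ∘ₗ (dualLift d).toLinearMap

theorem derivExt_ι (d : LieDerivation K h h) (x : h) :
    derivExt d (UniversalEnvelopingAlgebra.ι K x) = UniversalEnvelopingAlgebra.ι K (d x) := by
  change (dualLift d (UniversalEnvelopingAlgebra.ι K x)).snd = _
  rw [dualLift_ι]
  simp

theorem derivExt_mul (d : LieDerivation K h h) (X Y : UniversalEnvelopingAlgebra K h) :
    derivExt d (X * Y) = X * derivExt d Y + derivExt d X * Y := by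
  change (dualLift d (X * Y)).snd = X * (dualLift d Y).snd + (dualLift d X).snd * Y
  rw [map_mul, TrivSqZeroExt.snd_mul, fst_dualLift, fst_dualLift]
  simp

theorem derivExt_one (d : LieDerivation K h h) : derivExt d 1 = 0 := by
  change (dualLift d 1).snd = 0
  simp

/-- Two endomorphisms of `U(𝔥)` obeying the Leibniz rule agree if they agree on `𝔥`. -/
theorem leibniz_ext (D E : Module.End K (UniversalEnvelopingAlgebra K h))
    (hD : ∀ X Y, D (X * Y) = X * D Y + D X * Y) (hE : ∀ X Y, E (X * Y) = X * E Y + E X * Y)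
    (hDE : ∀ x : h, D (UniversalEnvelopingAlgebra.ι K x) = E (UniversalEnvelopingAlgebra.ι K x)) :
    D = E := by
  have D1 : D 1 = 0 := by simpa using hD 1 1
  have E1 : E 1 = 0 := by simpa using hE 1 1
  let S : Subalgebra K (UniversalEnvelopingAlgebra K h) :=
    { carrier := {X | D X = E X}
      mul_mem' := fun {X Y} hX hY => by
        simp only [Set.mem_ofPred_eq] at hX hY ⊢
        rw [hD, hE, hX, hY]
      add_mem' := fun {X Y} hX hY => by
        simp only [Set.mem_ofPred_eq] at hX hY ⊢
        rw [map_add, map_add, hX, hY]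
      algebraMap_mem' := fun r => by
        simp [Algebra.algebraMap_eq_smul_one, D1, E1] }
  let F : UniversalEnvelopingAlgebra K h →ₐ[K] S :=
    UniversalEnvelopingAlgebra.lift K
      { toFun := fun x => ⟨UniversalEnvelopingAlgebra.ι K x, hDE x⟩
        map_add' := fun x y => Subtype.ext (by simp)
        map_smul' := fun c x => Subtype.ext (by simp)
        map_lie' := fun {x y} => Subtype.ext (by
          have e1 := (UniversalEnvelopingAlgebra.ι K).map_lie x y
          rw [LieRing.of_associative_ring_bracket] at e1
          simp [-UniversalEnvelopingAlgebra.ι_apply, LieRing.of_associative_ring_bracket, e1]) }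
  have hF : S.val.comp F = AlgHom.id K _ := by
    apply UniversalEnvelopingAlgebra.hom_ext
    ext x
    simp only [LieHom.coe_comp, Function.comp_apply, AlgHom.coe_toLieHom, AlgHom.comp_apply]
    rw [UniversalEnvelopingAlgebra.lift_ι_apply]
    rfl
  ext X
  have hX : ((F X : S) : UniversalEnvelopingAlgebra K h) = X := congrArg (fun G => G X) hF
  have := (F X).2
  rw [hX] at this
  exact this

theorem derivExt_lie (d e : LieDerivation K h h) :
    derivExt ⁅d, e⁆ = derivExt d * derivExt e - derivExt e * derivExt d := by
  apply leibniz_ext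
  · exact derivExt_mul _
  · intro X Y
    simp only [LinearMap.sub_apply, Module.End.mul_apply, derivExt_mul, map_add, mul_sub, sub_mul]
    abel
  · intro x
    simp only [LinearMap.sub_apply, Module.End.mul_apply, derivExt_ι,
      LieDerivation.commutator_apply, map_sub]

theorem derivExt_add (d e : LieDerivation K h h) :
    derivExt (d + e) = derivExt d + derivExt e := by
  apply leibniz_ext
  · exact derivExt_mul _
  · intro X Y
    simp only [LinearMap.add_apply, derivExt_mul, mul_add, add_mul]
    abel
  · intro x
    simp only [LinearMap.add_apply, derivExt_ι, LieDerivation.add_apply, map_add]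

theorem derivExt_smul (c : K) (d : LieDerivation K h h) :
    derivExt (c • d) = c • derivExt d := by
  apply leibniz_ext
  · exact derivExt_mul _
  · intro X Y
    simp only [LinearMap.smul_apply, derivExt_mul, smul_add, mul_smul_comm, smul_mul_assoc]
  · intro x
    simp only [LinearMap.smul_apply, derivExt_ι, LieDerivation.smul_apply, map_smul]

variable {υ : g →ₗ⁅K⁆ LieDerivation K h h}

/-- The representation `M(x) = υ_x + (left multiplication by φ(x))` of `𝔤` on `U(𝔥)`. -/
def actionLie (φ : CrossedMorphism υ) :
    g →ₗ⁅K⁆ Module.End K (UniversalEnvelopingAlgebra K h) where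
  toFun x := derivExt (υ x) +
    LinearMap.mulLeft K (UniversalEnvelopingAlgebra.ι K (φ.toLinearMap x))
  map_add' x y := by
    ext X
    simp only [map_add, derivExt_add, LinearMap.add_apply, LinearMap.mulLeft_apply, add_mul]
    abel
  map_smul' c x := by
    ext X
    simp only [map_smul, derivExt_smul, LinearMap.add_apply, LinearMap.mulLeft_apply,
      LinearMap.smul_apply, smul_mul_assoc, RingHom.id_apply, smul_add]
  map_lie' {x y} := by
    have e1 := (UniversalEnvelopingAlgebra.ι K).map_lie (φ.toLinearMap x) (φ.toLinearMap y)
    rw [LieRing.of_associative_ring_bracket] at e1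
    ext X
    simp only [LieHom.map_lie υ, derivExt_lie, φ.crossed', LieRing.of_associative_ring_bracket,
      LinearMap.add_apply, LinearMap.sub_apply, Module.End.mul_apply, LinearMap.mulLeft_apply,
      map_add, map_sub, derivExt_mul, derivExt_ι, e1, add_mul, sub_mul, mul_add, mul_assoc]
    abel

/-- The action `M : U(𝔤) → End(U(𝔥))`. -/
def action (φ : CrossedMorphism υ) :
    UniversalEnvelopingAlgebra K g →ₐ[K] Module.End K (UniversalEnvelopingAlgebra K h) :=
  UniversalEnvelopingAlgebra.lift K (actionLie φ)

/-- The map `Θ : U(𝔤) → U(𝔥)`, `Θ(X) = M(X)(1)`. -/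
def Theta (φ : CrossedMorphism υ) :
    UniversalEnvelopingAlgebra K g →ₗ[K] UniversalEnvelopingAlgebra K h where
  toFun X := action φ X 1
  map_add' X Y := by simp
  map_smul' c X := by simp

end Enveloping

/-! ### Formal exponential and logarithm

A formal power series `∑ xₙ tⁿ` with coefficients in a vector space `V` is its sequence of
coefficients `x : ℕ → V`.  For algebras Mathlib's (noncommutative) `PowerSeries A = A[[t]]`, in
which `t` is central, is used.  -/

/-- `exp(u) = ∑ uᵏ / k!` in `A[[t]]`, for `u` without constant term (then `uᵏ` has order at least
`k`, so that only `k ≤ n` contributes to the coefficient of `tⁿ`). -/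
def expPS (K : Type*) {A : Type*} [Field K] [Ring A] [Algebra K A] (u : PowerSeries A) :
    PowerSeries A :=
  PowerSeries.mk fun n =>
    ∑ k ∈ Finset.range (n + 1), ((k.factorial : K)⁻¹) • PowerSeries.coeff n (u ^ k)

/-- `log(u) = ∑_{k ≥ 1} (-1)^(k-1) (u - 1)ᵏ / k` in `A[[t]]`, for `u` with constant term `1`. -/
def logPS (K : Type*) {A : Type*} [Field K] [Ring A] [Algebra K A] (u : PowerSeries A) :
    PowerSeries A :=
  PowerSeries.mk fun n =>
    ∑ k ∈ Finset.Icc 1 n, ((-1 : K) ^ (k - 1) / (k : K)) • PowerSeries.coeff n ((u - 1) ^ k)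

section Formal

variable (K : Type*) {g h : Type*} [Field K] [LieRing g] [LieAlgebra K g]
  [LieRing h] [LieAlgebra K h]

/-- The coefficientwise inclusion `𝔤[[t]] → U(𝔤)[[t]]`. -/
def toU (x : ℕ → g) : PowerSeries (UniversalEnvelopingAlgebra K g) :=
  PowerSeries.mk fun n => UniversalEnvelopingAlgebra.ι K (x n)

/-- `exp_𝔤 : t𝔤[[t]] → U(𝔤)[[t]]`. -/
def expU (x : ℕ → g) : PowerSeries (UniversalEnvelopingAlgebra K g) :=
  expPS K (toU K x)

open Classical in
/-- `log_𝔤`, read in `𝔤[[t]]`: the series in `𝔤[[t]]` whose image in `U(𝔤)[[t]]` is the logarithm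
of `u` (and `0` if that logarithm does not have coefficients in `𝔤`). -/
def logU (u : PowerSeries (UniversalEnvelopingAlgebra K g)) : ℕ → g :=
  if H : ∃ x : ℕ → g, toU K x = logPS K u then H.choose else 0

/-- The Baker-Campbell-Hausdorff product `BCH(x, y) = log (exp x · exp y)` on `t𝔤[[t]]`. -/
def BCH (x y : ℕ → g) : ℕ → g :=
  logU K (expU K x * expU K y)

variable {K}

/-- The `K[[t]]`-linear action of a series of derivations of `𝔥` on `𝔥[[t]]`. -/
def derivAct (D : ℕ → LieDerivation K h h) (b : ℕ → h) : ℕ → h := fun n =>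
  ∑ p ∈ Finset.HasAntidiagonal.antidiagonal n, D p.1 (b p.2)

/-- `Exp(υ_x) b = ∑ υ_xᵏ(b) / k!` for `x` in `t𝔤[[t]]` and `b` in `𝔥[[t]]` (as `x` has no constant
term, only `k ≤ n` contributes to the coefficient of `tⁿ`). -/
def ExpAct (υ : g →ₗ⁅K⁆ LieDerivation K h h) (x : ℕ → g) (b : ℕ → h) : ℕ → h := fun n =>
  ∑ k ∈ Finset.range (n + 1),
    ((k.factorial : K)⁻¹) • ((derivAct fun i => υ (x i))^[k] b) n

variable {υ : g →ₗ⁅K⁆ LieDerivation K h h}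

/-- The coefficientwise extension `U(𝔤)[[t]] → U(𝔥)[[t]]` of `Θ`. -/
def ThetaPS (φ : CrossedMorphism υ) (u : PowerSeries (UniversalEnvelopingAlgebra K g)) :
    PowerSeries (UniversalEnvelopingAlgebra K h) :=
  PowerSeries.mk fun n => Theta φ (PowerSeries.coeff n u)

/-- The coefficientwise extension `U(𝔥)[[t]] → U(𝔤)[[t]]` of `Θ⁻¹` (meaningful when `Θ` is
bijective). -/
def ThetaInvPS (φ : CrossedMorphism υ) (u : PowerSeries (UniversalEnvelopingAlgebra K h)) :
    PowerSeries (UniversalEnvelopingAlgebra K g) :=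
  PowerSeries.mk fun n => Function.invFun (Theta φ) (PowerSeries.coeff n u)

/-- The integrated map `Φ = log_𝔥 ∘ Θ ∘ exp_𝔤 : t𝔤[[t]] → t𝔥[[t]]`. -/
def Phi (φ : CrossedMorphism υ) (x : ℕ → g) : ℕ → h :=
  logU K (ThetaPS φ (expU K x))

/-- The post-Lie Magnus expansion `χ = log_𝔤 ∘ Θ⁻¹ ∘ exp_𝔥 : t𝔥[[t]] → t𝔤[[t]]`. -/
def chi (φ : CrossedMorphism υ) (a : ℕ → h) : ℕ → g :=
  logU K (ThetaInvPS φ (expU K a))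

end Formal

/-! ### The convergent versions

The component of degree `n` of each of the series is the coefficient of `tⁿ` after inserting `ta`
for `a`; its sum is the value of the series at `a`. -/

section Local

variable (K : Type*) {g h : Type*} [Field K] [LieRing g] [LieAlgebra K g]
  [LieRing h] [LieAlgebra K h]

/-- The formal series `ta`. -/
def line {V : Type*} [Zero V] (a : V) : ℕ → V := Pi.single 1 a

/-- The component of degree `n` of the Baker-Campbell-Hausdorff series at `(x, y)`. -/
def bchTerm (x y : g) (n : ℕ) : g := BCH K (line x) (line y) n

/-- The sum of the Baker-Campbell-Hausdorff series at `(x, y)`. -/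
def bchSum [TopologicalSpace g] (x y : g) : g := ∑' n, bchTerm K x y n

variable {K}

/-- The term `υ_xⁿ(b) / n!` of the series `Exp(υ_x) b`. -/
def expTerm (υ : g →ₗ⁅K⁆ LieDerivation K h h) (x : g) (b : h) (n : ℕ) : h :=
  ((n.factorial : K)⁻¹) • (fun c => υ x c)^[n] b

/-- `Exp(υ_x) b`. -/
def expSum [TopologicalSpace h] (υ : g →ₗ⁅K⁆ LieDerivation K h h) (x : g) (b : h) : h :=
  ∑' n, expTerm υ x b n

variable {υ : g →ₗ⁅K⁆ LieDerivation K h h}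

/-- The component of degree `n` of the post-Lie Magnus expansion at `a`. -/
def chiTerm (φ : CrossedMorphism υ) (a : h) (n : ℕ) : g := chi φ (line a) n

/-- The sum of the post-Lie Magnus expansion at `a`. -/
def chiSum [TopologicalSpace g] (φ : CrossedMorphism υ) (a : h) : g := ∑' n, chiTerm φ a n

/-- The component of degree `n` of `Φ` at `x`. -/
def phiTerm (φ : CrossedMorphism υ) (x : g) (n : ℕ) : h := Phi φ (line x) n

/-- The sum of the series `Φ` at `x`. -/
def phiSum [TopologicalSpace h] (φ : CrossedMorphism υ) (x : g) : h := ∑' n, phiTerm φ x n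

end Local

/-- A map between finite-dimensional spaces is analytic near `0`, in linear coordinates. -/
def AnalyticNearZero (𝕜 : Type*) {V W : Type*} [RCLike 𝕜] [AddCommGroup V] [Module 𝕜 V]
    [AddCommGroup W] [Module 𝕜 W] (f : V → W) : Prop :=
  ∀ (m n : ℕ) (e : V ≃ₗ[𝕜] (Fin m → 𝕜)) (e' : W ≃ₗ[𝕜] (Fin n → 𝕜)),
    AnalyticAt 𝕜 (fun v => e' (f (e.symm v))) 0

end PostLieMagnus

end

open PostLieMagnus

/-! Put M(x) = υ_x + (left multiplication by φ(x)). As υ_x is a derivation, M(x)(XY) = (M(x)X) Y + X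
υ_x(Y). Exponentiating gives Θ(e^x b) = Θ(e^x) e^{υ_x}(Θ b). Take b = e^y: since Θ(e^y) = e^{Φ(y)}
and the automorphism e^{υ_x} commutes with exponentials, Θ(e^x e^y) = e^{Φ(x)} e^{Exp(υ_x)Φ(y)}, and
the logarithm of this is the identity for Φ (`Phi_BCH`). Inserting χ(a), χ(b) gives the identity for
χ. It remains to see that the logarithms lie in the Lie algebras, that Θ is bijective, and that the
series converge.

Logarithms. All three come from one differential equation in an auxiliary time s. With F(X) = X/(1 -
e^{-X}), solve Ω' = F(ad Ω) e^{-B₂(Ω)} v + F(-ad Ω) v' + δΩ, Ω(0) = 0, inside the Lie algebra. By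
the formula for the derivative of the exponential, Z = e^Ω satisfies Z' = Z·e^{-B₂(Ω)}v + v'Z + DZ,
where D is the derivation extending δ (`derivPS_expPS_flow`). For B₂ = 0, δ = 0, v = y, v' = x this
forces Z = e^{sx} e^{sy}; for v = 0, v' = φ(x), δ = υ_x it forces Z = Θ(e^{sx}); for v = φ⁻¹(a), v'
= 0, δ = 0 and B₂(x) = φ⁻¹ υ_x φ it forces Θ(Z) = e^{sa}. If the data are series in t without
constant term, the coefficient of s^k has order at least k in t, so s = 1 may be inserted. `LieRep`
and `Crossed` are stable under passing to power series, which supplies first t and then s.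

Bijectivity. Θ sends a product of basis vectors to the product of their φ-images modulo lower
degree, because υ_x does not raise the degree. Surjectivity follows by induction on the degree.
Injectivity needs the ordered monomials in U(𝔥) to be independent modulo lower degree
(Poincaré-Birkhoff-Witt). This is obtained from the representation of 𝔥 by left-invariant vector
fields in exponential coordinates, whose bracket relations are the Maurer-Cartan equation
(`derivMC_sub`); leading symbols of ordered monomials are products of partial derivatives.

Convergence. The recursion for the coefficients of Ω is dominated by a scalar recursion U with
bounded sum (`IsMajorant.sum_le`). One transfer principle, `IsGradedRel.flow`, says that any graded
relation preserved by the operations in the equation holds between the coefficients of two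
solutions. Applied to different relations it yields orders in t, the passage from s to t,
analyticity, and the fact that inserting a convergent series into a formal operation gives a series
converging to the value at its sum (`MagnusData.evaluable`). Hence the local identities are the
formal ones applied to ta, tb and summed. -/

noncomputable section
namespace PostLieMagnus
open Finset hiding antidiagonal mem_antidiagonal
open Finset.HasAntidiagonal (antidiagonal mem_antidiagonal)
open scoped TensorProduct

/-! ### Formal sums of power series -/

section FormalSum

variable {K A A' : Type*} [CommRing K] [Ring A] [Algebra K A] [Ring A'] [Algebra K A']

/-- The family `f` of power series has `f k` of order at least `k`. -/
def OrderGe (f : ℕ → PowerSeries A) : Prop := ∀ k n, n < k → PowerSeries.coeff n (f k) = 0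

/-- The formal sum `∑ f k` of a family with `f k` of order at least `k`. -/
def fsum (f : ℕ → PowerSeries A) : PowerSeries A :=
  PowerSeries.mk fun n => ∑ k ∈ range (n + 1), PowerSeries.coeff n (f k)

theorem coeff_fsum (f : ℕ → PowerSeries A) (n : ℕ) :
    PowerSeries.coeff n (fsum f) = ∑ k ∈ range (n + 1), PowerSeries.coeff n (f k) :=
  PowerSeries.coeff_mk _ _

theorem coeff_fsum_of_lt {f : ℕ → PowerSeries A} (hf : OrderGe f) {n N : ℕ} (h : n < N) :
    PowerSeries.coeff n (fsum f) = ∑ k ∈ range N, PowerSeries.coeff n (f k) := by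
  rw [coeff_fsum]
  apply sum_subset (range_subset_range.2 h)
  intro k _ hk
  exact hf k n (by simpa [Nat.lt_succ_iff] using hk)

/-- The square and the triangle i + j < N differ only where F vanishes. -/
theorem sum_range_sum_range_eq_antidiagonal {M : Type*} [AddCommMonoid M] (F : ℕ → ℕ → M) (N : ℕ)
    (hF : ∀ i j, N ≤ i + j → F i j = 0) :
    ∑ i ∈ range N, ∑ j ∈ range N, F i j =
      ∑ k ∈ range N, ∑ p ∈ antidiagonal k, F p.1 p.2 := by
  rw [← sum_product' (range N) (range N) F, sum_sigma' (range N) (fun k => antidiagonal k)]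
  symm
  apply sum_bij_ne_zero (fun x _ _ => x.2)
  · rintro ⟨k, i, j⟩ h _
    simp only [mem_sigma, mem_range, mem_antidiagonal, mem_product] at h ⊢
    lia
  · rintro ⟨k, i, j⟩ h _ ⟨k', i', j'⟩ h' _ e
    simp only [mem_sigma, mem_range, mem_antidiagonal, Prod.mk.injEq] at h h' e
    obtain ⟨rfl, rfl⟩ := e
    obtain ⟨_, rfl⟩ := h
    obtain ⟨_, rfl⟩ := h'
    rfl
  · rintro ⟨i, j⟩ h hne
    refine ⟨⟨i + j, i, j⟩, ?_, hne, rfl⟩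
    simp only [mem_sigma, mem_range, mem_antidiagonal, and_true]
    by_contra hc
    exact hne (hF i j (by lia))
  · intros; rfl

theorem fsum_fsum {F : ℕ → ℕ → PowerSeries A}
    (hF : ∀ k l n, n < k + l → PowerSeries.coeff n (F k l) = 0) :
    fsum (fun k => fsum (F k)) = fsum fun m => ∑ p ∈ antidiagonal m, F p.1 p.2 := by
  ext n
  simp only [coeff_fsum, map_sum]
  exact sum_range_sum_range_eq_antidiagonal (fun i j => PowerSeries.coeff n (F i j)) (n + 1)
    fun i j h => hF i j n (by lia)

/-- A linear map of power series that lowers the order by at most one. -/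
def LosesOne (T : PowerSeries A →ₗ[K] PowerSeries A') : Prop :=
  ∀ w n, (∀ i ≤ n, PowerSeries.coeff i w = 0) → ∀ i < n, PowerSeries.coeff i (T w) = 0

/-- A linear map of power series that does not lower the order. -/
def KeepsOrder (T : PowerSeries A →ₗ[K] PowerSeries A') : Prop :=
  ∀ w n, (∀ i < n, PowerSeries.coeff i w = 0) → ∀ i < n, PowerSeries.coeff i (T w) = 0

/-- A linear map of power series that raises the order by at least one. -/
def RaisesOrder (T : PowerSeries A →ₗ[K] PowerSeries A') : Prop :=
  ∀ w n, (∀ i < n, PowerSeries.coeff i w = 0) → ∀ i < n + 1, PowerSeries.coeff i (T w) = 0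

theorem KeepsOrder.losesOne {T : PowerSeries A →ₗ[K] PowerSeries A'} (h : KeepsOrder T) :
    LosesOne T := fun w n hw i hi => h w n (fun j hj => hw j hj.le) i hi

/-- Coefficient n of the image sees coefficients up to n + 1 of the argument, whence the bound n + 1
< N. The model case is the derivative d/dt. -/
theorem LosesOne.coeff_fsum {T : PowerSeries A →ₗ[K] PowerSeries A'} (hT : LosesOne T)
    {f : ℕ → PowerSeries A} (hf : OrderGe f) {n N : ℕ} (h : n + 1 < N) :
    PowerSeries.coeff n (T (fsum f)) = ∑ k ∈ range N, PowerSeries.coeff n (T (f k)) := by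
  have : PowerSeries.coeff n (T (fsum f - ∑ k ∈ range N, f k)) = 0 := by
    apply hT _ (n + 1) _ n (by lia)
    intro i hi
    rw [map_sub, coeff_fsum_of_lt hf (N := N) (by lia), map_sum, sub_self]
  rw [map_sub, map_sub, sub_eq_zero, map_sum, map_sum] at this
  exact this

theorem KeepsOrder.map_fsum {T : PowerSeries A →ₗ[K] PowerSeries A'} (hT : KeepsOrder T)
    {f : ℕ → PowerSeries A} (hf : OrderGe f) : T (fsum f) = fsum fun k => T (f k) := by
  ext n
  rw [hT.losesOne.coeff_fsum hf (N := n + 2) (by lia)]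
  refine (coeff_fsum_of_lt (fun k n h => ?_) (by lia)).symm
  exact hT _ k (fun i hi => hf k i hi) n h

/-- The lost degree is absorbed by the index shift, which is possible because the zeroth term is
killed. This is how derivations act on exponential and logarithm series. -/
theorem LosesOne.map_fsum_succ {T : PowerSeries A →ₗ[K] PowerSeries A'} (hT : LosesOne T)
    {f : ℕ → PowerSeries A} (hf : OrderGe f) (h0 : T (f 0) = 0) :
    T (fsum f) = fsum fun k => T (f (k + 1)) := by
  ext n
  rw [hT.coeff_fsum hf (N := n + 2) (by lia), sum_range_succ', h0, map_zero, add_zero,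
    PostLieMagnus.coeff_fsum]

theorem OrderGe.smul {f : ℕ → PowerSeries A} (hf : OrderGe f) (c : ℕ → K) :
    OrderGe fun k => c k • f k := fun k n h => by
  rw [PowerSeries.coeff_smul, hf k n h, smul_zero]

theorem coeff_mul_eq_zero {u v : PowerSeries A} {k l : ℕ}
    (hu : ∀ i < k, PowerSeries.coeff i u = 0) (hv : ∀ i < l, PowerSeries.coeff i v = 0) :
    ∀ n < k + l, PowerSeries.coeff n (u * v) = 0 := by
  intro n hn
  rw [PowerSeries.coeff_mul]
  apply sum_eq_zero
  rintro ⟨i, j⟩ hij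
  rw [mem_antidiagonal] at hij
  dsimp only at hij ⊢
  by_cases h : i < k
  · rw [hu i h, zero_mul]
  · rw [hv j (by lia), mul_zero]

theorem keepsOrder_mulLeft (u : PowerSeries A) : KeepsOrder (LinearMap.mulLeft K u) :=
  fun w n hw i hi => coeff_mul_eq_zero (k := 0) (by simp) hw i (by lia)

theorem keepsOrder_mulRight (u : PowerSeries A) : KeepsOrder (LinearMap.mulRight K u) :=
  fun w n hw i hi => coeff_mul_eq_zero (l := 0) hw (by simp) i (by lia)

theorem raisesOrder_mulLeft {u : PowerSeries A} (hu : PowerSeries.coeff 0 u = 0) :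
    RaisesOrder (LinearMap.mulLeft K u) :=
  fun w n hw i hi => coeff_mul_eq_zero (k := 1) (l := n)
    (fun i hi => by obtain rfl : i = 0 := by lia
                    exact hu) hw i (by lia)

theorem raisesOrder_mulRight {u : PowerSeries A} (hu : PowerSeries.coeff 0 u = 0) :
    RaisesOrder (LinearMap.mulRight K u) :=
  fun w n hw i hi => coeff_mul_eq_zero (k := n) (l := 1) hw
    (fun i hi => by obtain rfl : i = 0 := by lia
                    exact hu) i (by lia)

theorem RaisesOrder.add {S T : PowerSeries A →ₗ[K] PowerSeries A'} (hS : RaisesOrder S)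
    (hT : RaisesOrder T) : RaisesOrder (S + T) := fun w n hw i hi => by
  rw [LinearMap.add_apply, map_add, hS w n hw i hi, hT w n hw i hi, add_zero]

theorem RaisesOrder.sub {S T : PowerSeries A →ₗ[K] PowerSeries A'} (hS : RaisesOrder S)
    (hT : RaisesOrder T) : RaisesOrder (S - T) := fun w n hw i hi => by
  rw [LinearMap.sub_apply, map_sub, hS w n hw i hi, hT w n hw i hi, sub_zero]

theorem fsum_mul_fsum {f g : ℕ → PowerSeries A} (hf : OrderGe f) (hg : OrderGe g) :
    fsum f * fsum g = fsum fun m => ∑ p ∈ antidiagonal m, f p.1 * g p.2 := by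
  rw [← fsum_fsum (F := fun k l => f k * g l)
    fun k l n h => coeff_mul_eq_zero (hf k) (hg l) n h]
  refine ((keepsOrder_mulRight (K := ℤ) (fsum g)).map_fsum hf).trans ?_
  congr 1
  ext1 k
  exact (keepsOrder_mulLeft (K := ℤ) (f k)).map_fsum hg

end FormalSum

/-! ### Functional calculus of operators that raise the order -/

section Calculus

variable {K A : Type*} [Field K] [Ring A] [Algebra K A]

theorem RaisesOrder.pow_apply {T : Module.End K (PowerSeries A)} (hT : RaisesOrder T) {m : ℕ}
    {w : PowerSeries A} (hw : ∀ i < m, PowerSeries.coeff i w = 0) (k : ℕ) :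
    ∀ i < m + k, PowerSeries.coeff i ((T ^ k) w) = 0 := by
  induction k with
  | zero => simpa using hw
  | succ k ih =>
    rw [pow_succ', Module.End.mul_apply]
    exact hT _ _ ih

theorem RaisesOrder.orderGe {T : Module.End K (PowerSeries A)} (hT : RaisesOrder T)
    (w : PowerSeries A) : OrderGe fun k => (T ^ k) w := fun k n h =>
  hT.pow_apply (m := 0) (by simp) k n (by lia)

/-- `c(T) w = ∑ cₖ Tᵏ w` for an operator `T` that raises the order. -/
def opCalc (c : PowerSeries K) (T : Module.End K (PowerSeries A)) (w : PowerSeries A) :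
    PowerSeries A := fsum fun k => PowerSeries.coeff k c • (T ^ k) w

/-- Makes c ↦ c(T) multiplicative, so that scalar identities such as F·(1 - e^{-X})/X = 1 become
identities of operators. -/
theorem opCalc_mul {T : Module.End K (PowerSeries A)} (hT : RaisesOrder T) (c d : PowerSeries K)
    (w : PowerSeries A) : opCalc (c * d) T w = opCalc c T (opCalc d T w) := by
  have h1 : opCalc c T (opCalc d T w) = fsum fun k => fsum fun l =>
      (PowerSeries.coeff k c * PowerSeries.coeff l d) • (T ^ (k + l)) w := by
    unfold opCalc
    congr 1
    ext1 k
    have hk : KeepsOrder (PowerSeries.coeff k c • T ^ k) := fun w n hw i hi => by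
      rw [LinearMap.smul_apply, PowerSeries.coeff_smul, hT.pow_apply hw k i (by lia), smul_zero]
    refine (hk.map_fsum ((hT.orderGe w).smul _)).trans ?_
    congr 1
    ext1 l
    rw [LinearMap.smul_apply, map_smul, smul_smul, pow_add, Module.End.mul_apply]
  rw [h1, fsum_fsum fun k l n h => by
    rw [PowerSeries.coeff_smul, hT.orderGe w _ n h, smul_zero]]
  unfold opCalc
  congr 1
  ext1 m
  rw [PowerSeries.coeff_mul, sum_smul]
  exact sum_congr rfl fun p hp => by rw [mem_antidiagonal.1 hp]

theorem opCalc_one (T : Module.End K (PowerSeries A)) (w : PowerSeries A) : opCalc 1 T w = w := by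
  ext n
  rw [opCalc, coeff_fsum, sum_eq_single 0]
  · simp
  · intro k _ hk
    simp [PowerSeries.coeff_one, hk]
  · simp

theorem opCalc_add_right (c : PowerSeries K) (T : Module.End K (PowerSeries A))
    (w w' : PowerSeries A) : opCalc c T (w + w') = opCalc c T w + opCalc c T w' := by
  ext n
  simp [opCalc, coeff_fsum, sum_add_distrib]

theorem opCalc_add_left (c d : PowerSeries K) (T : Module.End K (PowerSeries A))
    (w : PowerSeries A) : opCalc (c + d) T w = opCalc c T w + opCalc d T w := by
  ext n
  simp [opCalc, coeff_fsum, sum_add_distrib, add_smul]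

theorem opCalc_smul_left (a : K) (c : PowerSeries K) (T : Module.End K (PowerSeries A))
    (w : PowerSeries A) : opCalc (a • c) T w = a • opCalc c T w := by
  ext n
  simp [opCalc, coeff_fsum, mul_smul, smul_sum]

/-- `e^X`. -/
def expS (K : Type*) [Field K] : PowerSeries K := PowerSeries.mk fun k => (k.factorial : K)⁻¹

/-- `e^(-X)`. -/
def expNegS (K : Type*) [Field K] : PowerSeries K :=
  PowerSeries.mk fun k => (-1) ^ k * (k.factorial : K)⁻¹

/-- `(1 - e^(-X)) / X`. -/
def dexpS (K : Type*) [Field K] : PowerSeries K :=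
  PowerSeries.mk fun k => (-1) ^ k * ((k + 1).factorial : K)⁻¹

/-- `X / (1 - e^(-X))`. -/
def todd (K : Type*) [Field K] : PowerSeries K := (dexpS K)⁻¹

/-- `X / (e^X - 1)`. -/
def toddNeg (K : Type*) [Field K] : PowerSeries K :=
  PowerSeries.mk fun k => (-1) ^ k * PowerSeries.coeff k (todd K)

theorem dexpS_mul_todd (K : Type*) [Field K] : dexpS K * todd K = 1 :=
  PowerSeries.mul_inv_cancel _ (by simp [dexpS])

theorem fact_inv_mul [CharZero K] (n : ℕ) :
    ((n : K) + 1) * ((n + 1).factorial : K)⁻¹ = (n.factorial : K)⁻¹ := by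
  rw [Nat.factorial_succ, Nat.cast_mul, mul_inv, ← mul_assoc, Nat.cast_add_one,
    mul_inv_cancel₀ (Nat.cast_add_one_ne_zero n), one_mul]

theorem expS_mul_expNegS (K : Type*) [Field K] [CharZero K] : expS K * expNegS K = 1 := by
  let : Algebra ℚ K := DivisionRing.toRatAlgebra
  have h1 : expS K = PowerSeries.exp K := by
    ext n
    simp [expS, PowerSeries.coeff_exp]
  have h2 : expNegS K = PowerSeries.evalNegHom (PowerSeries.exp K) := by
    ext n
    simp [expNegS, PowerSeries.evalNegHom, PowerSeries.coeff_exp, PowerSeries.coeff_rescale]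
  rw [h1, h2, PowerSeries.exp_mul_exp_neg_eq_one]

/-- With G = (1 - e^{-X})/X one has G(-X) = (e^X - 1)/X, hence G(X) = e^{-X} G(-X), and G(-X)
cancels against F(-X). This is what turns the term F(-ad Ω)v' into a multiplication of e^Ω from the
left. -/
theorem dexpS_mul_toddNeg (K : Type*) [Field K] [CharZero K] :
    dexpS K * toddNeg K = expNegS K := by
  have h1 : toddNeg K = PowerSeries.evalNegHom (todd K) := by
    ext n
    simp [toddNeg, PowerSeries.evalNegHom, PowerSeries.coeff_rescale]
  have h2 : PowerSeries.X * dexpS K = 1 - expNegS K := by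
    ext n
    cases n with
    | zero => simp [expNegS]
    | succ n => simp [expNegS, dexpS, PowerSeries.coeff_succ_X_mul, PowerSeries.coeff_one, pow_succ]
  have h3 : PowerSeries.evalNegHom (dexpS K) * expNegS K = dexpS K := by
    have e1 : PowerSeries.evalNegHom (expNegS K) = expS K := by
      ext n
      simp [expNegS, expS, PowerSeries.evalNegHom, PowerSeries.coeff_rescale, ← mul_assoc,
        ← mul_pow]
    have e2 := congrArg PowerSeries.evalNegHom h2
    rw [map_mul, map_sub, map_one, e1, PowerSeries.evalNegHom_X] at e2
    -- G is only accessible through X·G = 1 - e^{-X}, so the identity is multiplied by X.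
    apply mul_left_cancel₀ (PowerSeries.X_ne_zero (R := K))
    rw [h2, ← mul_assoc, show (PowerSeries.X : PowerSeries K) * PowerSeries.evalNegHom (dexpS K) =
      expS K - 1 by linear_combination -e2, sub_mul, expS_mul_expNegS, one_mul]
  have h4 : PowerSeries.evalNegHom (dexpS K) * PowerSeries.evalNegHom (todd K) = 1 := by
    rw [← map_mul, dexpS_mul_todd, map_one]
  rw [h1]
  linear_combination (-PowerSeries.evalNegHom (todd K)) * h3 + expNegS K * h4

end Calculus

/-! ### Exponentials -/

section Exponential

variable {K A : Type*} [Field K] [Ring A] [Algebra K A]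

theorem orderGe_pow {u : PowerSeries A} (hu : PowerSeries.coeff 0 u = 0) :
    OrderGe fun k => u ^ k := by
  have := (raisesOrder_mulLeft (K := ℤ) hu)
  intro k
  induction k with
  | zero => simp
  | succ k ih =>
    intro n hn
    dsimp only
    rw [pow_succ']
    exact this _ _ ih n hn

theorem expPS_eq_fsum (u : PowerSeries A) :
    expPS K u = fsum fun k => (k.factorial : K)⁻¹ • u ^ k := by
  ext n
  simp [expPS, coeff_fsum]

theorem expPS_eq_opCalc (u : PowerSeries A) : expPS K u = opCalc (expS K) (LinearMap.mulLeft K u) 1 := by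
  rw [expPS_eq_fsum, opCalc]
  congr 1
  ext1 k
  rw [LinearMap.pow_mulLeft, LinearMap.mulLeft_apply, mul_one, expS, PowerSeries.coeff_mk]

theorem coeff_zero_expPS (u : PowerSeries A) : PowerSeries.coeff 0 (expPS K u) = 1 := by
  simp [expPS]

/-- `ad u`. -/
def adj (K : Type*) {A : Type*} [Field K] [Ring A] [Algebra K A] (u : PowerSeries A) :
    Module.End K (PowerSeries A) := LinearMap.mulLeft K u - LinearMap.mulRight K u

theorem adj_apply (u w : PowerSeries A) : adj K u w = u * w - w * u := rfl

theorem raisesOrder_adj {u : PowerSeries A} (hu : PowerSeries.coeff 0 u = 0) :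
    RaisesOrder (adj K u) := (raisesOrder_mulLeft hu).sub (raisesOrder_mulRight hu)

/-- A weighted sum over an antidiagonal, with the weight `m = i + j` distributed. -/
theorem smul_antidiagonal_succ {M : Type*} [AddCommGroup M] [Module K M] (F : ℕ → ℕ → M) (m : ℕ) :
    ((m : K) + 1) • ∑ p ∈ antidiagonal (m + 1), F p.1 p.2 =
      ∑ p ∈ antidiagonal m, ((p.1 : K) + 1) • F (p.1 + 1) p.2 +
      ∑ p ∈ antidiagonal m, ((p.2 : K) + 1) • F p.1 (p.2 + 1) := by
  have h1 := Finset.Nat.sum_antidiagonal_succ (n := m) (f := fun p => (p.1 : K) • F p.1 p.2)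
  have h2 := Finset.Nat.sum_antidiagonal_succ' (n := m) (f := fun p => (p.2 : K) • F p.1 p.2)
  simp only [Nat.cast_zero, zero_smul, zero_add, Nat.cast_add, Nat.cast_one] at h1 h2
  rw [← h1, ← h2, ← sum_add_distrib, smul_sum]
  refine sum_congr rfl fun p hp => ?_
  rw [← add_smul]
  congr 1
  rw [← Nat.cast_add_one, ← mem_antidiagonal.1 hp, Nat.cast_add]

variable [CharZero K]

theorem cast_succ_smul_injective {M : Type*} [AddCommGroup M] [Module K M] (n : ℕ) {x y : M}
    (h : ((n : K) + 1) • x = ((n : K) + 1) • y) : x = y :=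
  smul_right_injective M (Nat.cast_add_one_ne_zero n) h

/-- The degree-n part of a e^u = e^u e^{-ad u}(a). The induction moves one more u across: (ad
u)^j(a)·u = u·(ad u)^j(a) - (ad u)^{j+1}(a). -/
theorem mul_pow_eq_sum (u a : PowerSeries A) (n : ℕ) :
    (n.factorial : K)⁻¹ • (a * u ^ n) = ∑ p ∈ antidiagonal n,
      ((p.1.factorial : K)⁻¹ • u ^ p.1) * (PowerSeries.coeff p.2 (expNegS K) • (adj K u ^ p.2) a) := by
  induction n with
  | zero => simp [expNegS]
  | succ n ih =>
    apply cast_succ_smul_injective (K := K) n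
    rw [smul_smul, fact_inv_mul, pow_succ, ← mul_assoc, ← smul_mul_assoc, ih,
      smul_antidiagonal_succ (fun i j => ((i.factorial : K)⁻¹ • u ^ i) *
        (PowerSeries.coeff j (expNegS K) • (adj K u ^ j) a)) n, ← sum_add_distrib, sum_mul]
    refine sum_congr rfl fun p _ => ?_
    have e : (p.2 + 1 : K) * PowerSeries.coeff (p.2 + 1) (expNegS K) =
        - PowerSeries.coeff p.2 (expNegS K) := by
      simp only [expNegS, PowerSeries.coeff_mk, ← fact_inv_mul (K := K) p.2]
      ring
    rw [← smul_mul_assoc, smul_smul, fact_inv_mul, ← mul_smul_comm, smul_smul, e, pow_succ' u,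
      pow_succ' (adj K u), Module.End.mul_apply, adj_apply]
    simp only [smul_mul_assoc, mul_smul_comm, neg_smul, mul_neg, mul_sub, smul_sub,
      mul_assoc]
    rw [← mul_assoc u, ← pow_succ', pow_succ, mul_assoc]
    abel

/-- `a e^u = e^u e^(-ad u)(a)`. -/
theorem mul_expPS {u : PowerSeries A} (hu : PowerSeries.coeff 0 u = 0) (a : PowerSeries A) :
    a * expPS K u = expPS K u * opCalc (expNegS K) (adj K u) a := by
  have h := (keepsOrder_mulLeft (K := K) a).map_fsum
    ((orderGe_pow hu).smul fun k => (k.factorial : K)⁻¹)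
  rw [LinearMap.mulLeft_apply, ← expPS_eq_fsum] at h
  rw [h, expPS_eq_fsum, opCalc, fsum_mul_fsum ((orderGe_pow hu).smul _)
    (((raisesOrder_adj hu).orderGe a).smul _)]
  congr 1
  ext1 n
  rw [← mul_pow_eq_sum, LinearMap.mulLeft_apply, mul_smul_comm]

/-- The part of D e^u = e^u G(ad u)(D u) coming from u^{n+1}/(n+1)!. In D(u·u^{n+1}) the summand
u·D(u^{n+1}) contributes the weight i at (i, j), the summand D(u)·u^{n+1} contributes j + 1 by
`mul_pow_eq_sum`, and i + j + 1 = n + 2 cancels the factor made by the factorial. -/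
theorem derivation_pow_eq_sum (D : Module.End K (PowerSeries A))
    (hD : ∀ X Y, D (X * Y) = X * D Y + D X * Y) (u : PowerSeries A) (n : ℕ) :
    ((n + 1).factorial : K)⁻¹ • D (u ^ (n + 1)) = ∑ p ∈ antidiagonal n,
      ((p.1.factorial : K)⁻¹ • u ^ p.1) *
        (PowerSeries.coeff p.2 (dexpS K) • (adj K u ^ p.2) (D u)) := by
  induction n with
  | zero => simp [dexpS]
  | succ n ih =>
    apply cast_succ_smul_injective (K := K) (n + 1)
    rw [smul_smul, fact_inv_mul, pow_succ' u (n + 1), hD, smul_add, ← mul_smul_comm, ih,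
      mul_pow_eq_sum (K := K) u (D u)]
    have h1 := Finset.Nat.sum_antidiagonal_succ (n := n)
      (f := fun p => (p.1 : K) • (((p.1.factorial : K)⁻¹ • u ^ p.1) *
        (PowerSeries.coeff p.2 (dexpS K) • (adj K u ^ p.2) (D u))))
    simp only [Nat.cast_zero, zero_smul, zero_add] at h1
    have h2 : u * ∑ p ∈ antidiagonal n, ((p.1.factorial : K)⁻¹ • u ^ p.1) *
        (PowerSeries.coeff p.2 (dexpS K) • (adj K u ^ p.2) (D u)) =
        ∑ p ∈ antidiagonal (n + 1), (p.1 : K) • (((p.1.factorial : K)⁻¹ • u ^ p.1) *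
        (PowerSeries.coeff p.2 (dexpS K) • (adj K u ^ p.2) (D u))) := by
      rw [h1, mul_sum]
      refine sum_congr rfl fun p _ => ?_
      rw [← smul_mul_assoc ((_ : ℕ) : K), smul_smul, Nat.cast_add_one, fact_inv_mul, ← mul_assoc,
        mul_smul_comm _ u, pow_succ']
    rw [h2, ← sum_add_distrib, smul_sum]
    refine sum_congr rfl fun p hp => ?_
    have e : PowerSeries.coeff p.2 (expNegS K) =
        ((p.2 : K) + 1) * PowerSeries.coeff p.2 (dexpS K) := by
      simp only [expNegS, dexpS, PowerSeries.coeff_mk, ← fact_inv_mul (K := K) p.2]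
      ring
    rw [e, mul_smul ((p.2 : K) + 1), mul_smul_comm ((p.2 : K) + 1), ← add_smul]
    congr 1
    have := congrArg (Nat.cast (R := K)) (mem_antidiagonal.1 hp)
    push_cast at this ⊢
    linear_combination this

/-- `D e^u = e^u G(ad u)(D u)` with `G = (1 - e^(-X)) / X`, for a derivation `D`. -/
theorem derivation_expPS {D : Module.End K (PowerSeries A)} (hD1 : LosesOne D)
    (hD : ∀ X Y, D (X * Y) = X * D Y + D X * Y) {u : PowerSeries A}
    (hu : PowerSeries.coeff 0 u = 0) :
    D (expPS K u) = expPS K u * opCalc (dexpS K) (adj K u) (D u) := by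
  have h1 : D 1 = 0 := by simpa using hD 1 1
  have h := hD1.map_fsum_succ ((orderGe_pow hu).smul fun k => (k.factorial : K)⁻¹)
    (by simp [h1])
  rw [← expPS_eq_fsum] at h
  rw [h, expPS_eq_fsum, opCalc, fsum_mul_fsum ((orderGe_pow hu).smul _)
    (((raisesOrder_adj hu).orderGe _).smul _)]
  congr 1
  ext1 n
  rw [← derivation_pow_eq_sum D hD, map_smul]

/-- The binomial formula in divided powers. T' and D may differ, which is needed for T = T' = D +
left multiplication. -/
theorem leibniz_pow_eq_sum {T T' D : Module.End K (PowerSeries A)}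
    (h : ∀ X Y, T (X * Y) = T' X * Y + X * D Y) (X Y : PowerSeries A) (n : ℕ) :
    (n.factorial : K)⁻¹ • (T ^ n) (X * Y) = ∑ p ∈ antidiagonal n,
      ((p.1.factorial : K)⁻¹ • (T' ^ p.1) X) * ((p.2.factorial : K)⁻¹ • (D ^ p.2) Y) := by
  induction n with
  | zero => simp
  | succ n ih =>
    apply cast_succ_smul_injective (K := K) n
    rw [smul_smul, fact_inv_mul, pow_succ', Module.End.mul_apply, ← map_smul, ih,
      smul_antidiagonal_succ (fun i j => ((i.factorial : K)⁻¹ • (T' ^ i) X) *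
        ((j.factorial : K)⁻¹ • (D ^ j) Y)) n, ← sum_add_distrib, map_sum]
    refine sum_congr rfl fun p _ => ?_
    rw [h, map_smul, map_smul, ← smul_mul_assoc, smul_smul, fact_inv_mul, ← mul_smul_comm,
      smul_smul ((p.2 : K) + 1), fact_inv_mul, pow_succ', pow_succ', Module.End.mul_apply,
      Module.End.mul_apply]

/-- `e^T (XY) = e^T'(X) e^D(Y)` if `T(XY) = T'(X) Y + X D(Y)`. -/
theorem opCalc_exp_mul {T T' D : Module.End K (PowerSeries A)}
    (hT' : RaisesOrder T') (hD : RaisesOrder D)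
    (h : ∀ X Y, T (X * Y) = T' X * Y + X * D Y) (X Y : PowerSeries A) :
    opCalc (expS K) T (X * Y) = opCalc (expS K) T' X * opCalc (expS K) D Y := by
  rw [opCalc, opCalc, opCalc, fsum_mul_fsum ((hT'.orderGe _).smul _) ((hD.orderGe _).smul _)]
  congr 1
  ext1 n
  simp only [expS, PowerSeries.coeff_mk]
  exact leibniz_pow_eq_sum h X Y n

end Exponential

/-! ### The logarithm is inverse to the exponential -/

section Logarithm

variable {K A : Type*} [Field K] [Ring A] [Algebra K A]

/-- The substitution `c ↦ c(u)`. -/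
def substPS (K : Type*) {A : Type*} [Field K] [Ring A] [Algebra K A] (u : PowerSeries A) :
    PowerSeries K →ₗ[K] PowerSeries A where
  toFun c := opCalc c (LinearMap.mulLeft K u) 1
  map_add' c d := opCalc_add_left c d _ _
  map_smul' a c := opCalc_smul_left a c _ _

theorem substPS_apply (u : PowerSeries A) (c : PowerSeries K) :
    substPS K u c = fsum fun k => PowerSeries.coeff k c • u ^ k := by
  change opCalc c _ 1 = _
  rw [opCalc]
  congr 1
  ext1 k
  rw [LinearMap.pow_mulLeft, LinearMap.mulLeft_apply, mul_one]

/-- Powers of one element u commute, so substitution is multiplicative although A need not be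
commutative. -/
theorem substPS_mul {u : PowerSeries A} (hu : PowerSeries.coeff 0 u = 0) (c d : PowerSeries K) :
    substPS K u (c * d) = substPS K u c * substPS K u d := by
  have h := (keepsOrder_mulRight (K := K) (substPS K u d)).map_fsum
    ((orderGe_pow hu).smul fun k => PowerSeries.coeff k c)
  rw [← substPS_apply, LinearMap.mulRight_apply] at h
  rw [h]
  refine (opCalc_mul (raisesOrder_mulLeft hu) c d 1).trans ?_
  conv_lhs => rw [opCalc]
  congr 1
  ext1 k
  rw [LinearMap.pow_mulLeft, LinearMap.mulLeft_apply, LinearMap.mulRight_apply, smul_mul_assoc]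
  rfl

theorem substPS_one (u : PowerSeries A) : substPS K u 1 = 1 := opCalc_one _ _

theorem substPS_pow {u : PowerSeries A} (hu : PowerSeries.coeff 0 u = 0) (c : PowerSeries K)
    (n : ℕ) : substPS K u (c ^ n) = substPS K u c ^ n := by
  induction n with
  | zero => rw [pow_zero, pow_zero, substPS_one]
  | succ n ih => rw [pow_succ, pow_succ, substPS_mul hu, ih]

theorem keepsOrder_substPS (u : PowerSeries A) :
    KeepsOrder (substPS K u) := fun c n hc i hi => by
  rw [substPS_apply, coeff_fsum]
  refine sum_eq_zero fun k hk => ?_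
  rw [hc k (by have := mem_range.1 hk; lia), zero_smul, map_zero]

theorem substPS_X {u : PowerSeries A} (hu : PowerSeries.coeff 0 u = 0) :
    substPS K u PowerSeries.X = u := by
  ext n
  rw [substPS_apply, coeff_fsum_of_lt ((orderGe_pow hu).smul _) (N := n + 2) (by lia),
    sum_eq_single 1]
  · simp
  · intro k _ hk
    simp [PowerSeries.coeff_X, hk]
  · simp

theorem logPS_eq_fsum (u : PowerSeries A) : logPS K u =
    fsum fun k => ((if k = 0 then 0 else (-1) ^ (k - 1) / (k : K)) : K) • (u - 1) ^ k := by
  ext n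
  rw [logPS, PowerSeries.coeff_mk, coeff_fsum]
  symm
  have : Icc 1 n ⊆ range (n + 1) := fun k hk => by
    rw [mem_Icc] at hk
    rw [mem_range]
    lia
  rw [← sum_subset this]
  · refine sum_congr rfl fun k hk => ?_
    rw [mem_Icc] at hk
    rw [if_neg (by lia), PowerSeries.coeff_smul]
  · intro k h1 h2
    rw [mem_range] at h1
    rw [mem_Icc] at h2
    rw [if_pos (by lia), zero_smul, map_zero]

variable [CharZero K]

/-- Both sides have constant term zero, and the derivative of log(e^X) is e^X Σ (1 - e^X)^k = e^X /
e^X = 1. -/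
theorem logPS_expS : logPS K (expS K) = PowerSeries.X := by
  have h0 : PowerSeries.coeff 0 (expS K - 1) = 0 := by simp [expS]
  have hg := (orderGe_pow h0).smul
    fun k => ((if k = 0 then 0 else (-1) ^ (k - 1) / (k : K)) : K)
  apply PowerSeries.derivative.ext
  · have hD : LosesOne (PowerSeries.derivative K : PowerSeries K →ₗ[K] PowerSeries K) := by
      intro w n hw i hi
      simp [PowerSeries.coeff_derivative, hw (i + 1) hi]
    have he : PowerSeries.derivative K (expS K - 1) = expS K := by
      ext n
      rw [map_sub, PowerSeries.derivative_one, sub_zero, PowerSeries.coeff_derivative]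
      simp only [expS, PowerSeries.coeff_mk]
      rw [mul_comm, fact_inv_mul]
    have h := hD.map_fsum_succ hg (by simp)
    rw [← logPS_eq_fsum] at h
    refine h.trans ?_
    have hneg : PowerSeries.coeff 0 (1 - expS K) = 0 := by simp [expS]
    have h1 : (fun k => (PowerSeries.derivative K : PowerSeries K →ₗ[K] PowerSeries K)
        (((if k + 1 = 0 then 0 else (-1) ^ (k + 1 - 1) / ((k + 1 : ℕ) : K)) : K) •
          (expS K - 1) ^ (k + 1))) = fun k => LinearMap.mulRight K (expS K) ((1 - expS K) ^ k) := by
      ext1 k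
      rw [map_smul, if_neg (by lia), Nat.add_sub_cancel, Derivation.coeFn_coe,
        PowerSeries.derivative_pow, he, Nat.add_sub_cancel, LinearMap.mulRight_apply,
        ← neg_sub (expS K) 1, neg_pow (expS K - 1), PowerSeries.smul_eq_C_mul, div_eq_mul_inv,
        map_mul, map_pow, map_neg, map_one]
      have : PowerSeries.C ((k + 1 : ℕ) : K)⁻¹ * ((k + 1 : ℕ) : PowerSeries K) = 1 := by
        rw [← map_natCast (PowerSeries.C (R := K)), ← map_mul,
          inv_mul_cancel₀ (Nat.cast_ne_zero.2 (Nat.succ_ne_zero k)), map_one]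
      linear_combination ((-1) ^ k * (expS K - 1) ^ k * expS K) * this
    rw [h1, ← (keepsOrder_mulRight (expS K)).map_fsum (orderGe_pow hneg),
      LinearMap.mulRight_apply, PowerSeries.derivative_X]
    have h2 : fsum (fun k => (1 - expS K) ^ k) =
        substPS K (1 - expS K) (PowerSeries.mk 1) := by
      rw [substPS_apply]
      simp
    -- The product of e^X with the geometric series is the image of (1 - X)·Σ X^k = 1 under X ↦ 1 -
    -- e^X.
    have h3 : expS K = substPS K (1 - expS K) (1 - PowerSeries.X) := by
      rw [map_sub, substPS_X hneg, substPS_one]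
      ring
    rw [h2]
    conv_lhs => rw [mul_comm]; lhs; rw [h3]
    rw [← substPS_mul hneg, mul_comm, PowerSeries.mk_one_mul_one_sub_eq_one, substPS_one]
  · rw [← PowerSeries.coeff_zero_eq_constantCoeff_apply, logPS_eq_fsum, coeff_fsum]
    simp

/-- The identity log(e^X) = X in K[[X]], transported by X ↦ u. -/
theorem logPS_expPS {u : PowerSeries A} (hu : PowerSeries.coeff 0 u = 0) :
    logPS K (expPS K u) = u := by
  have h0 : PowerSeries.coeff 0 (expS K - 1) = 0 := by simp [expS]
  have he : expPS K u - 1 = substPS K u (expS K - 1) := by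
    rw [map_sub, substPS_one, expPS_eq_opCalc]
    rfl
  have h := congrArg (substPS K u) (logPS_expS (K := K))
  rw [substPS_X hu, logPS_eq_fsum, (keepsOrder_substPS u).map_fsum ((orderGe_pow h0).smul _)] at h
  rw [logPS_eq_fsum, he]
  simpa only [map_smul, substPS_pow hu] using h

end Logarithm

/-! ### Convolution of sequences -/

section Conv

variable {K V W X : Type*} [Field K] [AddCommGroup V] [Module K V] [AddCommGroup W] [Module K W]
  [AddCommGroup X] [Module K X]

/-- The extension of a bilinear map to formal power series. -/
def conv (B : V →ₗ[K] W →ₗ[K] X) : (ℕ → V) →ₗ[K] (ℕ → W) →ₗ[K] (ℕ → X) :=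
  LinearMap.mk₂ K (fun u w n => ∑ p ∈ antidiagonal n, B (u p.1) (w p.2))
    (fun u u' w => by ext n; simp [sum_add_distrib])
    (fun c u w => by ext n; simp [smul_sum])
    (fun u w w' => by ext n; simp [sum_add_distrib])
    (fun c u w => by ext n; simp [smul_sum])

theorem conv_apply (B : V →ₗ[K] W →ₗ[K] X) (u : ℕ → V) (w : ℕ → W) (n : ℕ) :
    conv B u w n = ∑ p ∈ antidiagonal n, B (u p.1) (w p.2) := rfl

/-- `c(B_u) w = ∑ cₖ B_uᵏ w` for a series `u` without constant term. -/
def opSeries (c : PowerSeries K) (B : V →ₗ[K] W →ₗ[K] W) (u : ℕ → V) (w : ℕ → W) : ℕ → W := fun n =>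
  ∑ k ∈ range (n + 1), PowerSeries.coeff k c • ((conv B u : Module.End K (ℕ → W)) ^ k) w n

theorem conv_congr (B : V →ₗ[K] W →ₗ[K] X) {u u' : ℕ → V} {w w' : ℕ → W} {n : ℕ}
    (hu : ∀ i ≤ n, u i = u' i) (hw : ∀ i ≤ n, w i = w' i) :
    ∀ i ≤ n, conv B u w i = conv B u' w' i := fun i hi => by
  rw [conv_apply, conv_apply]
  refine sum_congr rfl fun p hp => ?_
  have := mem_antidiagonal.1 hp
  rw [hu p.1 (by lia), hw p.2 (by lia)]

theorem opSeries_congr (c : PowerSeries K) (B : V →ₗ[K] W →ₗ[K] W) {u u' : ℕ → V} {w w' : ℕ → W}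
    {n : ℕ} (hu : ∀ i ≤ n, u i = u' i) (hw : ∀ i ≤ n, w i = w' i) :
    ∀ i ≤ n, opSeries c B u w i = opSeries c B u' w' i := fun i hi => by
  have (k : ℕ) : ∀ i ≤ n, ((conv B u : Module.End K (ℕ → W)) ^ k) w i =
      ((conv B u' : Module.End K (ℕ → W)) ^ k) w' i := by
    induction k with
    | zero => simpa using hw
    | succ k ih =>
      simp only [pow_succ', Module.End.mul_apply]
      exact conv_congr B hu ih
  exact sum_congr rfl fun k _ => by rw [this k i hi]

/-- A causal recursion has a solution. -/
theorem exists_recursion (N : (ℕ → V) → ℕ → V)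
    (hN : ∀ u w n, (∀ i ≤ n, u i = w i) → N u n = N w n) :
    ∃ Ω : ℕ → V, Ω 0 = 0 ∧ ∀ k, Ω (k + 1) = N Ω k := by
  let J : (ℕ → V) → ℕ → V := fun u n => Nat.casesOn n 0 fun k => N u k
  -- Picard iteration: iterate m is final up to degree m, so the diagonal is the fixed point.
  let x : ℕ → ℕ → V := fun m => J^[m] 0
  have hx (m : ℕ) : x (m + 1) = J (x m) := Function.iterate_succ_apply' _ _ _
  have h1 (m : ℕ) : ∀ i ≤ m, x m i = x (m + 1) i := by
    induction m with
    | zero =>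
      intro i hi
      obtain rfl : i = 0 := by lia
      rw [hx]
      rfl
    | succ m ih =>
      intro i hi
      rw [hx (m + 1), hx m]
      cases i with
      | zero => rfl
      | succ i => exact hN _ _ _ fun j hj => by rw [← hx]; exact ih j (by lia)
  have h2 (i l : ℕ) : x (i + l) i = x i i := by
    induction l with
    | zero => rfl
    | succ l ih => rw [← ih, ← add_assoc, ← h1 (i + l) i (by lia)]
  refine ⟨fun n => x n n, rfl, fun k => ?_⟩
  change x (k + 1) (k + 1) = _
  rw [hx]
  refine hN _ _ _ fun i hi => ?_
  obtain ⟨l, rfl⟩ := Nat.exists_eq_add_of_le hi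
  exact h2 i l

end Conv

/-! ### The differential equation of Magnus type -/

section Flow

variable {K V V' : Type*} [Field K] [AddCommGroup V] [Module K V] [AddCommGroup V'] [Module K V']

/-- `F(B₁(Ω)) e^(-B₂(Ω)) v + F(-B₁(Ω)) v' + δ Ω`, where `F = X / (1 - e^(-X))`. -/
def magnusField (B₁ B₂ : V →ₗ[K] V →ₗ[K] V) (δ : V →ₗ[K] V) (v v' : V) (Ω : ℕ → V) : ℕ → V :=
  fun n => opSeries (todd K) B₁ Ω (opSeries (expNegS K) B₂ Ω (Pi.single 0 v)) n +
    opSeries (toddNeg K) B₁ Ω (Pi.single 0 v') n + δ (Ω n)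

/-- `Ω` is the formal solution of `Ω' = F(B₁(Ω)) e^(-B₂(Ω)) v + F(-B₁(Ω)) v' + δ Ω`, `Ω(0) = 0`. -/
structure IsFlow (B₁ B₂ : V →ₗ[K] V →ₗ[K] V) (δ : V →ₗ[K] V) (v v' : V) (Ω : ℕ → V) : Prop where
  zero : Ω 0 = 0
  succ : ∀ k : ℕ, ((k : K) + 1) • Ω (k + 1) = magnusField B₁ B₂ δ v v' Ω k

theorem magnusField_congr (B₁ B₂ : V →ₗ[K] V →ₗ[K] V) (δ : V →ₗ[K] V) (v v' : V) {u w : ℕ → V}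
    {n : ℕ} (h : ∀ i ≤ n, u i = w i) :
    magnusField B₁ B₂ δ v v' u n = magnusField B₁ B₂ δ v v' w n := by
  unfold magnusField
  rw [opSeries_congr _ B₁ h (opSeries_congr _ B₂ h fun _ _ => rfl) n le_rfl,
    opSeries_congr _ B₁ h (fun _ _ => rfl) n le_rfl, h n le_rfl]

theorem exists_isFlow [CharZero K] (B₁ B₂ : V →ₗ[K] V →ₗ[K] V) (δ : V →ₗ[K] V) (v v' : V) :
    ∃ Ω, IsFlow B₁ B₂ δ v v' Ω := by
  obtain ⟨Ω, h0, h⟩ := exists_recursion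
    (fun Ω k => ((k : K) + 1)⁻¹ • magnusField B₁ B₂ δ v v' Ω k)
    fun u w n h => by rw [magnusField_congr B₁ B₂ δ v v' h]
  exact ⟨Ω, h0, fun k => by rw [h, smul_smul, mul_inv_cancel₀ (Nat.cast_add_one_ne_zero k),
    one_smul]⟩

/-- The multiplication of `ℝ` scaled by `τ`. -/
def mulScaled (τ : ℝ) : ℝ →ₗ[ℝ] ℝ →ₗ[ℝ] ℝ := τ • LinearMap.mul ℝ ℝ

/-- The majorant of `magnusField`. -/
def majorantField (τ d v v' : ℝ) (U : ℕ → ℝ) : ℕ → ℝ := fun n =>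
  -- Over ℝ or ℂ the coefficients of F(X), F(-X), e^{-X} and the factors 1/(k+1) all have norm at
  -- most 1; the majorant replaces each of them by 1 and each bilinear map by τ times a product.
  opSeries (PowerSeries.mk 1) (mulScaled τ) U
      (opSeries (PowerSeries.mk 1) (mulScaled τ) U (Pi.single 0 v)) n +
    opSeries (PowerSeries.mk 1) (mulScaled τ) U (Pi.single 0 v') n + d * U n

/-- `U` is the solution of the recursion defined by the majorant of `magnusField`. -/
structure IsMajorant (τ d v v' : ℝ) (U : ℕ → ℝ) : Prop where
  zero : U 0 = 0
  succ : ∀ k : ℕ, U (k + 1) = majorantField τ d v v' U k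

theorem exists_isMajorant (τ d v v' : ℝ) : ∃ U, IsMajorant τ d v v' U := by
  obtain ⟨U, h0, h⟩ := exists_recursion (majorantField τ d v v') fun u w n h => by
    unfold majorantField
    rw [opSeries_congr _ _ h (opSeries_congr _ _ h fun _ _ => rfl) n le_rfl,
      opSeries_congr _ _ h (fun _ _ => rfl) n le_rfl, h n le_rfl]
  exact ⟨U, h0, h⟩

/-- A graded relation with weights that is compatible with the operations of `magnusField`. -/
structure IsGradedRel (small : K → Prop) (B₁ B₂ : V →ₗ[K] V →ₗ[K] V) (δ : V →ₗ[K] V)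
    (B₁' B₂' : V' →ₗ[K] V' →ₗ[K] V') (δ' : V' →ₗ[K] V') (τ d : ℝ)
    (R : ℕ → ℝ → V → V' → Prop) : Prop where
  zero : ∀ k, R k 0 0 0
  add : ∀ {k C D u w x y}, R k C u w → R k D x y → R k (C + D) (u + x) (w + y)
  smul : ∀ {c k C u w}, small c → R k C u w → R k C (c • u) (c • w)
  br₁ : ∀ {k l C D u w x y}, R k C u w → R l D x y → R (k + l) (τ * (C * D)) (B₁ u x) (B₁' w y)
  br₂ : ∀ {k l C D u w x y}, R k C u w → R l D x y → R (k + l) (τ * (C * D)) (B₂ u x) (B₂' w y)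
  der : ∀ {k C u w}, R k C u w → R (k + 1) (d * C) (δ u) (δ' w)

variable {small : K → Prop} {B₁ B₂ : V →ₗ[K] V →ₗ[K] V} {δ : V →ₗ[K] V}
    {B₁' B₂' : V' →ₗ[K] V' →ₗ[K] V'} {δ' : V' →ₗ[K] V'} {τ d : ℝ}
    {R : ℕ → ℝ → V → V' → Prop}

theorem rel_sum (zero : ∀ k, R k 0 0 0)
    (add : ∀ {k C D u w x y}, R k C u w → R k D x y → R k (C + D) (u + x) (w + y))
    {ι : Type*} (s : Finset ι) {k : ℕ} {C : ι → ℝ} {u : ι → V} {w : ι → V'}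
    (h : ∀ i ∈ s, R k (C i) (u i) (w i)) :
    R k (∑ i ∈ s, C i) (∑ i ∈ s, u i) (∑ i ∈ s, w i) := by
  classical
  induction s using Finset.induction_on with
  | empty => exact zero k
  | insert i s hi ih =>
    rw [sum_insert hi, sum_insert hi, sum_insert hi]
    exact add (h i (mem_insert_self i s)) (ih fun j hj => h j (mem_insert_of_mem hj))

/-- The shift i + 1 for W and w records that v and v' have degree one although they stand at index
0: coefficient i of the right-hand side feeds coefficient i + 1 of Ω. -/
theorem rel_opSeries (zero : ∀ k, R k 0 0 0)
    (add : ∀ {k C D u w x y}, R k C u w → R k D x y → R k (C + D) (u + x) (w + y))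
    (smul : ∀ {c k C u w}, small c → R k C u w → R k C (c • u) (c • w))
    (br : ∀ {k l C D u w x y}, R k C u w → R l D x y → R (k + l) (τ * (C * D)) (B₁ u x) (B₁' w y))
    {c : PowerSeries K} (hc : ∀ k, small (PowerSeries.coeff k c))
    {U W : ℕ → ℝ} {u w : ℕ → V} {u' w' : ℕ → V'} {n : ℕ}
    (hu : ∀ i ≤ n, R i (U i) (u i) (u' i)) (hw : ∀ i ≤ n, R (i + 1) (W i) (w i) (w' i)) :
    ∀ i ≤ n, R (i + 1) (opSeries (PowerSeries.mk 1) (mulScaled τ) U W i)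
      (opSeries c B₁ u w i) (opSeries c B₁' u' w' i) := by
  have key (k : ℕ) : ∀ i ≤ n, R (i + 1)
      (((conv (mulScaled τ) U : Module.End ℝ (ℕ → ℝ)) ^ k) W i)
      (((conv B₁ u : Module.End K (ℕ → V)) ^ k) w i)
      (((conv B₁' u' : Module.End K (ℕ → V')) ^ k) w' i) := by
    induction k with
    | zero => simpa using hw
    | succ k ih =>
      intro i hi
      simp only [pow_succ', Module.End.mul_apply, conv_apply]
      refine rel_sum zero add (C := fun p : ℕ × ℕ => τ * (U p.1 * _)) _ fun p hp => ?_
      have hp := mem_antidiagonal.1 hp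
      have := br (hu p.1 (by lia)) (ih p.2 (by lia))
      rwa [← add_assoc, hp] at this
  intro i hi
  refine rel_sum zero add _ fun k _ => ?_
  simp only [PowerSeries.coeff_mk, Pi.one_apply, one_smul]
  exact smul (hc k) (key k i hi)

/-- The transfer principle: coefficient k + 1 of a solution is built from those of index at most k
by precisely the operations that R respects, so induction carries R from the data to the solutions,
with the majorant as weight. -/
theorem IsGradedRel.flow (h : IsGradedRel small B₁ B₂ δ B₁' B₂' δ' τ d R)
    (h1 : ∀ k, small (PowerSeries.coeff k (todd K)))
    (h2 : ∀ k, small (PowerSeries.coeff k (toddNeg K)))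
    (h3 : ∀ k, small (PowerSeries.coeff k (expNegS K)))
    (h4 : ∀ k : ℕ, small ((k : K) + 1)⁻¹) [CharZero K]
    {v v' : V} {w w' : V'} {r r' : ℝ} (hv : R 1 r v w) (hv' : R 1 r' v' w')
    {U : ℕ → ℝ} {Ω : ℕ → V} {Ω' : ℕ → V'} (hU : IsMajorant τ d r r' U)
    (hΩ : IsFlow B₁ B₂ δ v v' Ω) (hΩ' : IsFlow B₁' B₂' δ' w w' Ω') (k : ℕ) :
    R k (U k) (Ω k) (Ω' k) := by
  suffices H : ∀ i ≤ k, R i (U i) (Ω i) (Ω' i) from H k le_rfl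
  have single {v : V} {w : V'} {r : ℝ} (hv : R 1 r v w) (n : ℕ) : ∀ i ≤ n, R (i + 1)
      ((Pi.single 0 r : ℕ → ℝ) i) ((Pi.single 0 v : ℕ → V) i) ((Pi.single 0 w : ℕ → V') i) := by
    intro i _
    cases i with
    | zero => simpa using hv
    | succ i => simpa using h.zero _
  induction k with
  | zero =>
    intro i hi
    obtain rfl : i = 0 := by lia
    rw [hU.zero, hΩ.zero, hΩ'.zero]
    exact h.zero 0
  | succ k ih =>
    intro i hi
    rcases Nat.lt_or_ge k i with hik | hik
    swap
    · exact ih i hik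
    obtain rfl : i = k + 1 := by lia
    have e1 : Ω (k + 1) = ((k : K) + 1)⁻¹ • magnusField B₁ B₂ δ v v' Ω k := by
      rw [← hΩ.succ, smul_smul, inv_mul_cancel₀ (Nat.cast_add_one_ne_zero k), one_smul]
    have e2 : Ω' (k + 1) = ((k : K) + 1)⁻¹ • magnusField B₁' B₂' δ' w w' Ω' k := by
      rw [← hΩ'.succ, smul_smul, inv_mul_cancel₀ (Nat.cast_add_one_ne_zero k), one_smul]
    rw [e1, e2, hU.succ]
    refine h.smul (h4 k) (h.add (h.add ?_ ?_) (h.der (ih k le_rfl)))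
    · exact rel_opSeries h.zero h.add h.smul h.br₁ h1 ih
        (rel_opSeries h.zero h.add h.smul h.br₂ h3 ih (single hv k)) k le_rfl
    · exact rel_opSeries h.zero h.add h.smul h.br₁ h2 ih (single hv' k) k le_rfl

/-! #### Bounds for the majorant -/

/-- A partial sum of the Cauchy product runs over a triangle inside the square of the product of
partial sums. -/
theorem sum_conv_le {τ : ℝ} (hτ : 0 ≤ τ) {U W : ℕ → ℝ} (hU : ∀ k, 0 ≤ U k) (hW : ∀ k, 0 ≤ W k)
    (n : ℕ) : ∑ i ∈ range n, conv (mulScaled τ) U W i ≤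
      τ * ((∑ i ∈ range n, U i) * ∑ i ∈ range n, W i) := by
  let F : ℕ → ℕ → ℝ := fun i j => if i + j < n then τ * (U i * W j) else 0
  have h1 := sum_range_sum_range_eq_antidiagonal F n (fun i j h => if_neg (by lia))
  have h2 : ∑ i ∈ range n, conv (mulScaled τ) U W i =
      ∑ k ∈ range n, ∑ p ∈ antidiagonal k, F p.1 p.2 := by
    refine sum_congr rfl fun k hk => ?_
    rw [conv_apply]
    refine sum_congr rfl fun p hp => ?_
    rw [mem_antidiagonal] at hp
    rw [mem_range] at hk
    simp only [F, hp, if_pos hk]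
    rfl
  rw [h2, ← h1, sum_mul_sum, mul_sum]
  refine sum_le_sum fun i _ => ?_
  rw [mul_sum]
  refine sum_le_sum fun j _ => ?_
  by_cases h : i + j < n
  · simp [F, h]
  · simp only [F, if_neg h]
    exact mul_nonneg hτ (mul_nonneg (hU i) (hW j))

theorem conv_nonneg {τ : ℝ} (hτ : 0 ≤ τ) {U W : ℕ → ℝ} (hU : ∀ k, 0 ≤ U k) (hW : ∀ k, 0 ≤ W k)
    (n : ℕ) : 0 ≤ conv (mulScaled τ) U W n := by
  rw [conv_apply]
  exact sum_nonneg fun p _ => mul_nonneg hτ (mul_nonneg (hU p.1) (hW p.2))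

theorem pow_conv_nonneg {τ : ℝ} (hτ : 0 ≤ τ) {U W : ℕ → ℝ} (hU : ∀ k, 0 ≤ U k)
    (hW : ∀ k, 0 ≤ W k) (k n : ℕ) :
    0 ≤ ((conv (mulScaled τ) U : Module.End ℝ (ℕ → ℝ)) ^ k) W n := by
  induction k generalizing n with
  | zero => simpa using hW n
  | succ k ih =>
    simp only [pow_succ', Module.End.mul_apply]
    exact conv_nonneg hτ hU ih n

theorem opSeries_nonneg {τ : ℝ} (hτ : 0 ≤ τ) {U W : ℕ → ℝ} (hU : ∀ k, 0 ≤ U k)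
    (hW : ∀ k, 0 ≤ W k) (n : ℕ) : 0 ≤ opSeries (PowerSeries.mk 1) (mulScaled τ) U W n := by
  refine sum_nonneg fun k _ => ?_
  simpa using pow_conv_nonneg hτ hU hW k n

/-- Each convolution with U at least halves the bound for the partial sums; the geometric series
contributes the factor 2. -/
theorem sum_opSeries_le {τ : ℝ} (hτ : 0 ≤ τ) {U W : ℕ → ℝ} (hU : ∀ k, 0 ≤ U k)
    (hW : ∀ k, 0 ≤ W k) (n : ℕ) (hS : τ * ∑ i ∈ range n, U i ≤ 1 / 2) :
    ∑ i ∈ range n, opSeries (PowerSeries.mk 1) (mulScaled τ) U W i ≤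
      2 * ∑ i ∈ range n, W i := by
  have hW0 : 0 ≤ ∑ i ∈ range n, W i := sum_nonneg fun i _ => hW i
  have h1 (k : ℕ) : ∑ i ∈ range n, ((conv (mulScaled τ) U : Module.End ℝ (ℕ → ℝ)) ^ k) W i ≤
      (1 / 2) ^ k * ∑ i ∈ range n, W i := by
    induction k with
    | zero => simp
    | succ k ih =>
      simp only [pow_succ', Module.End.mul_apply]
      refine (sum_conv_le hτ hU (pow_conv_nonneg hτ hU hW k) n).trans ?_
      rw [← mul_assoc, mul_assoc (1 / 2 : ℝ)]
      exact mul_le_mul hS ih (sum_nonneg fun i _ => pow_conv_nonneg hτ hU hW k i) (by norm_num)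
  calc ∑ i ∈ range n, opSeries (PowerSeries.mk 1) (mulScaled τ) U W i
      ≤ ∑ i ∈ range n, ∑ k ∈ range n,
          ((conv (mulScaled τ) U : Module.End ℝ (ℕ → ℝ)) ^ k) W i := by
        refine sum_le_sum fun i hi => ?_
        unfold opSeries
        simp only [PowerSeries.coeff_mk, Pi.one_apply, one_smul]
        rw [mem_range] at hi
        exact sum_le_sum_of_subset_of_nonneg (range_subset_range.2 hi)
          fun k _ _ => pow_conv_nonneg hτ hU hW k i
    _ = ∑ k ∈ range n, ∑ i ∈ range n,
          ((conv (mulScaled τ) U : Module.End ℝ (ℕ → ℝ)) ^ k) W i := sum_comm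
    _ ≤ ∑ k ∈ range n, (1 / 2) ^ k * ∑ i ∈ range n, W i := sum_le_sum fun k _ => h1 k
    _ ≤ 2 * ∑ i ∈ range n, W i := by
        rw [← sum_mul]
        exact mul_le_mul_of_nonneg_right (sum_geometric_two_le n) hW0

theorem sum_single_zero_le {v : ℝ} (hv : 0 ≤ v) (n : ℕ) :
    ∑ i ∈ range n, (Pi.single 0 v : ℕ → ℝ) i ≤ v := by
  cases n with
  | zero => simpa using hv
  | succ n => simp

theorem single_zero_nonneg {v : ℝ} (hv : 0 ≤ v) (n : ℕ) : 0 ≤ (Pi.single 0 v : ℕ → ℝ) n := by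
  cases n <;> simp [hv]

theorem IsMajorant.nonneg {τ d v v' : ℝ} {U : ℕ → ℝ} (hU : IsMajorant τ d v v' U) (hτ : 0 ≤ τ)
    (hd : 0 ≤ d) (hv : 0 ≤ v) (hv' : 0 ≤ v') (k : ℕ) : 0 ≤ U k := by
  suffices H : ∀ i ≤ k, 0 ≤ U i from H k le_rfl
  induction k with
  | zero =>
    intro i hi
    obtain rfl : i = 0 := by lia
    rw [hU.zero]
  | succ k ih =>
    intro i hi
    rcases Nat.lt_or_ge k i with hik | hik
    swap
    · exact ih i hik
    obtain rfl : i = k + 1 := by lia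
    -- Nonnegativity is known so far only up to k; by causality U may be cut off there.
    let U' : ℕ → ℝ := fun i => if i ≤ k then U i else 0
    have hU' (i : ℕ) : 0 ≤ U' i := by
      by_cases h : i ≤ k
      · simpa [U', h] using ih i h
      · simp [U', h]
    have e : ∀ i ≤ k, U i = U' i := fun i h => by simp [U', h]
    rw [hU.succ, majorantField, opSeries_congr _ _ e (opSeries_congr _ _ e fun _ _ => rfl) k le_rfl,
      opSeries_congr _ _ e (fun _ _ => rfl) k le_rfl]
    exact add_nonneg (add_nonneg (opSeries_nonneg hτ hU' (opSeries_nonneg hτ hU'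
      (single_zero_nonneg hv)) k) (opSeries_nonneg hτ hU' (single_zero_nonneg hv') k))
      (mul_nonneg hd (ih k le_rfl))

/-- The ball of radius M is invariant under the recursion: as long as τM ≤ 1/2, each geometric
operator costs a factor 2, so the nested one on v costs 4 and the single one on v' costs 2. -/
theorem IsMajorant.sum_le {τ d v v' M : ℝ} {U : ℕ → ℝ} (hU : IsMajorant τ d v v' U) (hτ : 0 ≤ τ)
    (hd : 0 ≤ d) (hv : 0 ≤ v) (hv' : 0 ≤ v') (hM : 0 ≤ M) (hτM : τ * M ≤ 1 / 2)
    (h : 4 * v + 2 * v' + d * M ≤ M) (n : ℕ) : ∑ i ∈ range n, U i ≤ M := by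
  have h0 := hU.nonneg hτ hd hv hv'
  induction n with
  | zero => simpa using hM
  | succ n ih =>
    have hS : τ * ∑ i ∈ range n, U i ≤ 1 / 2 := (mul_le_mul_of_nonneg_left ih hτ).trans hτM
    rw [sum_range_succ', hU.zero, add_zero, sum_congr rfl fun k _ => hU.succ k]
    unfold majorantField
    rw [sum_add_distrib, sum_add_distrib, ← mul_sum]
    have a1 := sum_opSeries_le hτ h0 (opSeries_nonneg hτ h0 (single_zero_nonneg hv)) n hS
    have a2 := sum_opSeries_le hτ h0 (single_zero_nonneg hv) n hS
    have a3 := sum_opSeries_le hτ h0 (single_zero_nonneg hv') n hS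
    have a4 := sum_single_zero_le hv n
    have a5 := sum_single_zero_le hv' n
    have a6 := mul_le_mul_of_nonneg_left ih hd
    linarith

end Flow

/-! ### Coefficientwise extensions -/

section Coefficientwise

variable {K V W A A' : Type*} [Field K] [AddCommGroup V] [Module K V] [AddCommGroup W] [Module K W]
  [Ring A] [Algebra K A] [Ring A'] [Algebra K A']

theorem sum_antidiagonal_assoc {M : Type*} [AddCommMonoid M] (f : ℕ → ℕ → ℕ → M) (n : ℕ) :
    ∑ p ∈ antidiagonal n, ∑ q ∈ antidiagonal p.2, f p.1 q.1 q.2 =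
      ∑ p ∈ antidiagonal n, ∑ q ∈ antidiagonal p.1, f q.1 q.2 p.2 := by
  simp only [sum_sigma']
  refine sum_bij' (fun x _ => ⟨(x.1.1 + x.2.1, x.2.2), (x.1.1, x.2.1)⟩)
    (fun x _ => ⟨(x.2.1, x.2.2 + x.1.2), (x.2.2, x.1.2)⟩) ?_ ?_ ?_ ?_
    (fun _ _ => rfl) <;>
  · rintro ⟨⟨a, b⟩, ⟨c, d⟩⟩ h
    simp only [mem_sigma, mem_antidiagonal] at h ⊢
    obtain ⟨rfl, rfl⟩ := h
    all_goals first | rfl | (constructor <;> lia)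

theorem sum_antidiagonal_left_comm {M : Type*} [AddCommMonoid M] (f : ℕ → ℕ → ℕ → M) (n : ℕ) :
    ∑ p ∈ antidiagonal n, ∑ q ∈ antidiagonal p.2, f p.1 q.1 q.2 =
      ∑ p ∈ antidiagonal n, ∑ q ∈ antidiagonal p.2, f q.1 p.1 q.2 := by
  rw [sum_antidiagonal_assoc, sum_antidiagonal_assoc fun a b c => f b a c]
  refine sum_congr rfl fun p _ => ?_
  exact Finset.Nat.sum_antidiagonal_swap (f := fun q : ℕ × ℕ => f q.2 q.1 p.2) (n := p.1)

/-- The coefficientwise map `V[[t]] → A[[t]]` of a linear map `V → A`. -/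
def seqMap (f : V →ₗ[K] A) : (ℕ → V) →ₗ[K] PowerSeries A where
  toFun u := PowerSeries.mk fun n => f (u n)
  map_add' u w := by ext n; simp
  map_smul' c u := by ext n; simp

theorem coeff_seqMap (f : V →ₗ[K] A) (u : ℕ → V) (n : ℕ) :
    PowerSeries.coeff n (seqMap f u) = f (u n) := by
  simp [seqMap]

/-- The coefficientwise map `A[[t]] → A'[[t]]` of a linear map `A → A'`. -/
def coeffMap (f : A →ₗ[K] A') : PowerSeries A →ₗ[K] PowerSeries A' where
  toFun u := PowerSeries.mk fun n => f (PowerSeries.coeff n u)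
  map_add' u w := by ext n; simp
  map_smul' c u := by ext n; simp

theorem coeff_coeffMap (f : A →ₗ[K] A') (u : PowerSeries A) (n : ℕ) :
    PowerSeries.coeff n (coeffMap f u) = f (PowerSeries.coeff n u) := by
  simp [coeffMap]

theorem keepsOrder_coeffMap (f : A →ₗ[K] A') : KeepsOrder (coeffMap f) := fun w n hw i hi => by
  rw [coeff_coeffMap, hw i hi, map_zero]

theorem coeffMap_mul {D : Module.End K A} (hD : ∀ X Y, D (X * Y) = X * D Y + D X * Y)
    (X Y : PowerSeries A) : coeffMap D (X * Y) = X * coeffMap D Y + coeffMap D X * Y := by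
  ext n
  simp only [coeff_coeffMap, PowerSeries.coeff_mul, map_sum, map_add, hD, sum_add_distrib]

/-- The extension of a family of endomorphisms of `A` to an action of `V[[t]]` on `A[[t]]`. -/
def seqEnd (D : V →ₗ[K] Module.End K A) : (ℕ → V) →ₗ[K] Module.End K (PowerSeries A) :=
  LinearMap.mk₂ K (fun u Y => PowerSeries.mk fun n =>
      ∑ p ∈ antidiagonal n, D (u p.1) (PowerSeries.coeff p.2 Y))
    (fun u u' w => by ext n; simp [sum_add_distrib])
    (fun c u w => by ext n; simp [smul_sum])
    (fun u w w' => by ext n; simp [sum_add_distrib])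
    (fun c u w => by ext n; simp [smul_sum])

theorem coeff_seqEnd (D : V →ₗ[K] Module.End K A) (u : ℕ → V) (Y : PowerSeries A) (n : ℕ) :
    PowerSeries.coeff n (seqEnd D u Y) =
      ∑ p ∈ antidiagonal n, D (u p.1) (PowerSeries.coeff p.2 Y) := by
  simp [seqEnd]

theorem seqEnd_mul {D : V →ₗ[K] Module.End K A}
    (hD : ∀ x X Y, D x (X * Y) = X * D x Y + D x X * Y) (u : ℕ → V) (X Y : PowerSeries A) :
    seqEnd D u (X * Y) = X * seqEnd D u Y + seqEnd D u X * Y := by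
  ext n
  simp only [coeff_seqEnd, PowerSeries.coeff_mul, map_add, map_sum, hD, sum_add_distrib, mul_sum,
    sum_mul]
  congr 1
  · exact sum_antidiagonal_left_comm (fun a b c => PowerSeries.coeff b X *
      D (u a) (PowerSeries.coeff c Y)) n
  · exact sum_antidiagonal_assoc (fun a b c => D (u a) (PowerSeries.coeff b X) *
      PowerSeries.coeff c Y) n

theorem raisesOrder_seqEnd (D : V →ₗ[K] Module.End K A) {u : ℕ → V} (hu : u 0 = 0) :
    RaisesOrder (seqEnd D u) := fun w n hw i hi => by
  rw [coeff_seqEnd]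
  refine sum_eq_zero fun p hp => ?_
  have := mem_antidiagonal.1 hp
  by_cases h : p.1 = 0
  · rw [h, hu, map_zero, LinearMap.zero_apply]
  · rw [hw p.2 (by lia), map_zero]

/-- The formal derivative. -/
def derivPS (K : Type*) {A : Type*} [Field K] [Ring A] [Algebra K A] :
    Module.End K (PowerSeries A) where
  toFun u := PowerSeries.mk fun n => ((n : K) + 1) • PowerSeries.coeff (n + 1) u
  map_add' u w := by ext n; simp
  map_smul' c u := by ext n; simp [smul_comm c]

theorem coeff_derivPS (u : PowerSeries A) (n : ℕ) : PowerSeries.coeff n (derivPS K u) =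
    ((n : K) + 1) • PowerSeries.coeff (n + 1) u := by
  simp [derivPS]

theorem losesOne_derivPS : LosesOne (derivPS K : Module.End K (PowerSeries A)) :=
  fun w n hw i hi => by rw [coeff_derivPS, hw (i + 1) hi, smul_zero]

theorem derivPS_mul (X Y : PowerSeries A) :
    derivPS K (X * Y) = X * derivPS K Y + derivPS K X * Y := by
  ext n
  rw [coeff_derivPS, PowerSeries.coeff_mul, smul_antidiagonal_succ
    (fun i j => PowerSeries.coeff i X * PowerSeries.coeff j Y), map_add, PowerSeries.coeff_mul,
    PowerSeries.coeff_mul, add_comm]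
  simp only [coeff_derivPS, mul_smul_comm, smul_mul_assoc]

theorem seqMap_opSeries {f : W →ₗ[K] A} {B : V →ₗ[K] W →ₗ[K] W} {u : ℕ → V}
    {T : Module.End K (PowerSeries A)} (h : ∀ w, seqMap f (conv B u w) = T (seqMap f w))
    (c : PowerSeries K) (w : ℕ → W) :
    seqMap f (opSeries c B u w) = opCalc c T (seqMap f w) := by
  have hk (k : ℕ) : seqMap f (((conv B u : Module.End K (ℕ → W)) ^ k) w) =
      (T ^ k) (seqMap f w) := by
    induction k with
    | zero => rfl
    | succ k ih => rw [pow_succ', pow_succ', Module.End.mul_apply, Module.End.mul_apply, h, ih]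
  ext n
  simp only [coeff_seqMap, opCalc, coeff_fsum, opSeries, map_sum, map_smul, ← hk,
    PowerSeries.coeff_smul]

/-- A multiplicative operator that does not lower the order commutes with the exponential. -/
theorem map_expPS {T : PowerSeries A →ₗ[K] PowerSeries A'} (hT : KeepsOrder T) (h1 : T 1 = 1)
    (hmul : ∀ X Y, T (X * Y) = T X * T Y) {u : PowerSeries A} (hu : PowerSeries.coeff 0 u = 0) :
    T (expPS K u) = expPS K (T u) := by
  have hp (k : ℕ) : T (u ^ k) = T u ^ k := by
    induction k with
    | zero => rw [pow_zero, pow_zero, h1]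
    | succ k ih => rw [pow_succ, pow_succ, hmul, ih]
  rw [expPS_eq_fsum, hT.map_fsum ((orderGe_pow hu).smul _), expPS_eq_fsum]
  simp only [map_smul, hp]

/-- `c(T)` as a linear operator. -/
def opCalcLinear (c : PowerSeries K) (T : Module.End K (PowerSeries A)) :
    Module.End K (PowerSeries A) where
  toFun := opCalc c T
  map_add' w w' := opCalc_add_right c T w w'
  map_smul' a w := by
    ext n
    simp [opCalc, coeff_fsum, smul_sum, smul_comm a]

theorem keepsOrder_opCalcLinear (c : PowerSeries K) {T : Module.End K (PowerSeries A)}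
    (hT : RaisesOrder T) : KeepsOrder (opCalcLinear c T) := fun w n hw i hi => by
  change PowerSeries.coeff i (opCalc c T w) = 0
  rw [opCalc, coeff_fsum]
  refine sum_eq_zero fun k _ => ?_
  rw [PowerSeries.coeff_smul, hT.pow_apply hw k i (by lia), smul_zero]

/-- `e^D` commutes with the exponential for a derivation `D`. -/
theorem opCalc_exp_expPS [CharZero K] {D : Module.End K (PowerSeries A)} (hD : RaisesOrder D)
    (hmul : ∀ X Y, D (X * Y) = X * D Y + D X * Y) {u : PowerSeries A}
    (hu : PowerSeries.coeff 0 u = 0) :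
    opCalc (expS K) D (expPS K u) = expPS K (opCalc (expS K) D u) := by
  refine map_expPS (T := opCalcLinear (expS K) D) (keepsOrder_opCalcLinear _ hD) ?_
    (opCalc_exp_mul hD hD fun X Y => by rw [hmul, add_comm]) hu
  change fsum _ = _
  have h1 : D 1 = 0 := by simpa using hmul 1 1
  ext n
  rw [coeff_fsum, sum_eq_single 0]
  · simp [expS]
  · intro k _ hk
    obtain ⟨k, rfl⟩ := Nat.exists_eq_succ_of_ne_zero hk
    rw [Nat.succ_eq_add_one, pow_succ, Module.End.mul_apply, h1, map_zero, smul_zero, map_zero]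
  · simp

end Coefficientwise

/-! ### Lie algebras mapped to associative algebras -/

section LieRep

variable {K V A V' A' : Type*} [Field K] [AddCommGroup V] [Module K V] [Ring A] [Algebra K A]
  [AddCommGroup V'] [Module K V'] [Ring A'] [Algebra K A']

/-- A bracket on `V` and a linear map `V → A` that sends it to the commutator. -/
structure LieRep (K V A : Type*) [Field K] [AddCommGroup V] [Module K V] [Ring A]
    [Algebra K A] where
  br : V →ₗ[K] V →ₗ[K] V
  j : V →ₗ[K] A
  j_br : ∀ x y, j (br x y) = j x * j y - j y * j x

/-- The extension to formal power series. -/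
def LieRep.series (E : LieRep K V A) : LieRep K (ℕ → V) (PowerSeries A) where
  br := conv E.br
  j := seqMap E.j
  j_br u w := by
    ext n
    rw [coeff_seqMap, conv_apply, map_sum, map_sub, PowerSeries.coeff_mul, PowerSeries.coeff_mul,
      ← Finset.Nat.sum_antidiagonal_swap (n := n)
        (f := fun p => PowerSeries.coeff p.1 (seqMap E.j w) * _), ← sum_sub_distrib]
    simp only [E.j_br, coeff_seqMap, Prod.fst_swap, Prod.snd_swap]

/-- Compatible data for a crossed morphism `φ` from `V` to `V'`, relative to the action `act` of
`V` on `V'` which extends to derivations `D` of `A'`, with a map `θ : A → A'` over `φ`. -/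
structure Crossed (E : LieRep K V A) (E' : LieRep K V' A') where
  φ : V →ₗ[K] V'
  act : V →ₗ[K] V' →ₗ[K] V'
  D : V →ₗ[K] Module.End K A'
  D_mul : ∀ x X Y, D x (X * Y) = X * D x Y + D x X * Y
  D_j : ∀ x y, D x (E'.j y) = E'.j (act x y)
  θ : A →ₗ[K] A'
  θ_one : θ 1 = 1
  θ_mul : ∀ x X, θ (E.j x * X) = D x (θ X) + E'.j (φ x) * θ X

variable {E : LieRep K V A} {E' : LieRep K V' A'}

/-- The extension to formal power series. -/
def Crossed.series (C : Crossed E E') : Crossed E.series E'.series where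
  φ := C.φ.compLeft ℕ
  act := conv C.act
  D := seqEnd C.D
  D_mul := seqEnd_mul C.D_mul
  D_j u w := by
    ext n
    change PowerSeries.coeff n (seqEnd C.D u (seqMap E'.j w)) =
      PowerSeries.coeff n (seqMap E'.j (conv C.act u w))
    simp only [coeff_seqEnd, coeff_seqMap, conv_apply, map_sum, C.D_j]
  θ := coeffMap C.θ
  θ_one := by
    ext n
    rw [coeff_coeffMap, PowerSeries.coeff_one, PowerSeries.coeff_one]
    split_ifs
    · exact C.θ_one
    · exact map_zero _
  θ_mul u X := by
    ext n
    change PowerSeries.coeff n (coeffMap C.θ (seqMap E.j u * X)) = PowerSeries.coeff n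
      (seqEnd C.D u (coeffMap C.θ X) + seqMap E'.j (C.φ.compLeft ℕ u) * coeffMap C.θ X)
    simp only [coeff_coeffMap, coeff_seqEnd, PowerSeries.coeff_mul, map_add, map_sum, coeff_seqMap,
      C.θ_mul, sum_add_distrib]
    rfl

theorem Crossed.θ_j (C : Crossed E E') (x : V) : C.θ (E.j x) = E'.j (C.φ x) := by
  have h1 : C.D x 1 = 0 := by simpa using C.D_mul x 1 1
  simpa [C.θ_one, h1] using C.θ_mul x 1

theorem LieRep.coeff_zero_series_j (E : LieRep K V A) {u : ℕ → V} (hu : u 0 = 0) :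
    PowerSeries.coeff 0 (E.series.j u) = 0 := by
  change PowerSeries.coeff 0 (seqMap E.j u) = 0
  rw [coeff_seqMap, hu, map_zero]

theorem opSeries_zero_op (c : PowerSeries K) (u : ℕ → V) (w : ℕ → V') :
    opSeries c (0 : V →ₗ[K] V' →ₗ[K] V') u w = PowerSeries.coeff 0 c • w := by
  have hc : (conv (0 : V →ₗ[K] V' →ₗ[K] V') u : Module.End K (ℕ → V')) = 0 := by
    ext w n
    simp [conv_apply]
  ext n
  rw [opSeries, sum_eq_single 0]
  · simp
  · intro k _ hk
    rw [hc, zero_pow hk]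
    simp
  · simp

variable [CharZero K]

/-- `θ(e^u b) = θ(e^u) e^(D_u)(θ b)`. -/
theorem Crossed.θ_expPS_mul (C : Crossed E E') {u : ℕ → V} (hu : u 0 = 0) (b : PowerSeries A) :
    C.series.θ (expPS K (E.series.j u) * b) = C.series.θ (expPS K (E.series.j u)) *
      opCalc (expS K) (C.series.D u) (C.series.θ b) := by
  set S := C.series
  have hD : RaisesOrder (S.D u) := raisesOrder_seqEnd C.D hu
  have hju := E.coeff_zero_series_j hu
  have hφ : (S.φ u) 0 = 0 := by
    change C.φ (u 0) = 0
    rw [hu, map_zero]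
  -- T is the action M(u), and θ intertwines left multiplication by u with T.
  let T : Module.End K (PowerSeries A') := S.D u + LinearMap.mulLeft K (E'.series.j (S.φ u))
  have hT : RaisesOrder T := hD.add (raisesOrder_mulLeft (E'.coeff_zero_series_j hφ))
  have hpow (k : ℕ) (b : PowerSeries A) : S.θ (E.series.j u ^ k * b) = (T ^ k) (S.θ b) := by
    induction k with
    | zero => simp
    | succ k ih => rw [pow_succ', mul_assoc, S.θ_mul, ih, pow_succ']; rfl
  have hexp (b : PowerSeries A) :
      S.θ (expPS K (E.series.j u) * b) = opCalc (expS K) T (S.θ b) := by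
    have h1 := (keepsOrder_mulRight (K := K) b).map_fsum
      ((orderGe_pow hju).smul fun k => (k.factorial : K)⁻¹)
    rw [← expPS_eq_fsum, LinearMap.mulRight_apply] at h1
    rw [h1, show S.θ = coeffMap C.θ from rfl, (keepsOrder_coeffMap C.θ).map_fsum]
    · unfold opCalc
      congr 1
      ext1 k
      rw [LinearMap.mulRight_apply, smul_mul_assoc, map_smul, expS, PowerSeries.coeff_mk]
      exact congrArg _ (hpow k b)
    · intro k n hn
      exact keepsOrder_mulRight (K := K) b _ k
        (((orderGe_pow hju).smul fun k => (k.factorial : K)⁻¹) k) n hn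
  -- Now θ(e^u b) = e^T(1·θ b), and T(XY) = T(X)Y + X D(Y) splits this into e^T(1)·e^D(θ b).
  rw [hexp b, ← mul_one (expPS K (E.series.j u)), hexp 1, S.θ_one]
  rw [← opCalc_exp_mul hT hD, one_mul]
  intro X Y
  simp only [T, LinearMap.add_apply, LinearMap.mulLeft_apply, S.D_mul, add_mul, mul_assoc]
  abel

/-- The exponential of the solution of the equation of Magnus type. -/
theorem derivPS_expPS_flow (E : LieRep K V A) {B₂ : V →ₗ[K] V →ₗ[K] V} {δ : V →ₗ[K] V}
    {D : Module.End K A} (hD : ∀ X Y, D (X * Y) = X * D Y + D X * Y)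
    (hj : ∀ x, D (E.j x) = E.j (δ x)) {v v' : V} {Ω : ℕ → V} (hΩ : IsFlow E.br B₂ δ v v' Ω) :
    derivPS K (expPS K (E.series.j Ω)) =
      expPS K (E.series.j Ω) * E.series.j (opSeries (expNegS K) B₂ Ω (Pi.single 0 v)) +
      E.series.j (Pi.single 0 v') * expPS K (E.series.j Ω) +
      coeffMap D (expPS K (E.series.j Ω)) := by
  have hu := E.coeff_zero_series_j hΩ.zero
  set u := E.series.j Ω with hudef
  have had := raisesOrder_adj (K := K) hu
  have hbr (w : ℕ → V) : seqMap E.j (conv E.br Ω w) = adj K u (seqMap E.j w) :=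
    E.series.j_br Ω w
  have h1 : derivPS K u = opCalc (todd K) (adj K u)
      (E.series.j (opSeries (expNegS K) B₂ Ω (Pi.single 0 v))) +
      opCalc (toddNeg K) (adj K u) (E.series.j (Pi.single 0 v')) + coeffMap D u := by
    have e1 := seqMap_opSeries hbr (todd K) (opSeries (expNegS K) B₂ Ω (Pi.single 0 v))
    have e2 := seqMap_opSeries hbr (toddNeg K) (Pi.single 0 v')
    ext n
    rw [map_add, map_add]
    have e1' := congrArg (PowerSeries.coeff n) e1
    have e2' := congrArg (PowerSeries.coeff n) e2
    rw [coeff_seqMap] at e1' e2'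
    change _ = PowerSeries.coeff n (opCalc (todd K) (adj K u) (seqMap E.j _)) +
      PowerSeries.coeff n (opCalc (toddNeg K) (adj K u) (seqMap E.j _)) + _
    rw [← e1', ← e2', coeff_coeffMap, coeff_derivPS]
    change ((n : K) + 1) • PowerSeries.coeff (n + 1) (seqMap E.j Ω) = _ + _ +
      D (PowerSeries.coeff n (seqMap E.j Ω))
    rw [coeff_seqMap, coeff_seqMap, hj, ← map_smul, hΩ.succ, magnusField, map_add, map_add]
  -- With G(ad u) applied to Ω': G·F = 1 leaves e^u times the first term; G(X)·F(-X) = e^{-X} gives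
  -- e^u e^{-ad u}(v') = v' e^u; and e^u G(ad u)(D u) = D e^u.
  rw [derivation_expPS losesOne_derivPS derivPS_mul hu, h1, opCalc_add_right, opCalc_add_right,
    ← opCalc_mul had, ← opCalc_mul had, dexpS_mul_todd, dexpS_mul_toddNeg, opCalc_one, mul_add,
    mul_add, ← mul_expPS hu, ← derivation_expPS (keepsOrder_coeffMap D).losesOne (coeffMap_mul hD)
    hu]

/-- The coefficients of the exponential of the solution when `B₂ = 0`. -/
theorem coeff_succ_expPS_flow (E : LieRep K V A) {δ : V →ₗ[K] V}
    {D : Module.End K A} (hD : ∀ X Y, D (X * Y) = X * D Y + D X * Y)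
    (hj : ∀ x, D (E.j x) = E.j (δ x)) {v v' : V} {Ω : ℕ → V} (hΩ : IsFlow E.br 0 δ v v' Ω) (k : ℕ) :
    ((k : K) + 1) • PowerSeries.coeff (k + 1) (expPS K (E.series.j Ω)) =
      PowerSeries.coeff k (expPS K (E.series.j Ω)) * E.j v +
      E.j v' * PowerSeries.coeff k (expPS K (E.series.j Ω)) +
      D (PowerSeries.coeff k (expPS K (E.series.j Ω))) := by
  have h := congrArg (PowerSeries.coeff k) (derivPS_expPS_flow E hD hj hΩ)
  have hs (v : V) : E.series.j (Pi.single 0 v) = PowerSeries.C (E.j v) := by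
    ext n
    change PowerSeries.coeff n (seqMap E.j _) = _
    rw [coeff_seqMap, PowerSeries.coeff_C, Pi.single_apply]
    split_ifs <;> simp
  rw [opSeries_zero_op, show PowerSeries.coeff 0 (expNegS K) = 1 by simp [expNegS], one_smul, hs,
    hs, coeff_derivPS, map_add, map_add, PowerSeries.coeff_mul_C, PowerSeries.coeff_C_mul,
    coeff_coeffMap] at h
  exact h

/-- The exponential of the solution of the equation of the post-Lie Magnus expansion. -/
theorem Crossed.θ_expPS_flow (C : Crossed E E') {ψ : V' →ₗ[K] V} (hψ : ∀ y, C.φ (ψ y) = y)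
    {B₂ : V →ₗ[K] V →ₗ[K] V} (hB₂ : ∀ x y, B₂ x y = ψ (C.act x (C.φ y))) {a : V'} {Ω : ℕ → V}
    (hΩ : IsFlow E.br B₂ 0 (ψ a) 0 Ω) (k : ℕ) :
    PowerSeries.coeff k (C.series.θ (expPS K (E.series.j Ω))) =
      (k.factorial : K)⁻¹ • E'.j a ^ k := by
  have h := derivPS_expPS_flow E (D := 0) (by simp) (by simp) hΩ
  have h0 : E.series.j (Pi.single 0 (0 : V)) = 0 := by rw [Pi.single_zero, map_zero]
  have hz : coeffMap (0 : Module.End K A) (expPS K (E.series.j Ω)) = 0 := by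
    ext n
    rw [coeff_coeffMap]
    simp
  rw [h0, hz, zero_mul, add_zero, add_zero] at h
  set w := opSeries (expNegS K) B₂ Ω (Pi.single 0 (ψ a)) with hw
  -- B₂ is the action conjugated by φ, so φ carries e^{-B₂(Ω)} ψ(a) to e^{-act(Ω)} a.
  have hφw : C.series.φ w = opSeries (expNegS K) C.act Ω (Pi.single 0 a) := by
    have hk (k : ℕ) : C.series.φ (((conv B₂ Ω : Module.End K (ℕ → V)) ^ k)
        (Pi.single 0 (ψ a))) =
        ((conv C.act Ω : Module.End K (ℕ → V')) ^ k) (Pi.single 0 a) := by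
      induction k with
      | zero =>
        ext n
        change C.φ ((Pi.single 0 (ψ a) : ℕ → V) n) = (Pi.single 0 a : ℕ → V') n
        rw [Pi.single_apply, Pi.single_apply]
        split_ifs
        · exact hψ a
        · exact map_zero _
      | succ k ih =>
        rw [pow_succ', pow_succ', Module.End.mul_apply, Module.End.mul_apply, ← ih]
        ext n
        change C.φ (conv B₂ Ω _ n) = conv C.act Ω _ n
        rw [conv_apply, conv_apply, map_sum]
        refine sum_congr rfl fun p _ => ?_
        rw [hB₂, hψ]
        rfl
    ext n
    change C.φ (w n) = _
    rw [hw, opSeries, opSeries, map_sum]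
    refine sum_congr rfl fun k _ => ?_
    rw [map_smul, ← hk]
    rfl
  have hDr : RaisesOrder (C.series.D Ω) := raisesOrder_seqEnd C.D hΩ.zero
  have h1 : opCalc (expS K) (C.series.D Ω) (C.series.θ (E.series.j w)) =
      PowerSeries.C (E'.j a) := by
    rw [C.series.θ_j, hφw]
    refine (congrArg _ (seqMap_opSeries (T := C.series.D Ω)
      (fun w => (C.series.D_j Ω w).symm) (expNegS K) (Pi.single 0 a))).trans ?_
    rw [← opCalc_mul hDr, expS_mul_expNegS, opCalc_one]
    ext n
    rw [coeff_seqMap, PowerSeries.coeff_C, Pi.single_apply]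
    split_ifs <;> simp
  set Z := expPS K (E.series.j Ω) with hZ
  -- The operator e^{D_Ω} produced by θ(Z w) cancels e^{-act(Ω)}, leaving the equation θ(Z)' = θ(Z)
  -- a of the exponential.
  have h2 (k : ℕ) : ((k : K) + 1) • PowerSeries.coeff (k + 1) (C.series.θ Z) =
      PowerSeries.coeff k (C.series.θ Z) * E'.j a := by
    have e : C.series.θ (derivPS K Z) = C.series.θ Z * PowerSeries.C (E'.j a) := by
      rw [h, hZ, C.θ_expPS_mul hΩ.zero, h1]
    have e' := congrArg (PowerSeries.coeff k) e
    rw [PowerSeries.coeff_mul_C] at e'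
    rw [← e']
    change ((k : K) + 1) • PowerSeries.coeff (k + 1) (coeffMap C.θ Z) =
      PowerSeries.coeff k (coeffMap C.θ (derivPS K Z))
    rw [coeff_coeffMap, coeff_coeffMap, coeff_derivPS, map_smul]
  induction k with
  | zero =>
    change PowerSeries.coeff 0 (coeffMap C.θ Z) = _
    rw [coeff_coeffMap, hZ, coeff_zero_expPS, C.θ_one]
    simp
  | succ k ih =>
    apply cast_succ_smul_injective (K := K) k
    rw [h2, ih, smul_smul, fact_inv_mul, smul_mul_assoc, pow_succ]

end LieRep

/-! ### Left-invariant vector fields in exponential coordinates -/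

section VectorFields

theorem sum_antidiagonal_swap_middle {M : Type*} [AddCommMonoid M] (f : ℕ → ℕ → ℕ → ℕ → M) (n : ℕ) :
    ∑ p ∈ antidiagonal n, ∑ r ∈ antidiagonal p.1, ∑ q ∈ antidiagonal p.2, f r.1 r.2 q.1 q.2 =
      ∑ p ∈ antidiagonal n, ∑ r ∈ antidiagonal p.1, ∑ q ∈ antidiagonal p.2,
        f r.1 q.1 r.2 q.2 := by
  rw [← sum_antidiagonal_assoc fun a b c => ∑ q ∈ antidiagonal c, f a b q.1 q.2,
    ← sum_antidiagonal_assoc fun a b c => ∑ q ∈ antidiagonal c, f a q.1 b q.2]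
  exact sum_congr rfl fun p _ => sum_antidiagonal_left_comm (fun a b c => f p.1 a b c) p.2

variable {K h σ : Type*} [Field K] [LieRing h] [LieAlgebra K h]

/-- The pointwise Lie bracket of `h`-valued polynomials. -/
def fbr (K σ h : Type*) [Field K] [LieRing h] [LieAlgebra K h] :
    (MvPolynomial σ K ⊗[K] h) →ₗ[K] (MvPolynomial σ K ⊗[K] h) →ₗ[K] (MvPolynomial σ K ⊗[K] h) :=
  (LieAlgebra.ad K (MvPolynomial σ K ⊗[K] h) : (MvPolynomial σ K ⊗[K] h) →ₗ[K] _)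

theorem fbr_tmul (p q : MvPolynomial σ K) (x y : h) :
    fbr K σ h (p ⊗ₜ x) (q ⊗ₜ y) = (p * q) ⊗ₜ ⁅x, y⁆ := rfl

theorem fbr_skew (a b : MvPolynomial σ K ⊗[K] h) : fbr K σ h a b = -fbr K σ h b a :=
  (lie_skew a b).symm

theorem fbr_leibniz (a b c : MvPolynomial σ K ⊗[K] h) :
    fbr K σ h a (fbr K σ h b c) = fbr K σ h (fbr K σ h a b) c + fbr K σ h b (fbr K σ h a c) :=
  LieRing.leibniz_lie a b c

variable [Fintype σ] (e : Module.Basis σ K h)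

/-- The derivative of polynomials on `h` in the direction of a vector of `h`. -/
def dirDeriv : h →ₗ[K] Derivation K (MvPolynomial σ K) (MvPolynomial σ K) :=
  ∑ i, (e.coord i).smulRight (MvPolynomial.pderiv i)

theorem dirDeriv_X (y : h) (i : σ) :
    dirDeriv e y (MvPolynomial.X i) = MvPolynomial.C (e.repr y i) := by
  classical
  have h1 : dirDeriv e y (MvPolynomial.X i) =
      ∑ j, e.repr y j • MvPolynomial.pderiv j (MvPolynomial.X i : MvPolynomial σ K) := by
    rw [dirDeriv, LinearMap.sum_apply]
    exact map_sum (⟨⟨fun D : Derivation K (MvPolynomial σ K) (MvPolynomial σ K) =>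
      D (MvPolynomial.X i), rfl⟩, fun _ _ => rfl⟩ :
        Derivation K (MvPolynomial σ K) (MvPolynomial σ K) →+ MvPolynomial σ K) _ _
  rw [h1, Finset.sum_eq_single i]
  · simp [MvPolynomial.smul_eq_C_mul]
  · intro j _ hj
    simp [MvPolynomial.pderiv_X, hj.symm]
  · simp

theorem dirDeriv_basis (i : σ) : dirDeriv e (e i) = MvPolynomial.pderiv i := by
  classical
  apply MvPolynomial.derivation_ext
  intro j
  rw [dirDeriv_X, MvPolynomial.pderiv_X, e.repr_self, Finsupp.single_apply, Pi.single_apply]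
  by_cases hij : i = j
  · simp [hij]
  · simp [hij, Ne.symm hij]

theorem dirDeriv_comm (y y' : h) (p : MvPolynomial σ K) :
    dirDeriv e y (dirDeriv e y' p) = dirDeriv e y' (dirDeriv e y p) := by
  have : ⁅dirDeriv e y, dirDeriv e y'⁆ = 0 := by
    apply MvPolynomial.derivation_ext
    intro i
    rw [Derivation.commutator_apply, dirDeriv_X, dirDeriv_X]
    simp
  have := congrArg (fun D => D p) this
  simpa [Derivation.commutator_apply, sub_eq_zero] using this

/-- Polynomial vector fields on `h`, as derivations. -/
def vecDeriv : (MvPolynomial σ K ⊗[K] h) →ₗ[MvPolynomial σ K]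
    Derivation K (MvPolynomial σ K) (MvPolynomial σ K) :=
  (dirDeriv e).liftBaseChange (MvPolynomial σ K)

theorem vecDeriv_tmul (p : MvPolynomial σ K) (y : h) :
    vecDeriv e (p ⊗ₜ y) = p • dirDeriv e y := by
  simp [vecDeriv]

/-- The covariant derivative of vector fields for the flat connection on `h`. -/
def nabla : (MvPolynomial σ K ⊗[K] h) →ₗ[MvPolynomial σ K]
    ((MvPolynomial σ K ⊗[K] h) →ₗ[K] (MvPolynomial σ K ⊗[K] h)) :=
  LinearMap.liftBaseChange (MvPolynomial σ K)
    { toFun := fun y => LinearMap.rTensor h (dirDeriv e y : MvPolynomial σ K →ₗ[K] MvPolynomial σ K)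
      map_add' := fun y y' => by
        rw [← LinearMap.rTensor_add, map_add]
        rfl
      map_smul' := fun c y => by
        rw [RingHom.id_apply, ← LinearMap.rTensor_smul, map_smul]
        rfl }

theorem nabla_tmul_tmul (p q : MvPolynomial σ K) (y x : h) :
    nabla e (p ⊗ₜ y) (q ⊗ₜ x) = (p * dirDeriv e y q) ⊗ₜ x := by
  simp [nabla, TensorProduct.smul_tmul']

/-- The pointwise bracket has constant structure constants, so it is parallel for the flat
connection. -/
theorem nabla_fbr (a b c : MvPolynomial σ K ⊗[K] h) :
    nabla e a (fbr K σ h b c) = fbr K σ h (nabla e a b) c + fbr K σ h b (nabla e a c) := by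
  induction a using TensorProduct.induction_on with
  | zero => simp
  | add a a' ha ha' =>
    simp only [map_add, LinearMap.add_apply, ha, ha']
    abel
  | tmul q y =>
    induction b using TensorProduct.induction_on with
    | zero => simp
    | add b b' hb hb' =>
      simp only [map_add, LinearMap.add_apply, hb, hb']
      abel
    | tmul r x =>
      induction c using TensorProduct.induction_on with
      | zero => simp
      | add b b' hb hb' =>
        simp only [map_add, hb, hb']
        abel
      | tmul s w =>
        simp only [fbr_tmul, nabla_tmul_tmul]
        rw [← TensorProduct.add_tmul]
        congr 1
        simp only [smul_eq_mul, Derivation.leibniz]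
        ring

/-- The radial vector field. -/
def radial : MvPolynomial σ K ⊗[K] h := ∑ i, MvPolynomial.X i ⊗ₜ e i

theorem nabla_radial (a : MvPolynomial σ K ⊗[K] h) : nabla e a (radial e) = a := by
  induction a using TensorProduct.induction_on with
  | zero => simp
  | add a a' ha ha' => rw [map_add, LinearMap.add_apply, ha, ha']
  | tmul q y =>
    simp only [radial, map_sum, nabla_tmul_tmul, dirDeriv_X]
    conv_rhs => rw [← e.sum_repr y, TensorProduct.tmul_sum]
    refine sum_congr rfl fun i _ => ?_
    rw [mul_comm, ← MvPolynomial.smul_eq_C_mul, TensorProduct.smul_tmul]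

theorem nabla_one_tmul (a : MvPolynomial σ K ⊗[K] h) (y : h) :
    nabla e a ((1 : MvPolynomial σ K) ⊗ₜ y) = 0 := by
  induction a using TensorProduct.induction_on with
  | zero => simp
  | add a a' ha ha' => rw [map_add, LinearMap.add_apply, ha, ha', add_zero]
  | tmul q x => simp [nabla_tmul_tmul]

/-- The flat connection is free of torsion. -/
theorem vecDeriv_commutator (a b : MvPolynomial σ K ⊗[K] h) (f : MvPolynomial σ K) :
    vecDeriv e a (vecDeriv e b f) - vecDeriv e b (vecDeriv e a f) =
      vecDeriv e (nabla e a b - nabla e b a) f := by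
  induction a using TensorProduct.induction_on with
  | zero => simp
  | add a a' ha ha' =>
    simp only [map_add, map_sub, LinearMap.add_apply, Derivation.add_apply,
      Derivation.sub_apply] at ha ha' ⊢
    linear_combination ha + ha'
  | tmul p y =>
    induction b using TensorProduct.induction_on with
    | zero => simp
    | add b b' hb hb' =>
      simp only [map_add, map_sub, LinearMap.add_apply, Derivation.add_apply,
        Derivation.sub_apply] at hb hb' ⊢
      linear_combination hb + hb'
    | tmul q x =>
      rw [nabla_tmul_tmul, nabla_tmul_tmul, map_sub]
      simp only [vecDeriv_tmul, Derivation.smul_apply, Derivation.sub_apply, smul_eq_mul,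
        Derivation.leibniz, dirDeriv_comm e x y]
      ring

/-- `gₙ adⁿ` for the coefficients `gₙ` of `(1 - e^(-X)) / X`: the Maurer-Cartan form. -/
def maurerCartan (n : ℕ) : (MvPolynomial σ K ⊗[K] h) →ₗ[K] (MvPolynomial σ K ⊗[K] h) :=
  PowerSeries.coeff n (dexpS K) • (fbr K σ h (radial e) : Module.End K (MvPolynomial σ K ⊗[K] h)) ^ n

/-- The coefficients of the left-invariant vector field of a vector of `h`. -/
def leftInv (n : ℕ) : h →ₗ[K] (MvPolynomial σ K ⊗[K] h) :=
  PowerSeries.coeff n (todd K) •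
    (((fbr K σ h (radial e) : Module.End K (MvPolynomial σ K ⊗[K] h)) ^ n) ∘ₗ
      TensorProduct.mk K (MvPolynomial σ K) h 1)

theorem maurerCartan_zero (a : MvPolynomial σ K ⊗[K] h) : maurerCartan e 0 a = a := by
  simp [maurerCartan, dexpS]

/-- With R the radial field, G(ad R) and F(ad R) are inverse, sorted here by degree: the
Maurer-Cartan form takes the constant value y on the left-invariant field of y. -/
theorem sum_maurerCartan_leftInv (y : h) (n : ℕ) :
    ∑ p ∈ antidiagonal n, maurerCartan e p.1 (leftInv e p.2 y) =
      if n = 0 then (1 : MvPolynomial σ K) ⊗ₜ y else 0 := by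
  have h1 : ∑ p ∈ antidiagonal n, maurerCartan e p.1 (leftInv e p.2 y) =
      PowerSeries.coeff n (dexpS K * todd K) •
        ((fbr K σ h (radial e) : Module.End K (MvPolynomial σ K ⊗[K] h)) ^ n)
          ((1 : MvPolynomial σ K) ⊗ₜ y) := by
    rw [PowerSeries.coeff_mul, sum_smul]
    refine sum_congr rfl fun p hp => ?_
    rw [← mem_antidiagonal.1 hp, pow_add, mul_smul]
    simp only [maurerCartan, leftInv, LinearMap.smul_apply, LinearMap.comp_apply,
      Module.End.mul_apply, map_smul, TensorProduct.mk_apply]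
    exact smul_comm _ _ _
  rw [h1, dexpS_mul_todd, PowerSeries.coeff_one]
  split_ifs with hn
  · simp [hn]
  · simp

/-- The derivative of the Maurer-Cartan form. -/
def derivMC (n : ℕ) (a b : MvPolynomial σ K ⊗[K] h) : MvPolynomial σ K ⊗[K] h :=
  nabla e a (maurerCartan e n b) - maurerCartan e n (nabla e a b)

/-- Differentiating the constant ω(L_{y'}) = y' along L_y, where ω is the Maurer-Cartan form and L_y
the left-invariant field of y, gives (∇ω)(L_{y'}) + ω(∇L_{y'}) = 0. -/
theorem sum_maurerCartan_nabla (y y' : h) (n : ℕ) :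
    ∑ p ∈ antidiagonal n, ∑ q ∈ antidiagonal p.2,
        maurerCartan e p.1 (nabla e (leftInv e q.1 y) (leftInv e q.2 y')) =
      -∑ p ∈ antidiagonal n, ∑ q ∈ antidiagonal p.2,
        derivMC e p.1 (leftInv e q.1 y) (leftInv e q.2 y') := by
  have h1 : ∑ p ∈ antidiagonal n, ∑ q ∈ antidiagonal p.2,
      nabla e (leftInv e q.1 y) (maurerCartan e p.1 (leftInv e q.2 y')) = 0 := by
    rw [sum_antidiagonal_left_comm fun a b c =>
      nabla e (leftInv e b y) (maurerCartan e a (leftInv e c y'))]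
    refine sum_eq_zero fun p _ => ?_
    rw [← map_sum, sum_maurerCartan_leftInv]
    split_ifs
    · exact nabla_one_tmul e _ y'
    · exact map_zero _
  rw [← sub_eq_zero, sub_neg_eq_add, ← h1, ← sum_add_distrib]
  refine sum_congr rfl fun p _ => ?_
  rw [← sum_add_distrib]
  refine sum_congr rfl fun q _ => ?_
  rw [derivMC, add_sub_cancel]

/-- The left-invariant vector field of `y`, as a series of differential operators. -/
def fieldOp (y : h) : PowerSeries (Module.End K (MvPolynomial σ K)) :=
  PowerSeries.mk fun n => ((vecDeriv e (leftInv e n y)) : MvPolynomial σ K →ₗ[K] MvPolynomial σ K)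

theorem coeff_fieldOp_apply (y : h) (n : ℕ) (f : MvPolynomial σ K) :
    PowerSeries.coeff n (fieldOp e y) f = vecDeriv e (leftInv e n y) f := by
  rw [fieldOp, PowerSeries.coeff_mk]
  rfl

theorem coeff_zero_fieldOp (y : h) : PowerSeries.coeff 0 (fieldOp e y) =
    (dirDeriv e y : MvPolynomial σ K →ₗ[K] MvPolynomial σ K) := by
  refine LinearMap.ext fun f => ?_
  have h0 : PowerSeries.coeff 0 (todd K) = 1 := by
    have := congrArg (PowerSeries.coeff 0) (dexpS_mul_todd K)
    simpa [PowerSeries.coeff_mul, dexpS] using this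
  rw [coeff_fieldOp_apply, leftInv, h0, one_smul, pow_zero, Module.End.one_eq_id, LinearMap.id_comp,
    TensorProduct.mk_apply, vecDeriv_tmul, one_smul]
  rfl

variable [CharZero K]

theorem maurerCartan_succ (n : ℕ) (a : MvPolynomial σ K ⊗[K] h) :
    ((n : K) + 2) • maurerCartan e (n + 1) a = -fbr K σ h (radial e) (maurerCartan e n a) := by
  have hc : ((n : K) + 2) * PowerSeries.coeff (n + 1) (dexpS K) = -PowerSeries.coeff n (dexpS K) := by
    have := fact_inv_mul (K := K) (n + 1)
    push_cast at this
    simp only [dexpS, PowerSeries.coeff_mk, ← this]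
    ring
  rw [maurerCartan, LinearMap.smul_apply, smul_smul, hc, pow_succ', Module.End.mul_apply,
    maurerCartan, LinearMap.smul_apply, map_smul, neg_smul]

/-- The recursion (n + 2) ω_{n+1} = -[R, ω_n], differentiated with ∇_a R = a. -/
theorem derivMC_succ (n : ℕ) (a b : MvPolynomial σ K ⊗[K] h) :
    ((n : K) + 2) • derivMC e (n + 1) a b =
      -fbr K σ h a (maurerCartan e n b) - fbr K σ h (radial e) (derivMC e n a b) := by
  rw [derivMC, smul_sub, ← map_smul, maurerCartan_succ, maurerCartan_succ, map_neg, nabla_fbr,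
    nabla_radial, derivMC, map_sub]
  abel

/-- For p.1 + p.2 = n + 1 the factor n + 3 is (p.1 + 1) + (p.2 + 1), so the recursion for ω applies
in either slot; the Jacobi identity collects the results into one bracket with R. -/
theorem smul_sum_maurerCartan_lie (n : ℕ) (a b : MvPolynomial σ K ⊗[K] h) :
    ((n : K) + 3) • ∑ p ∈ antidiagonal (n + 1),
        fbr K σ h (maurerCartan e p.1 a) (maurerCartan e p.2 b) =
      fbr K σ h a (maurerCartan e (n + 1) b) + fbr K σ h (maurerCartan e (n + 1) a) b -
      fbr K σ h (radial e) (∑ p ∈ antidiagonal n,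
        fbr K σ h (maurerCartan e p.1 a) (maurerCartan e p.2 b)) := by
  have h1 := Finset.Nat.sum_antidiagonal_succ (n := n)
    (f := fun p => fbr K σ h (((p.1 : K) + 1) • maurerCartan e p.1 a) (maurerCartan e p.2 b))
  have h2 := Finset.Nat.sum_antidiagonal_succ' (n := n)
    (f := fun p => fbr K σ h (maurerCartan e p.1 a) (((p.2 : K) + 1) • maurerCartan e p.2 b))
  simp only [Nat.cast_zero, zero_add, one_smul, maurerCartan_zero, Nat.cast_add, Nat.cast_one,
    add_assoc, one_add_one_eq_two, maurerCartan_succ, map_neg,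
    LinearMap.neg_apply] at h1 h2
  have h3 : ((n : K) + 3) • ∑ p ∈ antidiagonal (n + 1),
      fbr K σ h (maurerCartan e p.1 a) (maurerCartan e p.2 b) =
      ∑ p ∈ antidiagonal (n + 1), fbr K σ h (((p.1 : K) + 1) • maurerCartan e p.1 a) (maurerCartan e p.2 b) +
      ∑ p ∈ antidiagonal (n + 1),
        fbr K σ h (maurerCartan e p.1 a) (((p.2 : K) + 1) • maurerCartan e p.2 b) := by
    rw [smul_sum, ← sum_add_distrib]
    refine sum_congr rfl fun p hp => ?_
    rw [map_smul, map_smul, LinearMap.smul_apply, ← add_smul]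
    congr 1
    have := congrArg (Nat.cast (R := K)) (mem_antidiagonal.1 hp)
    push_cast at this
    linear_combination -this
  rw [h3, h1, h2, map_sum]
  simp only [fbr_leibniz (radial e), sum_add_distrib, sum_neg_distrib]
  abel

/-- The Maurer-Cartan equation. -/
theorem derivMC_sub (n : ℕ) (a b : MvPolynomial σ K ⊗[K] h) :
    derivMC e (n + 1) a b - derivMC e (n + 1) b a =
      -∑ p ∈ antidiagonal n, fbr K σ h (maurerCartan e p.1 a) (maurerCartan e p.2 b) := by
  induction n with
  | zero =>
    apply smul_right_injective _ (two_ne_zero (α := K))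
    have h1 := derivMC_succ e 0 a b
    have h2 := derivMC_succ e 0 b a
    have h0 (a b : MvPolynomial σ K ⊗[K] h) : derivMC e 0 a b = 0 := by
      rw [derivMC, maurerCartan_zero, maurerCartan_zero, sub_self]
    simp only [Nat.cast_zero, zero_add, maurerCartan_zero, h0, map_zero, sub_zero] at h1 h2
    dsimp only
    rw [zero_add, smul_sub, h1, h2, fbr_skew b a]
    simp [maurerCartan_zero, two_smul, sub_eq_add_neg]
  | succ n ih =>
    have h3 : (n : K) + 3 ≠ 0 := by exact_mod_cast (by lia : n + 3 ≠ 0)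
    apply smul_right_injective _ h3
    have h1 := derivMC_succ e (n + 1) a b
    have h2 := derivMC_succ e (n + 1) b a
    have e3 : ((n + 1 : ℕ) : K) + 2 = (n : K) + 3 := by push_cast; ring
    rw [e3] at h1 h2
    dsimp only
    -- After multiplication by n + 3 both sides obey the same recursion in the degree.
    rw [smul_sub, h1, h2, smul_neg, smul_sum_maurerCartan_lie, ← neg_eq_iff_eq_neg.2 ih, map_neg,
      map_sub, fbr_skew b (maurerCartan e (n + 1) a)]
    abel

/-- The bracket of left-invariant vector fields, without signs and shifts of degree. -/
def leftInvBracket (y y' : h) (n : ℕ) : MvPolynomial σ K ⊗[K] h :=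
  ∑ p ∈ antidiagonal n, (nabla e (leftInv e p.1 y) (leftInv e p.2 y') -
    nabla e (leftInv e p.2 y') (leftInv e p.1 y))

/-- By the Maurer-Cartan equation ω([L_y, L_{y'}]) = [ω(L_y), ω(L_{y'})] = [y, y']. It sits at n = 1
because a bracket of vector fields lowers the total polynomial degree by one. -/
theorem sum_maurerCartan_leftInvBracket (y y' : h) (n : ℕ) :
    ∑ p ∈ antidiagonal n, maurerCartan e p.1 (leftInvBracket e y y' p.2) =
      if n = 1 then (1 : MvPolynomial σ K) ⊗ₜ ⁅y, y'⁆ else 0 := by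
  have h1 : ∑ p ∈ antidiagonal n, maurerCartan e p.1 (leftInvBracket e y y' p.2) =
      -∑ p ∈ antidiagonal n, ∑ q ∈ antidiagonal p.2,
        (derivMC e p.1 (leftInv e q.1 y) (leftInv e q.2 y') -
          derivMC e p.1 (leftInv e q.2 y') (leftInv e q.1 y)) := by
    have a1 := sum_maurerCartan_nabla e y y' n
    have a2 := sum_maurerCartan_nabla e y' y n
    have sw (F : ℕ → ℕ → ℕ → MvPolynomial σ K ⊗[K] h) :
        ∑ p ∈ antidiagonal n, ∑ q ∈ antidiagonal p.2, F p.1 q.1 q.2 =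
        ∑ p ∈ antidiagonal n, ∑ q ∈ antidiagonal p.2, F p.1 q.2 q.1 :=
      sum_congr rfl fun p _ =>
        (Finset.Nat.sum_antidiagonal_swap (f := fun q : ℕ × ℕ => F p.1 q.1 q.2)).symm
    rw [sw fun a b c => maurerCartan e a (nabla e (leftInv e b y') (leftInv e c y)),
      sw fun a b c => derivMC e a (leftInv e b y') (leftInv e c y)] at a2
    simp only [leftInvBracket, map_sum, map_sub, sum_sub_distrib, a1, a2]
    abel
  rw [h1]
  cases n with
  | zero => simp [derivMC, maurerCartan_zero]
  | succ n =>
    rw [Finset.Nat.sum_antidiagonal_succ]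
    simp only [derivMC_sub, sum_neg_distrib]
    have h0 : ∑ q ∈ antidiagonal (n + 1), (derivMC e 0 (leftInv e q.1 y) (leftInv e q.2 y') -
          derivMC e 0 (leftInv e q.2 y') (leftInv e q.1 y)) = 0 := by
      refine sum_eq_zero fun q _ => ?_
      simp [derivMC, maurerCartan_zero]
    rw [h0, zero_add, neg_neg]
    have h2 : ∑ p ∈ antidiagonal n, ∑ q ∈ antidiagonal p.2, ∑ r ∈ antidiagonal p.1,
        fbr K σ h (maurerCartan e r.1 (leftInv e q.1 y)) (maurerCartan e r.2 (leftInv e q.2 y')) =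
        ∑ p ∈ antidiagonal n, fbr K σ h
          (∑ r ∈ antidiagonal p.1, maurerCartan e r.1 (leftInv e r.2 y))
          (∑ q ∈ antidiagonal p.2, maurerCartan e q.1 (leftInv e q.2 y')) := by
      rw [sum_congr rfl fun p _ => sum_comm, sum_antidiagonal_swap_middle fun a b c d =>
        fbr K σ h (maurerCartan e a (leftInv e c y)) (maurerCartan e b (leftInv e d y'))]
      refine sum_congr rfl fun p _ => ?_
      rw [map_sum (fbr K σ h), LinearMap.sum_apply]
      refine sum_congr rfl fun r _ => ?_
      rw [map_sum]
    rw [h2]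
    simp only [sum_maurerCartan_leftInv]
    rw [sum_eq_single_of_mem (n, 0) (by simp)]
    · cases n with
      | zero => simp [fbr_tmul]
      | succ n => simp
    · rintro ⟨a, b⟩ hab hne
      rw [mem_antidiagonal] at hab
      have : b ≠ 0 := by
        rintro rfl
        exact hne (by simpa using hab)
      simp [this]

theorem leftInvBracket_zero (y y' : h) : leftInvBracket e y y' 0 = 0 := by
  have := sum_maurerCartan_leftInvBracket e y y' 0
  simpa [maurerCartan_zero] using this

/-- Both sides have the same image under the Maurer-Cartan form, which is unitriangular in the
degree and can therefore be cancelled. -/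
theorem leftInvBracket_succ (y y' : h) (n : ℕ) :
    leftInvBracket e y y' (n + 1) = leftInv e n ⁅y, y'⁆ := by
  induction n using Nat.strong_induction_on with
  | _ n ih =>
    have h1 := sum_maurerCartan_leftInvBracket e y y' (n + 1)
    have h2 := sum_maurerCartan_leftInv e ⁅y, y'⁆ n
    rw [Finset.Nat.sum_antidiagonal_succ', leftInvBracket_zero, map_zero, zero_add] at h1
    simp only [Nat.add_eq_right] at h1
    rw [← h2] at h1
    rw [← Finset.add_sum_erase _ _ (show ((0, n) : ℕ × ℕ) ∈ antidiagonal n by simp),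
      ← Finset.add_sum_erase _ _ (show ((0, n) : ℕ × ℕ) ∈ antidiagonal n by simp),
      maurerCartan_zero, maurerCartan_zero] at h1
    refine add_right_cancel (h1.trans ?_)
    congr 1
    refine sum_congr rfl fun p hp => ?_
    rw [mem_erase, mem_antidiagonal] at hp
    have : p.2 < n := by
      by_contra hc
      exact hp.1 (Prod.ext (by dsimp only; lia) (by dsimp only; lia))
    rw [ih p.2 this]

theorem fieldOp_commutator (y y' : h) :
    fieldOp e y * fieldOp e y' - fieldOp e y' * fieldOp e y =
      PowerSeries.X * fieldOp e ⁅y, y'⁆ := by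
  have key (n : ℕ) (f : MvPolynomial σ K) :
      PowerSeries.coeff n (fieldOp e y * fieldOp e y' - fieldOp e y' * fieldOp e y) f =
      vecDeriv e (leftInvBracket e y y' n) f := by
    have hs (D : ℕ → MvPolynomial σ K ⊗[K] h) (s : Finset (ℕ × ℕ))
        (E : ℕ × ℕ → MvPolynomial σ K ⊗[K] h) : vecDeriv e (∑ p ∈ s, E p) f =
        ∑ p ∈ s, vecDeriv e (E p) f := by
      induction s using Finset.induction_on with
      | empty => simp
      | insert p s hp ih => rw [sum_insert hp, sum_insert hp, map_add, Derivation.add_apply, ih]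
    rw [map_sub, PowerSeries.coeff_mul, PowerSeries.coeff_mul, LinearMap.sub_apply,
      LinearMap.sum_apply, LinearMap.sum_apply, ← Finset.Nat.sum_antidiagonal_swap (n := n)
        (f := fun p => (PowerSeries.coeff p.1 (fieldOp e y') * _) f), ← sum_sub_distrib,
      leftInvBracket, hs fun _ => 0]
    refine sum_congr rfl fun p _ => ?_
    rw [← vecDeriv_commutator]
    simp only [Module.End.mul_apply, Prod.fst_swap, Prod.snd_swap, coeff_fieldOp_apply]
  ext1 n
  refine LinearMap.ext fun f => ?_
  rw [key]
  cases n with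
  | zero => simp [leftInvBracket_zero]
  | succ n => rw [leftInvBracket_succ, PowerSeries.coeff_succ_X_mul, coeff_fieldOp_apply]

end VectorFields

/-! ### The filtration of the enveloping algebra -/

section Filtration

attribute [local instance 100] LieRing.ofAssociativeRing

open UniversalEnvelopingAlgebra (ι)

variable {K g h σ : Type*} [Field K] [LieRing g] [LieAlgebra K g] [LieRing h] [LieAlgebra K h]

/-- By the universal property ι lifts to a morphism into S, whose composition with the inclusion
must be the identity. -/
theorem mem_of_forall_ι_mem (S : Subalgebra K (UniversalEnvelopingAlgebra K h))
    (hS : ∀ x : h, ι K x ∈ S) (X : UniversalEnvelopingAlgebra K h) : X ∈ S := by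
  let F : UniversalEnvelopingAlgebra K h →ₐ[K] S :=
    UniversalEnvelopingAlgebra.lift K
      { toFun := fun x => ⟨ι K x, hS x⟩
        map_add' := fun x y => Subtype.ext (by simp)
        map_smul' := fun c x => Subtype.ext (by simp)
        map_lie' := fun {x y} => Subtype.ext (by
          have e1 := (ι K).map_lie x y
          rw [LieRing.of_associative_ring_bracket] at e1
          simp [-UniversalEnvelopingAlgebra.ι_apply, LieRing.of_associative_ring_bracket, e1]) }
  have hF : S.val.comp F = AlgHom.id K _ := by
    apply UniversalEnvelopingAlgebra.hom_ext
    ext x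
    simp only [LieHom.coe_comp, Function.comp_apply, AlgHom.coe_toLieHom, AlgHom.comp_apply]
    rw [UniversalEnvelopingAlgebra.lift_ι_apply]
    rfl
  have hX : ((F X : S) : UniversalEnvelopingAlgebra K h) = X := congrArg (fun G => G X) hF
  rw [← hX]
  exact (F X).2

/-- The product in the enveloping algebra of a list of basis vectors. -/
def basisProd (b : Module.Basis σ K h) (l : List σ) : UniversalEnvelopingAlgebra K h :=
  (l.map fun i => ι K (b i)).prod

theorem basisProd_cons (b : Module.Basis σ K h) (i : σ) (l : List σ) :
    basisProd b (i :: l) = ι K (b i) * basisProd b l := by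
  rw [basisProd, List.map_cons, List.prod_cons, basisProd]

/-- The elements of the enveloping algebra of degree less than `n`. -/
def degreeLT (b : Module.Basis σ K h) (n : ℕ) : Submodule K (UniversalEnvelopingAlgebra K h) :=
  Submodule.span K {X | ∃ l : List σ, l.length < n ∧ X = basisProd b l}

variable (b : Module.Basis σ K h)

theorem basisProd_mem {l : List σ} {n : ℕ} (hl : l.length < n) : basisProd b l ∈ degreeLT b n :=
  Submodule.subset_span ⟨l, hl, rfl⟩

theorem degreeLT_mono {m n : ℕ} (hmn : m ≤ n) : degreeLT b m ≤ degreeLT b n :=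
  Submodule.span_mono fun _ ⟨l, hl, hX⟩ => ⟨l, hl.trans_le hmn, hX⟩

theorem degreeLT_zero : degreeLT b 0 = ⊥ := by
  rw [degreeLT, Submodule.span_eq_bot]
  rintro X ⟨l, hl, -⟩
  exact absurd hl (Nat.not_lt_zero _)

theorem ι_mul_mem {X : UniversalEnvelopingAlgebra K h} {n : ℕ} (hX : X ∈ degreeLT b n) (y : h) :
    ι K y * X ∈ degreeLT b (n + 1) := by
  induction hX using Submodule.span_induction with
  | zero => simp
  | add X Y _ _ hX hY =>
    rw [mul_add]
    exact add_mem hX hY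
  | smul c X _ hX =>
    rw [mul_smul_comm]
    exact Submodule.smul_mem _ _ hX
  | mem X hX =>
    obtain ⟨l, hl, rfl⟩ := hX
    have hy : y ∈ Submodule.span K (Set.range b) := by
      rw [b.span_eq]
      trivial
    induction hy using Submodule.span_induction with
    | zero => rw [map_zero, zero_mul]; exact zero_mem _
    | add x y _ _ hx hy =>
      rw [map_add, add_mul]
      exact add_mem hx hy
    | smul c x _ hx =>
      rw [map_smul, smul_mul_assoc]
      exact Submodule.smul_mem _ _ hx
    | mem x hx =>
      obtain ⟨i, rfl⟩ := hx
      rw [← basisProd_cons]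
      exact basisProd_mem b (by simpa using hl)

/-- By the Leibniz rule a derivation replaces one factor from 𝔥 by another one, so the degree does
not grow. -/
theorem derivExt_mem (d : LieDerivation K h h) {X : UniversalEnvelopingAlgebra K h} {n : ℕ}
    (hX : X ∈ degreeLT b n) : derivExt d X ∈ degreeLT b n := by
  have hl (l : List σ) : derivExt d (basisProd b l) ∈ degreeLT b (l.length + 1) := by
    induction l with
    | nil =>
      rw [basisProd, List.map_nil, List.prod_nil, derivExt_one]
      exact zero_mem _
    | cons i l ih =>
      rw [basisProd_cons, derivExt_mul, derivExt_ι]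
      exact add_mem (ι_mul_mem b ih _) (ι_mul_mem b (basisProd_mem b l.length.lt_succ_self) _)
  induction hX using Submodule.span_induction with
  | zero => simp
  | add X Y _ _ hX hY =>
    rw [map_add]
    exact add_mem hX hY
  | smul c X _ hX =>
    rw [map_smul]
    exact Submodule.smul_mem _ _ hX
  | mem X hX =>
    obtain ⟨l, hn, rfl⟩ := hX
    exact degreeLT_mono b hn (hl l)

/-- Exchanging two neighbours costs their bracket, a product with one factor fewer. -/
theorem basisProd_sub_mem_of_perm {l l' : List σ} (hl : l.Perm l') :
    basisProd b l - basisProd b l' ∈ degreeLT b l.length := by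
  induction hl with
  | nil => simp
  | cons i _ ih =>
    rw [basisProd_cons, basisProd_cons, ← mul_sub]
    exact ι_mul_mem b ih _
  | swap i j l =>
    have e1 := (ι K).map_lie (b j) (b i)
    rw [LieRing.of_associative_ring_bracket] at e1
    rw [basisProd_cons, basisProd_cons, basisProd_cons, basisProd_cons, ← mul_assoc, ← mul_assoc,
      ← sub_mul, ← e1]
    exact degreeLT_mono b (by simp) (ι_mul_mem b (basisProd_mem b l.length.lt_succ_self) _)
  | trans h₁ _ ih₁ ih₂ =>
    rw [← h₁.length_eq] at ih₂
    simpa using add_mem ih₁ ih₂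

theorem exists_mem_degreeLT (X : UniversalEnvelopingAlgebra K h) : ∃ n, X ∈ degreeLT b n := by
  -- The condition concerns left multiplication rather than membership: it is visibly closed under
  -- products, while only left multiplication by 𝔥 has been compared with the filtration.
  let S : Subalgebra K (UniversalEnvelopingAlgebra K h) :=
    { carrier := {Y | ∀ n, ∀ X ∈ degreeLT b n, ∃ m, Y * X ∈ degreeLT b m}
      mul_mem' := fun {Y Z} hY hZ n X hX => by
        obtain ⟨m, hm⟩ := hZ n X hX
        rw [mul_assoc]
        exact hY m _ hm
      add_mem' := fun {Y Z} hY hZ n X hX => by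
        obtain ⟨m, hm⟩ := hY n X hX
        obtain ⟨m', hm'⟩ := hZ n X hX
        rw [add_mul]
        exact ⟨max m m', add_mem (degreeLT_mono b (le_max_left _ _) hm)
          (degreeLT_mono b (le_max_right _ _) hm')⟩
      algebraMap_mem' := fun c n X hX => ⟨n, by
        rw [← Algebra.smul_def]
        exact Submodule.smul_mem _ _ hX⟩ }
  have := mem_of_forall_ι_mem S (fun x n X hX => ⟨n + 1, ι_mul_mem b hX x⟩) X 1 1
    (basisProd_mem b (l := []) Nat.one_pos)
  simpa using this

variable {υ : g →ₗ⁅K⁆ LieDerivation K h h} (φ : CrossedMorphism υ)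

theorem Theta_one : Theta φ 1 = 1 := by
  change action φ 1 1 = 1
  rw [map_one (action φ)]
  rfl

theorem Theta_ι_mul (x : g) (X : UniversalEnvelopingAlgebra K g) :
    Theta φ (ι K x * X) = derivExt (υ x) (Theta φ X) + ι K (φ.toLinearMap x) * Theta φ X := by
  change action φ (ι K x * X) 1 = _
  rw [map_mul, action, UniversalEnvelopingAlgebra.lift_ι_apply]
  rfl

/-- In Θ(xX) = υ_x(ΘX) + φ(x)ΘX only the second summand can raise the degree, so on leading terms Θ
just replaces each factor by its image under φ. -/
theorem Theta_basisProd_sub_mem {bg : Module.Basis σ K g} (hb : ∀ i, φ.toLinearMap (bg i) = b i)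
    (l : List σ) : Theta φ (basisProd bg l) - basisProd b l ∈ degreeLT b l.length := by
  induction l with
  | nil => simp [basisProd, Theta_one]
  | cons i l ih =>
    have h1 : Theta φ (basisProd bg l) ∈ degreeLT b (l.length + 1) := by
      rw [← sub_add_cancel (Theta φ (basisProd bg l)) (basisProd b l)]
      exact add_mem (degreeLT_mono b l.length.le_succ ih) (basisProd_mem b l.length.lt_succ_self)
    rw [basisProd_cons, basisProd_cons, Theta_ι_mul, hb, add_sub_assoc, ← mul_sub]
    exact add_mem (derivExt_mem b _ h1) (ι_mul_mem b ih _)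

theorem Theta_mem {bg : Module.Basis σ K g} (hb : ∀ i, φ.toLinearMap (bg i) = b i)
    {X : UniversalEnvelopingAlgebra K g} {n : ℕ} (hX : X ∈ degreeLT bg n) :
    Theta φ X ∈ degreeLT b n := by
  induction hX using Submodule.span_induction with
  | zero => simp
  | add X Y _ _ hX hY =>
    rw [map_add]
    exact add_mem hX hY
  | smul c X _ hX =>
    rw [map_smul]
    exact Submodule.smul_mem _ _ hX
  | mem X hX =>
    obtain ⟨l, hl, rfl⟩ := hX
    rw [← sub_add_cancel (Theta φ (basisProd bg l)) (basisProd b l)]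
    exact add_mem (degreeLT_mono b hl.le (Theta_basisProd_sub_mem b φ hb l)) (basisProd_mem b hl)

/-- Up to lower degree, every element is a combination of ordered products. -/
theorem exists_linearCombination_sub_mem {X : UniversalEnvelopingAlgebra K h} {n : ℕ}
    (hX : X ∈ degreeLT b (n + 1)) : ∃ c : Multiset σ →₀ K, (∀ s ∈ c.support, s.card = n) ∧
      X - Finsupp.linearCombination K (fun s : Multiset σ => basisProd b s.toList) c ∈
        degreeLT b n := by
  classical
  induction hX using Submodule.span_induction with
  | zero => exact ⟨0, by simp⟩
  | add X Y _ _ hX hY =>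
    obtain ⟨c, hc, hX⟩ := hX
    obtain ⟨d, hd, hY⟩ := hY
    refine ⟨c + d, fun s hs => ?_, ?_⟩
    · rcases Finset.mem_union.1 (Finsupp.support_add hs) with hs | hs
      exacts [hc s hs, hd s hs]
    · rw [map_add, add_sub_add_comm]
      exact add_mem hX hY
  | smul a X _ hX =>
    obtain ⟨c, hc, hX⟩ := hX
    refine ⟨a • c, fun s hs => hc s (Finsupp.support_smul hs), ?_⟩
    rw [map_smul, ← smul_sub]
    exact Submodule.smul_mem _ _ hX
  | mem X hX =>
    obtain ⟨l, hl, rfl⟩ := hX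
    rcases Nat.lt_succ_iff_lt_or_eq.1 hl with hl | hl
    · exact ⟨0, by simp, by simpa using basisProd_mem b hl⟩
    · refine ⟨Finsupp.single (l : Multiset σ) 1, fun s hs => ?_, ?_⟩
      · rw [Finset.mem_singleton.1 (Finsupp.support_single_subset hs)]
        simpa using hl
      · rw [Finsupp.linearCombination_single, one_smul, ← hl]
        refine basisProd_sub_mem_of_perm b (Multiset.coe_eq_coe.1 ?_)
        rw [Multiset.coe_toList]

theorem Theta_surjective {bg : Module.Basis σ K g} (hb : ∀ i, φ.toLinearMap (bg i) = b i) :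
    Function.Surjective (Theta φ) := by
  have key (n : ℕ) (X : UniversalEnvelopingAlgebra K h) (hX : X ∈ degreeLT b n) :
      X ∈ LinearMap.range (Theta φ) := by
    induction n generalizing X with
    | zero =>
      rw [degreeLT_zero, Submodule.mem_bot] at hX
      rw [hX]
      exact zero_mem _
    | succ n ih =>
      induction hX using Submodule.span_induction with
      | zero => exact zero_mem _
      | add X Y _ _ hX hY => exact add_mem hX hY
      | smul c X _ hX => exact Submodule.smul_mem _ _ hX
      | mem X hX =>
        obtain ⟨l, hl, rfl⟩ := hX
        rw [← sub_sub_self (Theta φ (basisProd bg l)) (basisProd b l)]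
        exact sub_mem (LinearMap.mem_range_self _ _) (ih _ (degreeLT_mono b (Nat.lt_succ_iff.1 hl)
          (Theta_basisProd_sub_mem b φ hb l)))
  intro X
  obtain ⟨n, hn⟩ := exists_mem_degreeLT b X
  exact key n X hn

end Filtration

/-! ### The symbol of an element of the enveloping algebra -/

section Symbol

attribute [local instance 100] LieRing.ofAssociativeRing

open UniversalEnvelopingAlgebra (ι)

variable {K g h σ : Type*} [Field K] [LieRing g] [LieAlgebra K g] [LieRing h] [LieAlgebra K h]

theorem single_mul_comm {A : Type*} [Ring A] (n : ℤ) (x : HahnSeries ℤ A) :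
    HahnSeries.single n 1 * x = x * HahnSeries.single n 1 := by
  ext m
  rw [HahnSeries.coeff_single_mul, HahnSeries.coeff_mul_single, one_mul, mul_one]

theorem coeff_ofPowerSeries_neg {A : Type*} [Ring A] (x : PowerSeries A) {n : ℤ} (hn : n < 0) :
    (HahnSeries.ofPowerSeries ℤ A x).coeff n = 0 := by
  rw [HahnSeries.ofPowerSeries_apply, HahnSeries.embDomain_of_notMem_range]
  rintro ⟨m, hm⟩
  simp only [Nat.castOrderEmbedding_apply] at hm
  lia

/-- Iterated partial derivatives shift exponents and multiply by positive integers, nonzero in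
characteristic 0. -/
theorem coeff_map_pderiv_prod [CharZero K] (l : List σ) (m : σ →₀ ℕ) : ∃ w : K, w ≠ 0 ∧
    ∀ q : MvPolynomial σ K, MvPolynomial.coeff m ((l.map fun i =>
      ((MvPolynomial.pderiv i : Derivation K (MvPolynomial σ K) (MvPolynomial σ K)) :
        Module.End K (MvPolynomial σ K))).prod q) =
      w * MvPolynomial.coeff (m + (l.map fun i => Finsupp.single i 1).sum) q := by
  induction l generalizing m with
  | nil => exact ⟨1, one_ne_zero, by simp⟩
  | cons i l ih =>
    obtain ⟨w, hw, h⟩ := ih (m + Finsupp.single i 1)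
    refine ⟨w * (m i + 1), mul_ne_zero hw (Nat.cast_add_one_ne_zero _), fun q => ?_⟩
    rw [List.map_cons, List.prod_cons, Module.End.mul_apply, List.map_cons, List.sum_cons,
      ← add_assoc]
    refine (MvPolynomial.coeff_pderiv _ m).trans ?_
    rw [h]
    ring

variable [Fintype σ] (e : Module.Basis σ K h)

theorem fieldOp_add (y y' : h) : fieldOp e (y + y') = fieldOp e y + fieldOp e y' := by
  ext1 n
  refine LinearMap.ext fun f => ?_
  rw [map_add, LinearMap.add_apply]
  simp only [coeff_fieldOp_apply, map_add, Derivation.add_apply]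

theorem fieldOp_smul (c : K) (y : h) : fieldOp e (c • y) = c • fieldOp e y := by
  ext1 n
  refine LinearMap.ext fun f => ?_
  rw [PowerSeries.coeff_smul, LinearMap.smul_apply]
  simp only [coeff_fieldOp_apply, map_smul]
  rw [LinearMap.map_smul_of_tower, Derivation.smul_apply]

variable [CharZero K]

/-- The representation of `h` by differential operators, with a formal parameter. -/
def fieldRepLie : h →ₗ⁅K⁆ HahnSeries ℤ (Module.End K (MvPolynomial σ K)) where
  -- Dividing by the formal parameter removes the factor in `fieldOp_commutator`, and a product of n
  -- basis vectors acquires a pole of order at most n whose leading coefficient is its symbol.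
  toFun y := HahnSeries.single (-1) 1 * HahnSeries.ofPowerSeries ℤ _ (fieldOp e y)
  map_add' y y' := by rw [fieldOp_add, map_add, mul_add]
  map_smul' c y := by
    rw [fieldOp_smul]
    have h1 : HahnSeries.ofPowerSeries ℤ _ (c • fieldOp e y) =
        c • HahnSeries.ofPowerSeries ℤ _ (fieldOp e y) := by
      ext1
      funext m
      rw [HahnSeries.coeff_smul]
      rcases lt_or_ge m 0 with hm | hm
      · rw [coeff_ofPowerSeries_neg _ hm, coeff_ofPowerSeries_neg _ hm, smul_zero]
      · obtain ⟨n, rfl⟩ := Int.eq_ofNat_of_zero_le hm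
        refine (HahnSeries.ofPowerSeries_apply_coeff _ n).trans ?_
        exact congrArg (c • ·) (HahnSeries.ofPowerSeries_apply_coeff (fieldOp e y) n).symm
    rw [h1, RingHom.id_apply]
    ext1
    funext m
    rw [HahnSeries.coeff_smul, HahnSeries.coeff_single_mul, HahnSeries.coeff_single_mul, one_mul,
      one_mul, HahnSeries.coeff_smul]
  map_lie' {y y'} := by
    have h1 := congrArg (HahnSeries.ofPowerSeries ℤ _) (fieldOp_commutator e y y')
    rw [map_sub, map_mul, map_mul, map_mul, HahnSeries.ofPowerSeries_X] at h1
    set s : HahnSeries ℤ (Module.End K (MvPolynomial σ K)) := HahnSeries.single (-1) 1 with hs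
    have hmul (x x' : HahnSeries ℤ (Module.End K (MvPolynomial σ K))) :
        s * x * (s * x') = s * s * (x * x') := by
      rw [mul_assoc, ← mul_assoc x, hs, ← single_mul_comm, mul_assoc, mul_assoc]
    have h2 : s * HahnSeries.single 1 1 = 1 := by
      rw [hs, HahnSeries.single_mul_single]
      simp
    rw [LieRing.of_associative_ring_bracket, hmul, hmul, ← mul_sub (s * s), h1, mul_assoc, ← mul_assoc s
      (HahnSeries.single 1 1), h2, one_mul]

/-- The representation of `U(h)` by differential operators, with a formal parameter. -/
def fieldRep : UniversalEnvelopingAlgebra K h →ₐ[K]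
    HahnSeries ℤ (Module.End K (MvPolynomial σ K)) :=
  UniversalEnvelopingAlgebra.lift K (fieldRepLie e)

theorem fieldRep_basisProd (l : List σ) : fieldRep e (basisProd e l) =
    HahnSeries.single (-(l.length : ℤ)) 1 *
      HahnSeries.ofPowerSeries ℤ _ (l.map fun i => fieldOp e (e i)).prod := by
  induction l with
  | nil => simp [basisProd]
  | cons i l ih =>
    rw [basisProd_cons, map_mul, ih, fieldRep, UniversalEnvelopingAlgebra.lift_ι_apply,
      List.map_cons, List.prod_cons, map_mul]
    change HahnSeries.single (-1) 1 * HahnSeries.ofPowerSeries ℤ _ (fieldOp e (e i)) * _ = _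
    rw [mul_assoc, ← mul_assoc (HahnSeries.ofPowerSeries ℤ _ (fieldOp e (e i))),
      ← single_mul_comm, mul_assoc, ← mul_assoc, HahnSeries.single_mul_single, mul_one,
      List.length_cons]
    congr 3
    push_cast
    ring

/-- The symbol of degree `n`. -/
def symbol (n : ℕ) : UniversalEnvelopingAlgebra K h →ₗ[K] Module.End K (MvPolynomial σ K) where
  toFun X := (fieldRep e X).coeff (-(n : ℤ))
  map_add' X Y := by rw [map_add, HahnSeries.coeff_add]
  map_smul' c X := by rw [map_smul, HahnSeries.coeff_smul, RingHom.id_apply]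

theorem symbol_basisProd_of_lt {l : List σ} {n : ℕ} (hl : l.length < n) :
    symbol e n (basisProd e l) = 0 := by
  change (fieldRep e _).coeff _ = 0
  rw [fieldRep_basisProd, HahnSeries.coeff_single_mul, coeff_ofPowerSeries_neg, mul_zero]
  lia

theorem symbol_basisProd (l : List σ) : symbol e l.length (basisProd e l) = (l.map fun i =>
    ((MvPolynomial.pderiv i : Derivation K (MvPolynomial σ K) (MvPolynomial σ K)) :
        Module.End K (MvPolynomial σ K))).prod := by
  change (fieldRep e _).coeff _ = _
  rw [fieldRep_basisProd, HahnSeries.coeff_single_mul, one_mul, sub_self]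
  refine (HahnSeries.ofPowerSeries_apply_coeff _ 0).trans ?_
  rw [PowerSeries.coeff_zero_eq_constantCoeff, map_list_prod, List.map_map]
  congr 2
  ext1 i
  rw [Function.comp_apply, ← PowerSeries.coeff_zero_eq_constantCoeff, coeff_zero_fieldOp,
    dirDeriv_basis]

theorem symbol_eq_zero {X : UniversalEnvelopingAlgebra K h} {n : ℕ} (hX : X ∈ degreeLT e n) :
    symbol e n X = 0 := by
  induction hX using Submodule.span_induction with
  | zero => exact map_zero _
  | add X Y _ _ hX hY => rw [map_add, hX, hY, add_zero]
  | smul c X _ hX => rw [map_smul, hX, smul_zero]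
  | mem X hX =>
    obtain ⟨l, hl, rfl⟩ := hX
    exact symbol_basisProd_of_lt e hl

/-- The ordered products of degree `n` are independent modulo lower degree. -/
theorem eq_zero_of_linearCombination_mem {c : Multiset σ →₀ K} {n : ℕ}
    (hc : ∀ s ∈ c.support, s.card = n)
    (h : Finsupp.linearCombination K (fun s : Multiset σ => basisProd e s.toList) c ∈
      degreeLT e n) : c = 0 := by
  classical
  have h1 := symbol_eq_zero e h
  rw [Finsupp.linearCombination_apply, Finsupp.sum, map_sum] at h1
  ext s
  rw [Finsupp.zero_apply]
  by_contra hs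
  -- The symbol of each ordered product is a monomial differential operator. Applied to the monomial
  -- of s and read off at exponent 0, only the operator of s itself survives.
  have h2 := congrArg (fun T : Module.End K (MvPolynomial σ K) => MvPolynomial.coeff 0
    (T (MvPolynomial.monomial (Multiset.toFinsupp s) 1))) h1
  simp only [LinearMap.sum_apply, MvPolynomial.coeff_sum, LinearMap.zero_apply,
    MvPolynomial.coeff_zero] at h2
  have h3 (s' : Multiset σ) : (s'.toList.map fun i => Finsupp.single i 1).sum =
      Multiset.toFinsupp s' := by
    conv_rhs => rw [← Multiset.coe_toList s']
    induction s'.toList with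
    | nil => simp
    | cons i l ih =>
      rw [List.map_cons, List.sum_cons, ih, ← Multiset.cons_coe, ← Multiset.singleton_add, map_add,
        Multiset.toFinsupp_singleton]
  have h4 (s' : Multiset σ) (hs' : s' ∈ c.support) : ∃ w : K, w ≠ 0 ∧
      MvPolynomial.coeff 0 ((symbol e n (c s' • basisProd e s'.toList))
        (MvPolynomial.monomial (Multiset.toFinsupp s) 1)) = c s' * (w * if s = s' then 1 else 0) := by
    obtain ⟨w, hw, hq⟩ := coeff_map_pderiv_prod (K := K) s'.toList 0
    refine ⟨w, hw, ?_⟩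
    have hn : n = s'.toList.length := by rw [Multiset.length_toList, hc s' hs']
    rw [map_smul, hn, symbol_basisProd, LinearMap.smul_apply, MvPolynomial.coeff_smul, hq, h3,
      zero_add, MvPolynomial.coeff_monomial, smul_eq_mul]
    simp only [Multiset.toFinsupp.injective.eq_iff]
  rw [Finset.sum_eq_single s] at h2
  · obtain ⟨w, hw, hq⟩ := h4 s (Finsupp.mem_support_iff.2 hs)
    rw [hq, if_pos rfl, mul_one] at h2
    exact mul_ne_zero hs hw h2
  · intro s' hs' hne
    obtain ⟨w, -, hq⟩ := h4 s' hs'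
    rw [hq, if_neg hne.symm, mul_zero, mul_zero]
  · intro hs'
    exact absurd (Finsupp.mem_support_iff.2 hs) hs'

variable {υ : g →ₗ⁅K⁆ LieDerivation K h h} (φ : CrossedMorphism υ)

/-- Descent in the degree: the leading part of an element of the kernel is a combination of ordered
products, and the same combination in U(𝔥) has lower degree, so its coefficients vanish. Ordered
products need only span in U(𝔤); independence is used in U(𝔥) alone. -/
theorem Theta_injective {bg : Module.Basis σ K g} (hb : ∀ i, φ.toLinearMap (bg i) = e i) :
    Function.Injective (Theta φ) := by
  have key (n : ℕ) (X : UniversalEnvelopingAlgebra K g) (hX : X ∈ degreeLT bg n)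
      (h0 : Theta φ X = 0) : X = 0 := by
    induction n with
    | zero => rwa [degreeLT_zero, Submodule.mem_bot] at hX
    | succ n ih =>
      apply ih
      obtain ⟨c, hc, hXc⟩ := exists_linearCombination_sub_mem bg hX
      have h1 := Theta_mem e φ hb hXc
      rw [map_sub, h0, zero_sub, neg_mem_iff] at h1
      have h2 : Theta φ (Finsupp.linearCombination K
          (fun s : Multiset σ => basisProd bg s.toList) c) - Finsupp.linearCombination K
          (fun s : Multiset σ => basisProd e s.toList) c ∈ degreeLT e n := by
        rw [Finsupp.linearCombination_apply, Finsupp.linearCombination_apply, Finsupp.sum,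
          Finsupp.sum, map_sum, ← Finset.sum_sub_distrib]
        refine sum_mem fun s hs => ?_
        rw [map_smul, ← smul_sub, ← hc s hs, ← Multiset.length_toList]
        exact Submodule.smul_mem _ _ (Theta_basisProd_sub_mem e φ hb _)
      have h3 := sub_mem h1 h2
      rw [sub_sub_cancel] at h3
      rw [eq_zero_of_linearCombination_mem e hc h3] at hXc
      simpa using hXc
  rw [injective_iff_map_eq_zero]
  intro X h0
  obtain ⟨n, hn⟩ := exists_mem_degreeLT bg X
  exact key n X hn h0

theorem Theta_bijective [FiniteDimensional K h] (hφ : Function.Bijective φ.toLinearMap) :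
    Function.Bijective (Theta φ) := by
  let e := Module.finBasis K h
  let E := LinearEquiv.ofBijective φ.toLinearMap hφ
  have hb (i : Fin (Module.finrank K h)) : φ.toLinearMap ((e.map E.symm) i) = e i := by
    rw [Module.Basis.map_apply]
    exact E.apply_symm_apply _
  exact ⟨Theta_injective e φ hb, Theta_surjective e φ hb⟩

/-- The symbol of degree one of x is the directional derivative along x, which recovers its
coordinates. -/
theorem ι_injective [FiniteDimensional K h] :
    Function.Injective (ι K : h → UniversalEnvelopingAlgebra K h) := by
  let e := Module.finBasis K h
  rw [injective_iff_map_eq_zero]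
  intro x hx
  have h1 : symbol e 1 (ι K x) = (dirDeriv e x : Module.End K (MvPolynomial (Fin (Module.finrank K h)) K)) := by
    change (fieldRep e _).coeff _ = _
    rw [fieldRep, UniversalEnvelopingAlgebra.lift_ι_apply]
    change (HahnSeries.single (-1) 1 * HahnSeries.ofPowerSeries ℤ _ (fieldOp e x)).coeff _ = _
    rw [HahnSeries.coeff_single_mul, one_mul, Nat.cast_one, sub_self]
    refine (HahnSeries.ofPowerSeries_apply_coeff _ 0).trans ?_
    rw [coeff_zero_fieldOp]
  rw [hx, map_zero] at h1
  apply e.repr.injective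
  ext i
  have h2 := congrArg (fun T : Module.End K (MvPolynomial (Fin (Module.finrank K h)) K) => T (MvPolynomial.X i)) h1
  have h3 : (0 : MvPolynomial (Fin (Module.finrank K h)) K) = MvPolynomial.C (e.repr x i) := h2.trans (dirDeriv_X e x i)
  rw [map_zero, Finsupp.zero_apply]
  exact (MvPolynomial.C_injective _ K ((map_zero _).trans h3)).symm

end Symbol

/-! ### Setting the formal parameter of a flow equal to one -/

section Total

variable {K A : Type*} [Field K] [Ring A] [Algebra K A]

/-- The sum of the coefficients of a series whose coefficient of degree `k` has order at least
`k`. -/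
def total (Z : PowerSeries (PowerSeries A)) : PowerSeries A := fsum fun k => PowerSeries.coeff k Z

/-- The coefficient of degree `k` has order at least `k`. -/
def IsSteep (Z : PowerSeries (PowerSeries A)) : Prop := OrderGe fun k => PowerSeries.coeff k Z

theorem IsSteep.mul {Y Z : PowerSeries (PowerSeries A)} (hY : IsSteep Y) (hZ : IsSteep Z) :
    IsSteep (Y * Z) := fun k n hn => by
  dsimp only
  rw [PowerSeries.coeff_mul, map_sum]
  refine sum_eq_zero fun p hp => ?_
  have := mem_antidiagonal.1 hp
  exact coeff_mul_eq_zero (hY p.1) (hZ p.2) n (by lia)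

theorem total_mul {Y Z : PowerSeries (PowerSeries A)} (hY : IsSteep Y) (hZ : IsSteep Z) :
    total (Y * Z) = total Y * total Z := by
  rw [total, total, total, fsum_mul_fsum hY hZ]
  simp only [PowerSeries.coeff_mul]

theorem isSteep_one : IsSteep (1 : PowerSeries (PowerSeries A)) := fun k n hn => by
  dsimp only
  rw [PowerSeries.coeff_one, if_neg (by lia), map_zero]

theorem total_one : total (1 : PowerSeries (PowerSeries A)) = 1 := by
  ext n
  rw [total, coeff_fsum, sum_eq_single 0]
  · rw [PowerSeries.coeff_one, if_pos rfl]
  · intro k _ hk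
    rw [PowerSeries.coeff_one, if_neg hk, map_zero]
  · simp

theorem isSteep_pow {Z : PowerSeries (PowerSeries A)} (hZ : IsSteep Z) (m : ℕ) :
    IsSteep (Z ^ m) := by
  induction m with
  | zero => rw [pow_zero]; exact isSteep_one
  | succ m ih => rw [pow_succ]; exact ih.mul hZ

theorem total_pow {Z : PowerSeries (PowerSeries A)} (hZ : IsSteep Z) (m : ℕ) :
    total (Z ^ m) = total Z ^ m := by
  induction m with
  | zero => rw [pow_zero, pow_zero, total_one]
  | succ m ih => rw [pow_succ, pow_succ, total_mul (isSteep_pow hZ m) hZ, ih]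

/-- Setting the time s equal to 1 is multiplicative on steep series, and for a fixed power of t only
finitely many terms of the exponential contribute. -/
theorem total_expPS {Z : PowerSeries (PowerSeries A)} (hZ : IsSteep Z)
    (h0 : PowerSeries.coeff 0 Z = 0) : total (expPS K Z) = expPS K (total Z) := by
  ext n
  have h1 : ∀ k ∈ range (n + 1), PowerSeries.coeff n (PowerSeries.coeff k (expPS K Z)) =
      ∑ m ∈ range (n + 1), (m.factorial : K)⁻¹ •
        PowerSeries.coeff n (PowerSeries.coeff k (Z ^ m)) := by
    intro k hk
    rw [expPS_eq_fsum, coeff_fsum_of_lt ((orderGe_pow h0).smul _) (mem_range.1 hk), map_sum]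
    rfl
  rw [total, coeff_fsum, sum_congr rfl h1, sum_comm, expPS, PowerSeries.coeff_mk]
  refine sum_congr rfl fun m _ => ?_
  rw [← total_pow hZ, total, coeff_fsum, smul_sum]

theorem isSteep_expPS {Z : PowerSeries (PowerSeries A)} (hZ : IsSteep Z) :
    IsSteep (expPS K Z) := fun k n hn => by
  dsimp only
  rw [expPS, PowerSeries.coeff_mk, map_sum]
  refine sum_eq_zero fun m _ => ?_
  refine (congrArg ((m.factorial : K)⁻¹ • ·) (isSteep_pow hZ m k n hn)).trans (smul_zero _)

end Total

/-! ### Flows with power series as data, at time one -/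

section SeqSum

variable {K V A V' A' : Type*} [Field K] [AddCommGroup V] [Module K V] [Ring A] [Algebra K A]
  [AddCommGroup V'] [Module K V'] [Ring A'] [Algebra K A']

/-- The formal sum of a family of sequences, the `k`-th one being of order at least `k`. -/
def seqSum (Ω : ℕ → ℕ → V) : ℕ → V := fun n => ∑ k ∈ range (n + 1), Ω k n

theorem seqMap_seqSum (E : LieRep K V A) (Ω : ℕ → ℕ → V) :
    E.series.j (seqSum Ω) = total (E.series.series.j Ω) := by
  change seqMap E.j (seqSum Ω) = total (seqMap (seqMap E.j) Ω)
  ext n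
  rw [coeff_seqMap, total, coeff_fsum, seqSum, map_sum]
  simp only [coeff_seqMap]

theorem isSteep_series_j (E : LieRep K V A) {Ω : ℕ → ℕ → V} (hΩ : ∀ k n, n < k → Ω k n = 0) :
    IsSteep (E.series.series.j Ω) := fun k n hn => by
  change PowerSeries.coeff n (PowerSeries.coeff k (seqMap (seqMap E.j) Ω)) = 0
  rw [coeff_seqMap, coeff_seqMap, hΩ k n hn, map_zero]

theorem expPS_seqSum (E : LieRep K V A) {Ω : ℕ → ℕ → V} (hΩ : ∀ k n, n < k → Ω k n = 0)
    (h0 : Ω 0 = 0) : expPS K (E.series.j (seqSum Ω)) = total (expPS K (E.series.series.j Ω)) := by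
  rw [total_expPS (isSteep_series_j E hΩ) (E.series.coeff_zero_series_j h0), seqMap_seqSum]

theorem conv_order {W X : Type*} [AddCommGroup W] [Module K W] [AddCommGroup X] [Module K X]
    (B : V →ₗ[K] W →ₗ[K] X) (u : ℕ → V) (w : ℕ → W) (k l : ℕ)
    (hu : ∀ n < k, u n = 0) (hw : ∀ n < l, w n = 0) : ∀ n < k + l, conv B u w n = 0 := by
  intro n hn
  rw [conv_apply]
  refine sum_eq_zero fun p hp => ?_
  have := mem_antidiagonal.1 hp
  rcases lt_or_ge p.1 k with h | h
  · rw [hu _ h, map_zero, LinearMap.zero_apply]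
  · rw [hw p.2 (by lia), map_zero]

variable [CharZero K]

/-- The transfer principle for the relation "of order at least k in t", comparing the flow with
itself; the weights play no role. It makes the value at time one well defined. -/
theorem IsFlow.order {B B₂ : (ℕ → V) →ₗ[K] (ℕ → V) →ₗ[K] (ℕ → V)} {δ : (ℕ → V) →ₗ[K] (ℕ → V)}
    (hB : ∀ u w k l, (∀ n < k, u n = 0) → (∀ n < l, w n = 0) → ∀ n < k + l, B u w n = 0)
    (hB₂ : ∀ u w k l, (∀ n < k, u n = 0) → (∀ n < l, w n = 0) → ∀ n < k + l, B₂ u w n = 0)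
    (hδ : ∀ u k, (∀ n < k, u n = 0) → ∀ n < k + 1, δ u n = 0) {v v' : ℕ → V} (hv : v 0 = 0)
    (hv' : v' 0 = 0) {Ω : ℕ → ℕ → V} (hΩ : IsFlow B B₂ δ v v' Ω) (k n : ℕ) (hn : n < k) :
    Ω k n = 0 := by
  have h : IsGradedRel (fun _ : K => True) B B₂ δ B B₂ δ 0 0
      (fun k _ u _ => ∀ n < k, u n = 0) :=
    { zero := fun k n _ => rfl
      add := fun hu hx n hn => by rw [Pi.add_apply, hu n hn, hx n hn, add_zero]
      smul := fun _ hu n hn => by rw [Pi.smul_apply, hu n hn, smul_zero]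
      br₁ := fun hu hx => hB _ _ _ _ hu hx
      br₂ := fun hu hx => hB₂ _ _ _ _ hu hx
      der := fun hu => hδ _ _ hu }
  obtain ⟨U, hU⟩ := exists_isMajorant 0 0 0 0
  refine h.flow (fun _ => trivial) (fun _ => trivial) (fun _ => trivial) (fun _ => trivial)
    (v := v) (v' := v') (w := v) (w' := v') ?_ ?_ hU hΩ hΩ k n hn
  · intro n hn
    rwa [Nat.lt_one_iff.1 hn]
  · intro n hn
    rwa [Nat.lt_one_iff.1 hn]

/-- The flow of the Baker-Campbell-Hausdorff series. -/
theorem exp_mul_exp_eq_exp_seqSum (E : LieRep K V A) {x y : ℕ → V} (hx : x 0 = 0) (hy : y 0 = 0)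
    {Ω : ℕ → ℕ → V} (hΩ : IsFlow (conv E.br) 0 0 y x Ω) :
    expPS K (E.series.j x) * expPS K (E.series.j y) = expPS K (E.series.j (seqSum Ω)) := by
  have hord : ∀ k n, n < k → Ω k n = 0 := hΩ.order (conv_order E.br) (fun _ _ _ _ _ _ _ _ => rfl)
    (fun _ _ _ _ _ => rfl) hy hx
  have h1 := coeff_succ_expPS_flow E.series (D := 0) (by simp) (by simp) hΩ
  -- In the time variable, e^Ω and e^{sx} e^{sy} both solve Z' = xZ + Zy with Z(0) = 1.
  have h2 (k : ℕ) : PowerSeries.coeff k (expPS K (E.series.series.j Ω)) =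
      ∑ p ∈ antidiagonal k, ((p.1.factorial : K)⁻¹ • E.series.j x ^ p.1) *
        ((p.2.factorial : K)⁻¹ • E.series.j y ^ p.2) := by
    induction k with
    | zero => simp [coeff_zero_expPS]
    | succ k ih =>
      apply cast_succ_smul_injective (K := K) k
      have h3 := smul_antidiagonal_succ (K := K) (fun i j => ((i.factorial : K)⁻¹ •
        E.series.j x ^ i) * ((j.factorial : K)⁻¹ • E.series.j y ^ j)) k
      rw [h1, ih, LinearMap.zero_apply, add_zero, h3, mul_sum, sum_mul, add_comm]
      congr 1
      · refine sum_congr rfl fun p _ => ?_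
        rw [← smul_mul_assoc, smul_smul, fact_inv_mul, pow_succ', ← mul_assoc, mul_smul_comm (_ : K)
          (E.series.j x)]
      · refine sum_congr rfl fun p _ => ?_
        rw [← mul_smul_comm, smul_smul, fact_inv_mul, pow_succ, mul_assoc, smul_mul_assoc _ _
          (E.series.j y)]
  rw [expPS_seqSum E hord hΩ.zero, total, expPS_eq_fsum, expPS_eq_fsum, fsum_mul_fsum
    ((orderGe_pow (E.coeff_zero_series_j hx)).smul _)
    ((orderGe_pow (E.coeff_zero_series_j hy)).smul _)]
  simp only [h2]

variable {E : LieRep K V A} {E' : LieRep K V' A'} (C : Crossed E E')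

/-- The flow of the integrated crossed morphism. -/
theorem Crossed.θ_exp_eq_exp_seqSum {x : ℕ → V} (hx : x 0 = 0) {Ω : ℕ → ℕ → V'}
    (hΩ : IsFlow (conv E'.br) 0 (conv C.act x) 0 (C.φ.compLeft ℕ x) Ω) :
    C.series.θ (expPS K (E.series.j x)) = expPS K (E'.series.j (seqSum Ω)) := by
  have hφx : C.φ.compLeft ℕ x 0 = 0 := by
    change C.φ (x 0) = 0
    rw [hx, map_zero]
  have hord : ∀ k n, n < k → Ω k n = 0 := hΩ.order (conv_order E'.br) (fun _ _ _ _ _ _ _ _ => rfl)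
    (fun u k hu n hn => conv_order C.act x u 1 k (fun m hm => by rwa [Nat.lt_one_iff.1 hm]) hu n
      (by lia)) rfl hφx
  have h1 := coeff_succ_expPS_flow E'.series (D := C.series.D x) (C.series.D_mul x)
    (C.series.D_j x) hΩ
  -- In the time variable, e^Ω and θ(e^{sx}) both solve Z' = D_x Z + φ(x)Z with Z(0) = 1.
  have h2 (k : ℕ) : PowerSeries.coeff k (expPS K (E'.series.series.j Ω)) =
      C.series.θ ((k.factorial : K)⁻¹ • E.series.j x ^ k) := by
    induction k with
    | zero => simp [coeff_zero_expPS, C.series.θ_one]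
    | succ k ih =>
      apply cast_succ_smul_injective (K := K) k
      rw [h1, ih, map_zero, mul_zero, zero_add, ← map_smul, smul_smul, fact_inv_mul, pow_succ',
        ← mul_smul_comm, C.series.θ_mul, add_comm]
      rfl
  have hord' := (orderGe_pow (E.coeff_zero_series_j hx)).smul fun k => (k.factorial : K)⁻¹
  rw [expPS_seqSum E' hord hΩ.zero, total, expPS_eq_fsum]
  refine ((keepsOrder_coeffMap C.θ).map_fsum hord').trans ?_
  simp only [h2]
  rfl

/-- The flow of the post-Lie Magnus expansion. -/
theorem Crossed.θ_exp_seqSum_eq_exp {ψ : V' →ₗ[K] V} (hψ : ∀ y, C.φ (ψ y) = y)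
    {B₂ : V →ₗ[K] V →ₗ[K] V} (hB₂ : ∀ x y, B₂ x y = ψ (C.act x (C.φ y))) {a : ℕ → V'}
    (ha : a 0 = 0) {Ω : ℕ → ℕ → V} (hΩ : IsFlow (conv E.br) (conv B₂) 0 (ψ.compLeft ℕ a) 0 Ω) :
    C.series.θ (expPS K (E.series.j (seqSum Ω))) = expPS K (E'.series.j a) := by
  have hψa : ψ.compLeft ℕ a 0 = 0 := by
    change ψ (a 0) = 0
    rw [ha, map_zero]
  have hord : ∀ k n, n < k → Ω k n = 0 := hΩ.order (conv_order E.br) (conv_order B₂)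
    (fun _ _ _ _ _ => rfl) hψa rfl
  have h2 := C.series.θ_expPS_flow (ψ := ψ.compLeft ℕ) (fun y => funext fun n => hψ (y n))
    (fun x y => by
      funext n
      change conv B₂ x y n = ψ (conv C.act x (fun m => C.φ (y m)) n)
      rw [conv_apply, conv_apply, map_sum]
      exact sum_congr rfl fun p _ => hB₂ _ _) hΩ
  have hst : IsSteep (expPS K (E.series.series.j Ω)) := isSteep_expPS (isSteep_series_j E hord)
  rw [expPS_seqSum E hord hΩ.zero, total, expPS_eq_fsum (E'.series.j a)]
  refine ((keepsOrder_coeffMap C.θ).map_fsum hst).trans ?_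
  refine congrArg (fsum (A := A')) (funext fun k => ?_)
  exact (coeff_coeffMap C.series.θ _ k).symm.trans (h2 k)

end SeqSum

/-! ### The formal series of a crossed morphism -/

section FormalSeries

attribute [local instance 100] LieRing.ofAssociativeRing

open UniversalEnvelopingAlgebra (ι)

variable {K g h : Type*} [Field K] [LieRing g] [LieAlgebra K g] [LieRing h] [LieAlgebra K h]

/-- A Lie algebra in its enveloping algebra. -/
def envRep (K g : Type*) [Field K] [LieRing g] [LieAlgebra K g] :
    LieRep K g (UniversalEnvelopingAlgebra K g) where
  br := LinearMap.mk₂ K (fun x y => ⁅x, y⁆) add_lie smul_lie lie_add (fun c x y => lie_smul c x y)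
  j := (ι K (L := g)).toLinearMap
  j_br x y := ((ι K).map_lie x y).trans (LieRing.of_associative_ring_bracket _ _)

variable {υ : g →ₗ⁅K⁆ LieDerivation K h h}

/-- The action of `g` on `h`. -/
def actLin (υ : g →ₗ⁅K⁆ LieDerivation K h h) : g →ₗ[K] h →ₗ[K] h :=
  LinearMap.mk₂ K (fun x y => υ x y) (fun x x' y => by rw [map_add]; rfl)
    (fun c x y => by rw [map_smul]; rfl) (fun x => map_add (υ x)) (fun c x => map_smul (υ x) c)

/-- The data of a crossed morphism on the enveloping algebras. -/
def envCrossed (φ : CrossedMorphism υ) : Crossed (envRep K g) (envRep K h) where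
  φ := φ.toLinearMap
  act := actLin υ
  D :=
    { toFun := fun x => derivExt (υ x)
      map_add' := fun x y => by rw [map_add, derivExt_add]
      map_smul' := fun c x => by rw [map_smul, derivExt_smul]; rfl }
  D_mul x := derivExt_mul (υ x)
  D_j x := derivExt_ι (υ x)
  θ := Theta φ
  θ_one := Theta_one φ
  θ_mul := Theta_ι_mul φ

theorem ExpAct_eq (x : ℕ → g) (b : ℕ → h) : ExpAct υ x b = opSeries (expS K) (actLin υ) x b := by
  funext n
  refine sum_congr rfl fun k _ => ?_
  rw [Module.End.pow_apply, expS, PowerSeries.coeff_mk]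
  rfl

theorem ThetaInvPS_ThetaPS {φ : CrossedMorphism υ} (hΘ : Function.Injective (Theta φ))
    (u : PowerSeries (UniversalEnvelopingAlgebra K g)) : ThetaInvPS φ (ThetaPS φ u) = u := by
  ext n
  rw [ThetaInvPS, PowerSeries.coeff_mk, ThetaPS, PowerSeries.coeff_mk]
  exact Function.leftInverse_invFun hΘ _

theorem ThetaPS_injective {φ : CrossedMorphism υ} (hΘ : Function.Injective (Theta φ)) :
    Function.Injective (ThetaPS φ) :=
  Function.LeftInverse.injective (ThetaInvPS_ThetaPS hΘ)

/-- The inverse of a bijective crossed morphism. -/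
def invLin {φ : CrossedMorphism υ} (hφ : Function.Bijective φ.toLinearMap) : h →ₗ[K] g :=
  (LinearEquiv.ofBijective φ.toLinearMap hφ).symm

theorem apply_invLin {φ : CrossedMorphism υ} (hφ : Function.Bijective φ.toLinearMap) (y : h) :
    φ.toLinearMap (invLin hφ y) = y :=
  (LinearEquiv.ofBijective φ.toLinearMap hφ).apply_symm_apply y

theorem ExpAct_zero {x : ℕ → g} {b : ℕ → h} (hb : b 0 = 0) : ExpAct υ x b 0 = 0 := by
  simp [ExpAct, hb]

section Injective

theorem logPS_expU [CharZero K] {x : ℕ → g} (hx : x 0 = 0) : logPS K (expU K x) = toU K x :=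
  logPS_expPS ((envRep K g).coeff_zero_series_j hx)

variable [CharZero K] [FiniteDimensional K g]

theorem toU_injective : Function.Injective (toU K : (ℕ → g) → _) := fun x y hxy => by
  funext n
  have := congrArg (PowerSeries.coeff n) hxy
  simp only [toU, PowerSeries.coeff_mk] at this
  exact ι_injective this

/-- Injectivity of 𝔤 → U(𝔤) makes the choice in `logU` unambiguous, so exhibiting a series as an
exponential computes its logarithm. -/
theorem logU_expPS {z : ℕ → g} (hz : z 0 = 0) : logU K (expPS K (toU K z)) = z := by
  have h1 : toU K z = logPS K (expPS K (toU K z)) :=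
    (logPS_expPS ((envRep K g).coeff_zero_series_j hz)).symm
  have H : ∃ x : ℕ → g, toU K x = logPS K (expPS K (toU K z)) := ⟨z, h1⟩
  rw [logU, dif_pos H]
  exact toU_injective (H.choose_spec.trans h1.symm)

theorem expU_injective {x y : ℕ → g} (hx : x 0 = 0) (hy : y 0 = 0) (h : expU K x = expU K y) :
    x = y := by
  rw [← logU_expPS (K := K) hx, ← logU_expPS (K := K) hy]
  exact congrArg (logU K) h

theorem BCH_eq_seqSum {x y : ℕ → g} (hx : x 0 = 0) (hy : y 0 = 0) {Ω : ℕ → ℕ → g}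
    (hΩ : IsFlow (conv (envRep K g).br) 0 0 y x Ω) : BCH K x y = seqSum Ω := by
  rw [BCH]
  refine (congrArg (logU K) (exp_mul_exp_eq_exp_seqSum (envRep K g) hx hy hΩ)).trans
    (logU_expPS ?_)
  rw [seqSum, sum_range_one, hΩ.zero, Pi.zero_apply]

theorem BCH_spec {x y : ℕ → g} (hx : x 0 = 0) (hy : y 0 = 0) :
    BCH K x y 0 = 0 ∧ expU K (BCH K x y) = expU K x * expU K y := by
  obtain ⟨Ω, hΩ⟩ := exists_isFlow (conv (envRep K g).br) 0 0 y x
  rw [BCH_eq_seqSum hx hy hΩ]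
  refine ⟨?_, (exp_mul_exp_eq_exp_seqSum (envRep K g) hx hy hΩ).symm⟩
  rw [seqSum, sum_range_one, hΩ.zero, Pi.zero_apply]

end Injective

/-- The action of `g` on `h`, transported to `g`. -/
def actInv {φ : CrossedMorphism υ} (hφ : Function.Bijective φ.toLinearMap) : g →ₗ[K] g →ₗ[K] g :=
  LinearMap.mk₂ K (fun x y => invLin hφ (actLin υ x (φ.toLinearMap y)))
    (fun x x' y => by simp) (fun c x y => by simp) (fun x y y' => by simp) (fun c x y => by simp)

theorem Theta_exp_seqSum [CharZero K] {φ : CrossedMorphism υ}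
    (hφ : Function.Bijective φ.toLinearMap)
    {a : ℕ → h} (ha : a 0 = 0) {Ω : ℕ → ℕ → g}
    (hΩ : IsFlow (conv (envRep K g).br) (conv (actInv hφ)) 0 ((invLin hφ).compLeft ℕ a) 0 Ω) :
    ThetaPS φ (expU K (seqSum Ω)) = expU K a :=
  (envCrossed φ).θ_exp_seqSum_eq_exp (apply_invLin hφ) (fun _ _ => rfl) ha hΩ

variable [CharZero K] [FiniteDimensional K h] (φ : CrossedMorphism υ)

theorem Phi_eq_seqSum {x : ℕ → g} (hx : x 0 = 0) {Ω : ℕ → ℕ → h}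
    (hΩ : IsFlow (conv (envRep K h).br) 0 (conv (actLin υ) x) 0 (φ.toLinearMap.compLeft ℕ x) Ω) :
    Phi φ x = seqSum Ω := by
  rw [Phi]
  refine (congrArg (logU K) ((envCrossed φ).θ_exp_eq_exp_seqSum hx hΩ)).trans (logU_expPS ?_)
  rw [seqSum, sum_range_one, hΩ.zero, Pi.zero_apply]

theorem Phi_spec {x : ℕ → g} (hx : x 0 = 0) :
    Phi φ x 0 = 0 ∧ expU K (Phi φ x) = ThetaPS φ (expU K x) := by
  obtain ⟨Ω, hΩ⟩ := exists_isFlow (conv (envRep K h).br) 0 (conv (actLin υ) x) 0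
    (φ.toLinearMap.compLeft ℕ x)
  rw [Phi_eq_seqSum φ hx hΩ]
  refine ⟨?_, ((envCrossed φ).θ_exp_eq_exp_seqSum hx hΩ).symm⟩
  rw [seqSum, sum_range_one, hΩ.zero, Pi.zero_apply]

variable {φ}

variable [FiniteDimensional K g]

theorem chi_eq_seqSum (hφ : Function.Bijective φ.toLinearMap)
    {a : ℕ → h} (ha : a 0 = 0) {Ω : ℕ → ℕ → g}
    (hΩ : IsFlow (conv (envRep K g).br) (conv (actInv hφ)) 0 ((invLin hφ).compLeft ℕ a) 0 Ω) :
    chi φ a = seqSum Ω := by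
  rw [chi, ← Theta_exp_seqSum hφ ha hΩ, ThetaInvPS_ThetaPS (Theta_bijective φ hφ).1]
  refine logU_expPS ?_
  rw [seqSum, sum_range_one, hΩ.zero, Pi.zero_apply]

theorem chi_spec (hφ : Function.Bijective φ.toLinearMap)
    {a : ℕ → h} (ha : a 0 = 0) :
    chi φ a 0 = 0 ∧ ThetaPS φ (expU K (chi φ a)) = expU K a := by
  obtain ⟨Ω, hΩ⟩ := exists_isFlow (conv (envRep K g).br) (conv (actInv hφ)) 0
    ((invLin hφ).compLeft ℕ a) 0
  rw [chi_eq_seqSum hφ ha hΩ]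
  refine ⟨?_, Theta_exp_seqSum hφ ha hΩ⟩
  rw [seqSum, sum_range_one, hΩ.zero, Pi.zero_apply]

theorem Phi_chi (hφ : Function.Bijective φ.toLinearMap) {a : ℕ → h} (ha : a 0 = 0) :
    Phi φ (chi φ a) = a := by
  have h1 := chi_spec hφ ha
  have h2 := Phi_spec φ h1.1
  exact expU_injective (K := K) h2.1 ha (h2.2.trans h1.2)

theorem chi_Phi (hφ : Function.Bijective φ.toLinearMap) {x : ℕ → g} (hx : x 0 = 0) :
    chi φ (Phi φ x) = x := by
  have h1 := Phi_spec φ hx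
  have h2 := chi_spec hφ h1.1
  exact expU_injective (K := K) h2.1 hx
    (ThetaPS_injective (Theta_bijective φ hφ).1 (h2.2.trans h1.2))

/-- Compared after exponentiation: Θ(e^x e^y) = Θ(e^x) e^{υ_x}(e^{Φ(y)}), and e^{υ_x} passes inside
the exponential because υ_x acts by a derivation. Bijectivity of φ plays no role here. -/
theorem Phi_BCH (φ : CrossedMorphism υ) {x y : ℕ → g} (hx : x 0 = 0) (hy : y 0 = 0) :
    Phi φ (BCH K x y) = BCH K (Phi φ x) (ExpAct υ x (Phi φ y)) := by
  have h1 := BCH_spec (K := K) hx hy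
  have h2 := Phi_spec φ h1.1
  have h3 := Phi_spec φ hx
  have h4 := Phi_spec φ hy
  have h5 := BCH_spec (K := K) h3.1 (ExpAct_zero (υ := υ) (x := x) h4.1)
  refine expU_injective (K := K) h2.1 h5.1 ?_
  rw [h2.2, h1.2, h5.2, h3.2]
  refine ((envCrossed φ).θ_expPS_mul hx (expU K y)).trans (congrArg (ThetaPS φ (expU K x) * ·) ?_)
  have h6 : (envCrossed φ).series.θ (expU K y) = expPS K ((envRep K h).series.j (Phi φ y)) :=
    h4.2.symm
  refine (congrArg _ h6).trans ?_
  have hD : RaisesOrder ((envCrossed φ).series.D x) := raisesOrder_seqEnd _ hx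
  rw [opCalc_exp_expPS hD ((envCrossed φ).series.D_mul x)
    ((envRep K h).coeff_zero_series_j h4.1), ExpAct_eq, expU]
  refine congrArg _ ?_
  exact (seqMap_opSeries (fun w => ((envCrossed φ).series.D_j x w).symm) (expS K) (Phi φ y)).symm

theorem BCH_chi (hφ : Function.Bijective φ.toLinearMap) {a b : ℕ → h} (ha : a 0 = 0)
    (hb : b 0 = 0) : BCH K (chi φ a) (chi φ b) = chi φ (BCH K a (ExpAct υ (chi φ a) b)) := by
  have h1 := chi_spec hφ ha
  have h2 := chi_spec hφ hb
  rw [← chi_Phi hφ (BCH_spec (K := K) h1.1 h2.1).1, Phi_BCH φ h1.1 h2.1, Phi_chi hφ ha,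
    Phi_chi hφ hb]

end FormalSeries

/-! ### Bounds for the coefficients of the series -/

section Coefficients

variable {𝕜 : Type*} [RCLike 𝕜]

theorem norm_factorial_inv (n : ℕ) : ‖((n.factorial : 𝕜)⁻¹)‖ = (n.factorial : ℝ)⁻¹ := by
  rw [norm_inv, RCLike.norm_natCast]

theorem factorial_inv_le_one (n : ℕ) : (n.factorial : ℝ)⁻¹ ≤ 1 :=
  inv_le_one_of_one_le₀ (by exact_mod_cast n.factorial_pos)

theorem norm_coeff_expNegS_le (n : ℕ) : ‖PowerSeries.coeff n (expNegS 𝕜)‖ ≤ 1 := by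
  rw [expNegS, PowerSeries.coeff_mk, norm_mul, norm_pow, norm_neg, norm_one, one_pow, one_mul,
    norm_factorial_inv]
  exact factorial_inv_le_one n

theorem norm_coeff_dexpS_le (n : ℕ) : ‖PowerSeries.coeff n (dexpS 𝕜)‖ ≤ (1 / 2) ^ n := by
  rw [dexpS, PowerSeries.coeff_mk, norm_mul, norm_pow, norm_neg, norm_one, one_pow, one_mul,
    norm_factorial_inv, one_div, inv_pow]
  have h : 2 ^ n ≤ (n + 1).factorial := by
    induction n with
    | zero => simp
    | succ n ih =>
      rw [Nat.factorial_succ, pow_succ, mul_comm]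
      exact Nat.mul_le_mul (by lia) ih
  exact inv_anti₀ (by positivity) (by exact_mod_cast h)

/-- In the recursion from G·F = 1 the coefficients of G are bounded by 2^{-k}, and those with k ≥ 1
sum to less than 1. -/
theorem norm_coeff_todd_le (n : ℕ) : ‖PowerSeries.coeff n (todd 𝕜)‖ ≤ 1 := by
  induction n using Nat.strong_induction_on with
  | _ n ih =>
    have h := congrArg (PowerSeries.coeff n) (dexpS_mul_todd 𝕜)
    have h0 : PowerSeries.coeff 0 (dexpS 𝕜) = 1 := by simp [dexpS]
    cases n with
    | zero =>
      rw [PowerSeries.coeff_mul, PowerSeries.coeff_one, if_pos rfl, Finset.Nat.antidiagonal_zero,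
        sum_singleton, h0, one_mul] at h
      rw [h, norm_one]
    | succ n =>
      rw [PowerSeries.coeff_mul, PowerSeries.coeff_one, if_neg n.succ_ne_zero,
        Finset.Nat.sum_antidiagonal_succ, h0, one_mul] at h
      rw [eq_neg_of_add_eq_zero_left h, norm_neg]
      calc ‖∑ p ∈ antidiagonal n, PowerSeries.coeff (p.1 + 1) (dexpS 𝕜) *
            PowerSeries.coeff p.2 (todd 𝕜)‖
          ≤ ∑ p ∈ antidiagonal n, (1 / 2 : ℝ) ^ (p.1 + 1) := by
            refine norm_sum_le_of_le _ fun p hp => ?_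
            have := mem_antidiagonal.1 hp
            rw [norm_mul]
            calc _ ≤ (1 / 2 : ℝ) ^ (p.1 + 1) * 1 :=
                  mul_le_mul (norm_coeff_dexpS_le _) (ih _ (by lia)) (norm_nonneg _) (by positivity)
              _ = _ := mul_one _
        _ = 1 - (1 / 2) ^ (n + 1) := by
            rw [Finset.Nat.sum_antidiagonal_eq_sum_range_succ_mk]
            induction n with
            | zero => norm_num
            | succ n ih' =>
              rw [sum_range_succ]
              dsimp only at ih' ⊢
              have : ∑ k ∈ range (n + 1), (1 / 2 : ℝ) ^ (k + 1) = 1 - (1 / 2) ^ (n + 1) := by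
                clear * -
                induction n with
                | zero => norm_num
                | succ n ih => rw [sum_range_succ, ih]; ring
              rw [this]
              ring
        _ ≤ 1 := by
            have : (0 : ℝ) ≤ (1 / 2) ^ (n + 1) := by positivity
            linarith

theorem norm_coeff_toddNeg_le (n : ℕ) : ‖PowerSeries.coeff n (toddNeg 𝕜)‖ ≤ 1 := by
  rw [toddNeg, PowerSeries.coeff_mk, norm_mul, norm_pow, norm_neg, norm_one, one_pow, one_mul]
  exact norm_coeff_todd_le n

theorem norm_succ_inv_le (n : ℕ) : ‖((n : 𝕜) + 1)⁻¹‖ ≤ 1 := by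
  have h : ((n : 𝕜) + 1) = ((n + 1 : ℕ) : 𝕜) := by push_cast; rfl
  rw [h, norm_inv, RCLike.norm_natCast]
  exact inv_le_one_of_one_le₀ (by exact_mod_cast Nat.le_add_left 1 n)

end Coefficients

/-! ### Absolutely convergent sequences in coordinates -/

section Near

variable {𝕜 V W X F₁ F₂ F₃ : Type*} [RCLike 𝕜] [AddCommGroup V] [Module 𝕜 V]
  [AddCommGroup W] [Module 𝕜 W] [AddCommGroup X] [Module 𝕜 X]
  [NormedAddCommGroup F₁] [NormedSpace 𝕜 F₁]
  [NormedAddCommGroup F₂] [NormedSpace 𝕜 F₂]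
  [NormedAddCommGroup F₃] [NormedSpace 𝕜 F₃]

/-- In the coordinates `e`, the series of norms of `u` is bounded by `C`, and `u` sums to `w`. -/
structure Near (e : V ≃ₗ[𝕜] F₁) (C : ℝ) (u : ℕ → V) (w : V) : Prop where
  sum_le : ∀ N, ∑ i ∈ range N, ‖e (u i)‖ ≤ C
  hasSum : HasSum (fun n => e (u n)) (e w)

theorem exists_continuous_bilin [FiniteDimensional 𝕜 F₁] [FiniteDimensional 𝕜 F₂]
    (e₁ : V ≃ₗ[𝕜] F₁) (e₂ : W ≃ₗ[𝕜] F₂) (e₃ : X ≃ₗ[𝕜] F₃)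
    (B : V →ₗ[𝕜] W →ₗ[𝕜] X) :
    ∃ B' : F₁ →L[𝕜] F₂ →L[𝕜] F₃, ∀ v w, B' (e₁ v) (e₂ w) = e₃ (B v w) := by
  let T : F₁ →ₗ[𝕜] F₂ →L[𝕜] F₃ :=
    { toFun := fun a => LinearMap.toContinuousLinearMap
        (e₃.toLinearMap ∘ₗ B (e₁.symm a) ∘ₗ e₂.symm.toLinearMap)
      map_add' := fun a b => by ext; simp
      map_smul' := fun c a => by ext; simp }
  exact ⟨LinearMap.toContinuousLinearMap T, fun v w => by simp [T]⟩

theorem exists_bilin_bound [FiniteDimensional 𝕜 F₁] [FiniteDimensional 𝕜 F₂]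
    (e₁ : V ≃ₗ[𝕜] F₁) (e₂ : W ≃ₗ[𝕜] F₂) (e₃ : X ≃ₗ[𝕜] F₃)
    (B : V →ₗ[𝕜] W →ₗ[𝕜] X) :
    ∃ τ : ℝ, 0 ≤ τ ∧ ∀ v w, ‖e₃ (B v w)‖ ≤ τ * (‖e₁ v‖ * ‖e₂ w‖) := by
  obtain ⟨B', hB'⟩ := exists_continuous_bilin e₁ e₂ e₃ B
  refine ⟨‖B'‖, norm_nonneg B', fun v w => ?_⟩
  rw [← hB', ← mul_assoc]
  exact B'.le_opNorm₂ _ _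

theorem exists_linear_bound [FiniteDimensional 𝕜 F₁] (e₁ : V ≃ₗ[𝕜] F₁) (e₂ : W ≃ₗ[𝕜] F₂) (L : V →ₗ[𝕜] W) :
    ∃ τ : ℝ, 0 ≤ τ ∧ ∀ v, ‖e₂ (L v)‖ ≤ τ * ‖e₁ v‖ := by
  let T : F₁ →L[𝕜] F₂ :=
    LinearMap.toContinuousLinearMap (e₂.toLinearMap ∘ₗ L ∘ₗ e₁.symm.toLinearMap)
  refine ⟨‖T‖, norm_nonneg _, fun v => ?_⟩
  have : e₂ (L v) = T (e₁ v) := by simp [T]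
  rw [this]
  exact T.le_opNorm _

/-- The double family is absolutely summable, so it may be summed by rows, giving B(a, b), or along
antidiagonals. -/
theorem hasSum_antidiagonal [CompleteSpace F₃] (B : F₁ →L[𝕜] F₂ →L[𝕜] F₃) {u : ℕ → F₁} {w : ℕ → F₂}
    {a : F₁} {b : F₂} (hu : Summable fun n => ‖u n‖) (hw : Summable fun n => ‖w n‖)
    (ha : HasSum u a) (hb : HasSum w b) :
    HasSum (fun n => ∑ p ∈ antidiagonal n, B (u p.1) (w p.2)) (B a b) := by
  have h1 : Summable fun p : ℕ × ℕ => B (u p.1) (w p.2) := by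
    refine Summable.of_norm_bounded (g := fun p : ℕ × ℕ => ‖B‖ * (‖u p.1‖ * ‖w p.2‖))
      ((hu.mul_of_nonneg hw (fun _ => norm_nonneg _) fun _ => norm_nonneg _).mul_left _)
      fun p => ?_
    rw [← mul_assoc]
    exact B.le_opNorm₂ _ _
  obtain ⟨s, hs⟩ := h1
  have h2 : HasSum (fun i => B (u i) b) s := hs.prod_fiberwise fun i => (B (u i)).hasSum hb
  have h3 : HasSum (fun i => B (u i) b) (B a b) :=
    (ContinuousLinearMap.apply 𝕜 F₃ b).hasSum (B.hasSum ha)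
  obtain rfl := h2.unique h3
  have h4 := (Finset.HasAntidiagonal.sigmaAntidiagonalEquivProd (A := ℕ)).hasSum_iff.2 hs
  refine h4.sigma fun n => ?_
  have h5 := hasSum_fintype fun p : antidiagonal n => B (u p.1.1) (w p.1.2)
  rwa [Finset.sum_coe_sort (antidiagonal n) fun p => B (u p.1) (w p.2)] at h5

variable {e₁ : V ≃ₗ[𝕜] F₁} {e₂ : W ≃ₗ[𝕜] F₂} {e₃ : X ≃ₗ[𝕜] F₃}

theorem Near.nonneg {C : ℝ} {u : ℕ → V} {w : V} (h : Near e₁ C u w) : 0 ≤ C := by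
  simpa using h.sum_le 0

theorem Near.summable {C : ℝ} {u : ℕ → V} {w : V} (h : Near e₁ C u w) :
    Summable fun n => ‖e₁ (u n)‖ :=
  summable_of_sum_range_le (fun _ => norm_nonneg _) h.sum_le

theorem Near.norm_le {C : ℝ} {u : ℕ → V} {w : V} (h : Near e₁ C u w) : ‖e₁ w‖ ≤ C := by
  rw [← h.hasSum.tsum_eq]
  exact (norm_tsum_le_tsum_norm h.summable).trans
    (h.summable.tsum_le_of_sum_range_le h.sum_le)

theorem Near.mono {C D : ℝ} {u : ℕ → V} {w : V} (h : Near e₁ C u w) (hCD : C ≤ D) :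
    Near e₁ D u w :=
  ⟨fun N => (h.sum_le N).trans hCD, h.hasSum⟩

theorem near_zero (e : V ≃ₗ[𝕜] F₁) : Near e 0 (0 : ℕ → V) 0 :=
  ⟨fun N => by simp, by simp [hasSum_zero]⟩

theorem near_single (e : V ≃ₗ[𝕜] F₁) (k : ℕ) (w : V) : Near e ‖e w‖ (Pi.single k w) w := by
  have h (i : ℕ) : e ((Pi.single k w : ℕ → V) i) = (Pi.single k (e w) : ℕ → F₁) i := by
    rw [Pi.single_apply, Pi.single_apply]
    split_ifs
    · rfl
    · exact map_zero e
  refine ⟨fun N => ?_, ?_⟩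
  · have h' (i : ℕ) : ‖(Pi.single k (e w) : ℕ → F₁) i‖ = if i = k then ‖e w‖ else 0 := by
      rw [Pi.single_apply]
      split_ifs
      · rfl
      · exact norm_zero
    simp only [h, h', Finset.sum_ite_eq']
    split_ifs
    · exact le_rfl
    · exact norm_nonneg _
  · simp only [h]
    exact hasSum_pi_single k (e w)

theorem Near.add {C D : ℝ} {u u' : ℕ → V} {w w' : V} (h : Near e₁ C u w) (h' : Near e₁ D u' w') :
    Near e₁ (C + D) (u + u') (w + w') := by
  refine ⟨fun N => ?_, ?_⟩
  · calc _ ≤ ∑ i ∈ range N, (‖e₁ (u i)‖ + ‖e₁ (u' i)‖) := sum_le_sum fun i _ => by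
          rw [Pi.add_apply, map_add]
          exact norm_add_le _ _
      _ ≤ C + D := by
          rw [sum_add_distrib]
          exact add_le_add (h.sum_le N) (h'.sum_le N)
  · simpa using h.hasSum.add h'.hasSum

theorem Near.smul_of_le {c : 𝕜} {r C : ℝ} (hc : ‖c‖ ≤ r) {u : ℕ → V} {w : V} (h : Near e₁ C u w) :
    Near e₁ (r * C) (c • u) (c • w) := by
  have hr : 0 ≤ r := (norm_nonneg c).trans hc
  refine ⟨fun N => ?_, ?_⟩
  · calc _ ≤ ∑ i ∈ range N, r * ‖e₁ (u i)‖ := sum_le_sum fun i _ => by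
          rw [Pi.smul_apply, map_smul, norm_smul]
          exact mul_le_mul_of_nonneg_right hc (norm_nonneg _)
      _ ≤ r * C := by
          rw [← mul_sum]
          exact mul_le_mul_of_nonneg_left (h.sum_le N) hr
  · simpa using h.hasSum.const_smul c

theorem Near.map [FiniteDimensional 𝕜 F₁] {L : V →ₗ[𝕜] W} {τ C : ℝ} (hτ : 0 ≤ τ) (hL : ∀ v, ‖e₂ (L v)‖ ≤ τ * ‖e₁ v‖)
    {u : ℕ → V} {w : V} (h : Near e₁ C u w) : Near e₂ (τ * C) (L.compLeft ℕ u) (L w) := by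
  refine ⟨fun N => ?_, ?_⟩
  · calc _ ≤ ∑ i ∈ range N, τ * ‖e₁ (u i)‖ := sum_le_sum fun i _ => hL _
      _ ≤ τ * C := by
          rw [← mul_sum]
          exact mul_le_mul_of_nonneg_left (h.sum_le N) hτ
  · let T : F₁ →L[𝕜] F₂ :=
      LinearMap.toContinuousLinearMap (e₂.toLinearMap ∘ₗ L ∘ₗ e₁.symm.toLinearMap)
    have hT (v : V) : e₂ (L v) = T (e₁ v) := by simp [T]
    have := T.hasSum h.hasSum
    simp only [← hT] at this
    exact this

theorem Near.conv [FiniteDimensional 𝕜 F₁] [FiniteDimensional 𝕜 F₂] [FiniteDimensional 𝕜 F₃]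
    {B : V →ₗ[𝕜] W →ₗ[𝕜] X} {τ C D : ℝ} (hτ : 0 ≤ τ)
    (hB : ∀ v w, ‖e₃ (B v w)‖ ≤ τ * (‖e₁ v‖ * ‖e₂ w‖)) {u : ℕ → V} {v : V} {x : ℕ → W} {y : W}
    (h : Near e₁ C u v) (h' : Near e₂ D x y) :
    Near e₃ (τ * (C * D)) (PostLieMagnus.conv B u x) (B v y) := by
  have := FiniteDimensional.complete 𝕜 F₃
  refine ⟨fun N => ?_, ?_⟩
  · calc _ ≤ ∑ i ∈ range N, PostLieMagnus.conv (mulScaled τ) (fun n => ‖e₁ (u n)‖)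
          (fun n => ‖e₂ (x n)‖) i := sum_le_sum fun i _ => by
            rw [conv_apply, conv_apply, map_sum]
            exact norm_sum_le_of_le _ fun p _ => hB _ _
      _ ≤ τ * ((∑ i ∈ range N, ‖e₁ (u i)‖) * ∑ i ∈ range N, ‖e₂ (x i)‖) :=
          sum_conv_le hτ (fun _ => norm_nonneg _) (fun _ => norm_nonneg _) N
      _ ≤ τ * (C * D) := mul_le_mul_of_nonneg_left (mul_le_mul (h.sum_le N) (h'.sum_le N)
          (sum_nonneg fun _ _ => norm_nonneg _) h.nonneg) hτ
  · obtain ⟨B', hB'⟩ := exists_continuous_bilin e₁ e₂ e₃ B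
    have := hasSum_antidiagonal B' h.summable h'.summable h.hasSum h'.hasSum
    simp only [hB', ← map_sum] at this
    exact this

/-- Fubini's theorem for the formal sum of a family. -/
theorem near_seqSum [FiniteDimensional 𝕜 F₁] {Ω : ℕ → ℕ → V} {ω : ℕ → V} {U : ℕ → ℝ} {M : ℝ}
    (hord : ∀ k n, n < k → Ω k n = 0) (hU : ∀ N, ∑ k ∈ range N, U k ≤ M)
    (h : ∀ k, Near e₁ (U k) (Ω k) (ω k)) :
    (Summable fun k => e₁ (ω k)) ∧
      ∀ s, HasSum (fun k => e₁ (ω k)) (e₁ s) → Near e₁ M (seqSum Ω) s := by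
  have := FiniteDimensional.complete 𝕜 F₁
  have hUs : Summable U := summable_of_sum_range_le (fun k => (h k).nonneg) hU
  refine ⟨.of_norm_bounded hUs fun k => (h k).norm_le, fun s hs => ⟨fun N => ?_, ?_⟩⟩
  · calc ∑ n ∈ range N, ‖e₁ (seqSum Ω n)‖ ≤ ∑ n ∈ range N, ∑ k ∈ range N, ‖e₁ (Ω k n)‖ := by
          refine sum_le_sum fun n hn => ?_
          rw [seqSum, map_sum]
          refine (norm_sum_le _ _).trans (sum_le_sum_of_subset_of_nonneg
            (range_subset_range.2 (mem_range.1 hn)) fun _ _ _ => norm_nonneg _)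
      _ = ∑ k ∈ range N, ∑ n ∈ range N, ‖e₁ (Ω k n)‖ := sum_comm
      _ ≤ ∑ k ∈ range N, U k := sum_le_sum fun k _ => (h k).sum_le N
      _ ≤ M := hU N
  · have h1 : Summable fun p : ℕ × ℕ => ‖e₁ (Ω p.1 p.2)‖ := by
      refine (summable_prod_of_nonneg fun _ => norm_nonneg _).2 ⟨fun k => (h k).summable, ?_⟩
      exact .of_nonneg_of_le (fun k => tsum_nonneg fun _ => norm_nonneg _)
        (fun k => (h k).summable.tsum_le_of_sum_range_le (h k).sum_le) hUs
    have h2 : Summable fun p : ℕ × ℕ => e₁ (Ω p.1 p.2) := .of_norm h1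
    obtain ⟨t, ht⟩ := h2
    have h3 : HasSum (fun k => e₁ (ω k)) t := ht.prod_fiberwise fun k => (h k).hasSum
    rw [hs.unique h3]
    have h4 := (Equiv.prodComm ℕ ℕ).hasSum_iff.2 ht
    refine h4.prod_fiberwise fun n => ?_
    rw [seqSum, map_sum]
    refine hasSum_sum_of_ne_finset_zero fun k hk => ?_
    have : n < k := by simpa [Nat.lt_succ_iff] using hk
    change e₁ (Ω k n) = 0
    rw [hord k n this, map_zero]

end Near

/-! ### Equations of Magnus type depending on a parameter -/

section MagnusData

variable {K X V : Type*} [Field K] [AddCommGroup X] [Module K X] [AddCommGroup V] [Module K V]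

theorem conv_single {W Y : Type*} [AddCommGroup W] [Module K W] [AddCommGroup Y] [Module K Y]
    (B : V →ₗ[K] W →ₗ[K] Y) (k l : ℕ) (u : V) (w : W) :
    conv B (Pi.single k u) (Pi.single l w) = Pi.single (k + l) (B u w) := by
  funext n
  rw [conv_apply, Pi.single_apply]
  split_ifs with hn
  · rw [sum_eq_single (k, l)]
    · simp
    · rintro ⟨i, j⟩ hp hne
      rw [mem_antidiagonal] at hp
      dsimp only at hp ⊢
      have hi : i ≠ k := by
        rintro rfl
        exact hne (Prod.ext rfl (by dsimp only; lia))
      rw [Pi.single_eq_of_ne hi, map_zero, LinearMap.zero_apply]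
    · intro h
      exact absurd (mem_antidiagonal.2 hn.symm) h
  · refine sum_eq_zero fun p hp => ?_
    rw [mem_antidiagonal] at hp
    by_cases h1 : p.1 = k
    · have h2 : p.2 ≠ l := by
        rintro rfl
        exact hn (by rw [← hp, h1])
      rw [Pi.single_eq_of_ne h2, map_zero]
    · rw [Pi.single_eq_of_ne h1, map_zero, LinearMap.zero_apply]

theorem compLeft_single {W : Type*} [AddCommGroup W] [Module K W] (L : V →ₗ[K] W) (k : ℕ) (u : V) :
    L.compLeft ℕ (Pi.single k u) = Pi.single k (L u) := by
  funext n
  change L ((Pi.single k u : ℕ → V) n) = _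
  rw [Pi.single_apply, Pi.single_apply]
  split_ifs
  · rfl
  · exact map_zero L

variable [CharZero K]

/-- The data of the equation `Ω' = F(B₁(Ω)) e^(-B₂(Ω)) v + F(-B₁(Ω)) v' + δ Ω`, where `v`, `v'` and
`δ` depend linearly on a parameter in `X`. -/
structure MagnusData (K X V : Type*) [Field K] [AddCommGroup X] [Module K X] [AddCommGroup V]
    [Module K V] where
  B₁ : V →ₗ[K] V →ₗ[K] V
  B₂ : V →ₗ[K] V →ₗ[K] V
  δ : X →ₗ[K] V →ₗ[K] V
  v : X →ₗ[K] V
  v' : X →ₗ[K] V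

namespace MagnusData

/-- The extension to formal power series. -/
def series (S : MagnusData K X V) : MagnusData K (ℕ → X) (ℕ → V) where
  B₁ := conv S.B₁
  B₂ := conv S.B₂
  δ := conv S.δ
  v := S.v.compLeft ℕ
  v' := S.v'.compLeft ℕ

/-- The coefficients of the solution. -/
def flow (S : MagnusData K X V) (x : X) : ℕ → V :=
  (exists_isFlow S.B₁ S.B₂ (S.δ x) (S.v x) (S.v' x)).choose

theorem isFlow (S : MagnusData K X V) (x : X) :
    IsFlow S.B₁ S.B₂ (S.δ x) (S.v x) (S.v' x) (S.flow x) :=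
  (exists_isFlow S.B₁ S.B₂ (S.δ x) (S.v x) (S.v' x)).choose_spec

/-- The value of the solution at time one, for a formal power series as parameter. -/
def formal (S : MagnusData K X V) (x : ℕ → X) : ℕ → V := seqSum (S.series.flow x)

theorem flow_order (S : MagnusData K X V) {x : ℕ → X} (hx : x 0 = 0) (k n : ℕ) (hn : n < k) :
    S.series.flow x k n = 0 := by
  refine (S.series.isFlow x).order (conv_order S.B₁) (conv_order S.B₂) (fun u k hu n hn => ?_) ?_ ?_
    k n hn
  · exact conv_order S.δ x u 1 k (fun m hm => by rwa [Nat.lt_one_iff.1 hm]) hu n (by lia)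
  · change S.v (x 0) = 0
    rw [hx, map_zero]
  · change S.v' (x 0) = 0
    rw [hx, map_zero]

end MagnusData

/-- The components of the solution are the coefficients for the parameter `t x`. -/
theorem MagnusData.formal_line (S : MagnusData K X V) (x : X) : S.formal (line x) = S.flow x := by
  -- The relation is u = t^k w: scaling the parameter by t multiplies the coefficient of s^k by t^k.
  have h : IsGradedRel (fun _ : K => True) S.series.B₁ S.series.B₂ (S.series.δ (line x)) S.B₁ S.B₂
      (S.δ x) 0 0 (fun k _ u w => u = Pi.single k w) :=
    { zero := fun k => (Pi.single_zero k).symm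
      add := fun {k _ _ _ _ _ _} hu hx => by rw [hu, hx, Pi.single_add]
      smul := fun {_ k _ _ _} _ hu => by rw [hu, Pi.single_smul]
      br₁ := fun hu hx => by
        rw [hu, hx]
        exact conv_single S.B₁ _ _ _ _
      br₂ := fun hu hx => by
        rw [hu, hx]
        exact conv_single S.B₂ _ _ _ _
      der := fun {k _ _ _} hu => by
        rw [hu, add_comm k 1]
        exact conv_single S.δ _ _ _ _ }
  obtain ⟨U, hU⟩ := exists_isMajorant 0 0 0 0
  have key (k : ℕ) : S.series.flow (line x) k = Pi.single k (S.flow x k) :=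
    h.flow (fun _ => trivial) (fun _ => trivial) (fun _ => trivial) (fun _ => trivial)
      (compLeft_single S.v 1 x) (compLeft_single S.v' 1 x) hU (S.series.isFlow _) (S.isFlow x) k
  funext n
  rw [formal, seqSum, sum_eq_single n]
  · rw [key, Pi.single_eq_same]
  · intro k _ hk
    rw [key, Pi.single_eq_of_ne (Ne.symm hk)]
  · simp

end MagnusData

/-! ### Evaluating flows at convergent series -/

section Evaluation

variable {𝕜 X V F₁ F₂ : Type*} [RCLike 𝕜] [AddCommGroup X] [Module 𝕜 X] [AddCommGroup V] [Module 𝕜 V]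
  [NormedAddCommGroup F₁] [NormedSpace 𝕜 F₁] [FiniteDimensional 𝕜 F₁]
  [NormedAddCommGroup F₂] [NormedSpace 𝕜 F₂] [FiniteDimensional 𝕜 F₂]
  (e₁ : X ≃ₗ[𝕜] F₁) (e₂ : V ≃ₗ[𝕜] F₂)

theorem MagnusData.exists_bound (S : MagnusData 𝕜 X V) : ∃ τ : ℝ, 0 ≤ τ ∧
    (∀ x y, ‖e₂ (S.B₁ x y)‖ ≤ τ * (‖e₂ x‖ * ‖e₂ y‖)) ∧
    (∀ x y, ‖e₂ (S.B₂ x y)‖ ≤ τ * (‖e₂ x‖ * ‖e₂ y‖)) ∧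
    (∀ x y, ‖e₂ (S.δ x y)‖ ≤ τ * (‖e₁ x‖ * ‖e₂ y‖)) ∧
    (∀ x, ‖e₂ (S.v x)‖ ≤ τ * ‖e₁ x‖) ∧ ∀ x, ‖e₂ (S.v' x)‖ ≤ τ * ‖e₁ x‖ := by
  obtain ⟨τ₁, h₁, H₁⟩ := exists_bilin_bound e₂ e₂ e₂ S.B₁
  obtain ⟨τ₂, h₂, H₂⟩ := exists_bilin_bound e₂ e₂ e₂ S.B₂
  obtain ⟨τ₃, h₃, H₃⟩ := exists_bilin_bound e₁ e₂ e₂ S.δ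
  obtain ⟨τ₄, h₄, H₄⟩ := exists_linear_bound e₁ e₂ S.v
  obtain ⟨τ₅, h₅, H₅⟩ := exists_linear_bound e₁ e₂ S.v'
  refine ⟨τ₁ + τ₂ + τ₃ + τ₄ + τ₅, by positivity, fun x y => (H₁ x y).trans ?_,
    fun x y => (H₂ x y).trans ?_, fun x y => (H₃ x y).trans ?_, fun x => (H₄ x).trans ?_,
    fun x => (H₅ x).trans ?_⟩ <;>
  exact mul_le_mul_of_nonneg_right (by linarith) (by positivity)

/-- A formal operation which can be evaluated at convergent series of small norm. -/
def Evaluable (P : (ℕ → X) → ℕ → V) : Prop :=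
  ∀ ε > 0, ∃ r > 0, ∀ (x : ℕ → X) (a : X), x 0 = 0 → Near e₁ r x a →
    (Summable fun n => e₂ (P (line a) n)) ∧
      ∀ s, HasSum (fun n => e₂ (P (line a) n)) (e₂ s) → Near e₂ ε (P x) s

/-- The transfer principle for `Near`, between the flow of the series x and the flow of its sum a;
then the sums over s and over t are interchanged. -/
theorem MagnusData.evaluable (S : MagnusData 𝕜 X V) : Evaluable e₁ e₂ S.formal := by
  obtain ⟨τ, hτ, h₁, h₂, h₃, h₄, h₅⟩ := S.exists_bound e₁ e₂
  intro ε hε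
  set M := min ε (1 / (2 * (τ + 1))) with hM
  have hM0 : 0 < M := lt_min hε (by positivity)
  have hτM : τ * M ≤ 1 / 2 := by
    calc τ * M ≤ τ * (1 / (2 * (τ + 1))) := mul_le_mul_of_nonneg_left (min_le_right _ _) hτ
      _ ≤ 1 / 2 := by
        rw [mul_one_div, div_le_div_iff₀ (by positivity) (by positivity)]
        linarith
  -- This makes τr ≤ M/12 and τr ≤ 1/2, so that 4τr + 2τr + τrM ≤ M, the invariance condition for
  -- the majorant.
  refine ⟨min (M / (12 * (τ + 1))) (1 / (2 * (τ + 1))), by positivity, fun x a hx hxa => ?_⟩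
  set r := min (M / (12 * (τ + 1))) (1 / (2 * (τ + 1))) with hr
  have hr1 : τ * r ≤ M / 12 := by
    calc τ * r ≤ τ * (M / (12 * (τ + 1))) := mul_le_mul_of_nonneg_left (min_le_left _ _) hτ
      _ ≤ M / 12 := by
        rw [← mul_div_assoc, div_le_div_iff₀ (by positivity) (by positivity)]
        nlinarith
  have hr2 : τ * r ≤ 1 / 2 := by
    calc τ * r ≤ τ * (1 / (2 * (τ + 1))) := mul_le_mul_of_nonneg_left (min_le_right _ _) hτ
      _ ≤ 1 / 2 := by
        rw [mul_one_div, div_le_div_iff₀ (by positivity) (by positivity)]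
        linarith
  have hr0 : 0 ≤ r := hxa.nonneg
  have h : IsGradedRel (fun c : 𝕜 => ‖c‖ ≤ 1) S.series.B₁ S.series.B₂ (S.series.δ x) S.B₁ S.B₂
      (S.δ a) τ (τ * r) (fun _ C u w => Near e₂ C u w) :=
    { zero := fun _ => near_zero e₂
      add := fun hu hx => hu.add hx
      smul := fun hc hu => by simpa using hu.smul_of_le hc
      br₁ := fun hu hx => hu.conv hτ h₁ hx
      br₂ := fun hu hx => hu.conv hτ h₂ hx
      der := fun hu => (hxa.conv hτ h₃ hu).mono (mul_assoc _ _ _).ge }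
  obtain ⟨U, hU⟩ := exists_isMajorant τ (τ * r) (τ * r) (τ * r)
  have key (k : ℕ) : Near e₂ (U k) (S.series.flow x k) (S.flow a k) :=
    h.flow norm_coeff_todd_le norm_coeff_toddNeg_le norm_coeff_expNegS_le norm_succ_inv_le
      (hxa.map hτ h₄) (hxa.map hτ h₅) hU (S.series.isFlow x) (S.isFlow a) k
  have hUM := hU.sum_le hτ (by positivity) (by positivity) (by positivity) hM0.le hτM
    (by nlinarith)
  have := near_seqSum (S.flow_order hx) hUM key
  rw [S.formal_line]
  exact ⟨this.1, fun s hs => (this.2 s hs).mono (min_le_left _ _)⟩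

end Evaluation

/-! ### Analyticity -/

section Multilinear

variable {𝕜 E F F' G : Type*} [RCLike 𝕜] [NormedAddCommGroup E] [NormedSpace 𝕜 E]
  [NormedAddCommGroup F] [NormedSpace 𝕜 F] [NormedAddCommGroup F'] [NormedSpace 𝕜 F']
  [NormedAddCommGroup G] [NormedSpace 𝕜 G]

/-- The product of multilinear maps for a bilinear map on the values. -/
def multilinearMul (B : F →ₗ[𝕜] F' →ₗ[𝕜] G) {k l : ℕ} (p : E [×k]→L[𝕜] F) (q : E [×l]→L[𝕜] F') :
    MultilinearMap 𝕜 (fun _ : Fin (k + l) => E) G where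
  toFun m := B (p (m ∘ Fin.castAdd l)) (q (m ∘ Fin.natAdd k))
  map_update_add' {inst} m i x y := by
    obtain rfl := Subsingleton.elim inst (instDecidableEqFin _)
    refine Fin.addCases (fun i => ?_) (fun i => ?_) i
    · have h (z : E) : Function.update m (Fin.castAdd l i) z ∘ Fin.natAdd k = m ∘ Fin.natAdd k :=
        Function.update_comp_eq_of_forall_ne _ _ fun j => by simp [Fin.ext_iff]; lia
      simp only [h, Function.update_comp_eq_of_injective _ (Fin.castAdd_injective k l),
        ContinuousMultilinearMap.map_update_add, map_add, LinearMap.add_apply]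
    · have h (z : E) : Function.update m (Fin.natAdd k i) z ∘ Fin.castAdd l = m ∘ Fin.castAdd l :=
        Function.update_comp_eq_of_forall_ne _ _ fun j => by simp [Fin.ext_iff]; lia
      simp only [h, Function.update_comp_eq_of_injective _ (Fin.natAdd_injective l k),
        ContinuousMultilinearMap.map_update_add, map_add]
  map_update_smul' {inst} m i c x := by
    obtain rfl := Subsingleton.elim inst (instDecidableEqFin _)
    refine Fin.addCases (fun i => ?_) (fun i => ?_) i
    · have h (z : E) : Function.update m (Fin.castAdd l i) z ∘ Fin.natAdd k = m ∘ Fin.natAdd k :=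
        Function.update_comp_eq_of_forall_ne _ _ fun j => by simp [Fin.ext_iff]; lia
      simp only [h, Function.update_comp_eq_of_injective _ (Fin.castAdd_injective k l),
        ContinuousMultilinearMap.map_update_smul, map_smul, LinearMap.smul_apply]
    · have h (z : E) : Function.update m (Fin.natAdd k i) z ∘ Fin.castAdd l = m ∘ Fin.castAdd l :=
        Function.update_comp_eq_of_forall_ne _ _ fun j => by simp [Fin.ext_iff]; lia
      simp only [h, Function.update_comp_eq_of_injective _ (Fin.natAdd_injective l k),
        ContinuousMultilinearMap.map_update_smul, map_smul]

theorem exists_multilinear_mul {B : F →ₗ[𝕜] F' →ₗ[𝕜] G} {τ : ℝ} (hτ : 0 ≤ τ)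
    (hB : ∀ a b, ‖B a b‖ ≤ τ * (‖a‖ * ‖b‖)) {k l : ℕ} (p : E [×k]→L[𝕜] F) (q : E [×l]→L[𝕜] F') :
    ∃ s : E [×(k + l)]→L[𝕜] G, ‖s‖ ≤ τ * (‖p‖ * ‖q‖) ∧
      ∀ x, s (fun _ => x) = B (p fun _ => x) (q fun _ => x) := by
  have H (m : Fin (k + l) → E) : ‖multilinearMul B p q m‖ ≤ τ * (‖p‖ * ‖q‖) * ∏ i, ‖m i‖ := by
    rw [Fin.prod_univ_add]
    refine (hB _ _).trans ?_
    have h1 := p.le_opNorm (m ∘ Fin.castAdd l)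
    have h2 := q.le_opNorm (m ∘ Fin.natAdd k)
    calc _ ≤ τ * ((‖p‖ * ∏ i, ‖m (Fin.castAdd l i)‖) * (‖q‖ * ∏ i, ‖m (Fin.natAdd k i)‖)) :=
          mul_le_mul_of_nonneg_left (mul_le_mul h1 h2 (norm_nonneg _) (by positivity)) hτ
      _ = _ := by ring
  exact ⟨(multilinearMul B p q).mkContinuous _ H,
    MultilinearMap.mkContinuous_norm_le _ (by positivity) H, fun x => rfl⟩

end Multilinear

/-! ### Homogeneous components and analyticity of flows -/

section Analytic

variable {𝕜 X V E F : Type*} [RCLike 𝕜] [AddCommGroup X] [Module 𝕜 X] [AddCommGroup V] [Module 𝕜 V]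
  [NormedAddCommGroup E] [NormedSpace 𝕜 E] [NormedAddCommGroup F] [NormedSpace 𝕜 F]

/-- A bilinear map, pointwise on functions. -/
def pointwise {𝕜 V : Type*} [Field 𝕜] [AddCommGroup V] [Module 𝕜 V] (E : Type*)
    (B : V →ₗ[𝕜] V →ₗ[𝕜] V) : (E → V) →ₗ[𝕜] (E → V) →ₗ[𝕜] (E → V) :=
  LinearMap.mk₂ 𝕜 (fun f g x => B (f x) (g x)) (fun f f' g => by funext x; simp)
    (fun c f g => by funext x; simp) (fun f g g' => by funext x; simp)
    (fun c f g => by funext x; simp)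

/-- `f` is homogeneous of degree `k`, given by a multilinear map of norm at most `C`. -/
def IsHomogeneous (e₂ : V ≃ₗ[𝕜] F) (k : ℕ) (C : ℝ) (f : E → V) : Prop :=
  ∃ p : E [×k]→L[𝕜] F, ‖p‖ ≤ C ∧ ∀ x, p (fun _ => x) = e₂ (f x)

theorem IsHomogeneous.mul {V₁ V₂ V₃ F₁ F₂ F₃ : Type*} [AddCommGroup V₁] [Module 𝕜 V₁]
    [AddCommGroup V₂] [Module 𝕜 V₂] [AddCommGroup V₃] [Module 𝕜 V₃]
    [NormedAddCommGroup F₁] [NormedSpace 𝕜 F₁] [NormedAddCommGroup F₂] [NormedSpace 𝕜 F₂]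
    [NormedAddCommGroup F₃] [NormedSpace 𝕜 F₃]
    {e₁ : V₁ ≃ₗ[𝕜] F₁} {e₂ : V₂ ≃ₗ[𝕜] F₂} {e₃ : V₃ ≃ₗ[𝕜] F₃} {B : V₁ →ₗ[𝕜] V₂ →ₗ[𝕜] V₃} {τ : ℝ}
    (hτ : 0 ≤ τ) (hB : ∀ x y, ‖e₃ (B x y)‖ ≤ τ * (‖e₁ x‖ * ‖e₂ y‖)) {k l : ℕ} {C D : ℝ}
    {f : E → V₁} {f' : E → V₂} (h : IsHomogeneous e₁ k C f) (h' : IsHomogeneous e₂ l D f') :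
    IsHomogeneous e₃ (k + l) (τ * (C * D)) fun x => B (f x) (f' x) := by
  obtain ⟨p, hp, hpf⟩ := h
  obtain ⟨q, hq, hqf⟩ := h'
  obtain ⟨s, hs, hsf⟩ := exists_multilinear_mul
    (B := (B.compl₁₂ e₁.symm.toLinearMap e₂.symm.toLinearMap).compr₂ e₃.toLinearMap) hτ
    (fun a b => by simpa using hB (e₁.symm a) (e₂.symm b)) p q
  refine ⟨s, hs.trans (mul_le_mul_of_nonneg_left (mul_le_mul hp hq (norm_nonneg _)
    ((norm_nonneg _).trans hp)) hτ), fun x => ?_⟩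
  rw [hsf, hpf, hqf]
  simp

theorem isHomogeneous_linear [FiniteDimensional 𝕜 E] {e₁ : X ≃ₗ[𝕜] E} {e₂ : V ≃ₗ[𝕜] F} {L : X →ₗ[𝕜] V} {τ : ℝ} (hτ : 0 ≤ τ)
    (hL : ∀ x, ‖e₂ (L x)‖ ≤ τ * ‖e₁ x‖) : IsHomogeneous e₂ 1 τ fun x => L (e₁.symm x) := by
  let T : E →L[𝕜] F :=
    LinearMap.toContinuousLinearMap (e₂.toLinearMap ∘ₗ L ∘ₗ e₁.symm.toLinearMap)
  refine ⟨ContinuousMultilinearMap.ofSubsingleton 𝕜 E F (0 : Fin 1) T, ?_, fun x => rfl⟩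
  rw [ContinuousMultilinearMap.norm_ofSubsingleton]
  refine T.opNorm_le_bound hτ fun x => ?_
  have := hL (e₁.symm x)
  rwa [e₁.apply_symm_apply] at this

variable [FiniteDimensional 𝕜 E] [FiniteDimensional 𝕜 F]

/-- The equation is solved once with functions of the parameter as values. One relation identifies
its values with the flow at each point; another shows that coefficient k is homogeneous of degree k,
given by a multilinear map of norm at most U_k ρ^k. -/
theorem MagnusData.exists_power_series (S : MagnusData 𝕜 X V) (e₁ : X ≃ₗ[𝕜] E) (e₂ : V ≃ₗ[𝕜] F) :
    ∃ p : FormalMultilinearSeries 𝕜 E F, 0 < p.radius ∧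
      ∀ n x, p n (fun _ => x) = e₂ (S.flow (e₁.symm x) n) := by
  obtain ⟨τ, hτ, h₁, h₂, h₃, h₄, h₅⟩ := S.exists_bound e₁ e₂
  -- The data have norm τ = rρ. Charging a factor ρ to each degree leaves the small r ≤ M/12 for the
  -- majorant, and the radius of convergence is at least 1/ρ.
  set ρ : ℝ := 24 * (τ + 1) ^ 2 with hρ
  have hρ0 : 0 < ρ := by positivity
  set r := τ / ρ with hr
  have hrρ : r * ρ = τ := div_mul_cancel₀ _ hρ0.ne'
  have hr0 : 0 ≤ r := by positivity
  set M : ℝ := 1 / (2 * (τ + 1)) with hM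
  have hM0 : 0 < M := by positivity
  have hτM : τ * M ≤ 1 / 2 := by
    rw [hM, mul_one_div, div_le_div_iff₀ (by positivity) (by positivity)]
    linarith
  have hrM : r ≤ M / 12 := by
    rw [hr, hM, hρ, div_div, div_le_div_iff₀ (by positivity) (by positivity)]
    nlinarith
  have hM1 : M ≤ 1 / 2 := by
    rw [hM, div_le_div_iff₀ (by positivity) (by positivity)]
    linarith
  let δ' : (E → V) →ₗ[𝕜] (E → V) :=
    { toFun := fun f x => S.δ (e₁.symm x) (f x)
      map_add' := fun f g => by funext x; simp
      map_smul' := fun c f => by funext x; simp }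
  let v : E → V := fun x => S.v (e₁.symm x)
  let v' : E → V := fun x => S.v' (e₁.symm x)
  obtain ⟨Ω, hΩ⟩ := exists_isFlow (pointwise E S.B₁) (pointwise E S.B₂) δ' v v'
  obtain ⟨U, hU⟩ := exists_isMajorant τ r r r
  have hflow (k : ℕ) (x : E) : Ω k x = S.flow (e₁.symm x) k := by
    have h : IsGradedRel (fun _ : 𝕜 => True) (pointwise E S.B₁) (pointwise E S.B₂) δ' S.B₁ S.B₂
        (S.δ (e₁.symm x)) τ r (fun _ _ f w => f x = w) :=
      { zero := fun _ => rfl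
        add := fun hu hx => by rw [Pi.add_apply, hu, hx]
        smul := fun _ hu => by rw [Pi.smul_apply, hu]
        br₁ := fun hu hx => by
          rw [← hu, ← hx]
          rfl
        br₂ := fun hu hx => by
          rw [← hu, ← hx]
          rfl
        der := fun hu => by
          rw [← hu]
          rfl }
    exact h.flow (fun _ => trivial) (fun _ => trivial) (fun _ => trivial) (fun _ => trivial)
      (v := v) (v' := v') rfl rfl hU hΩ (S.isFlow _) k
  have hhom : IsGradedRel (fun c : 𝕜 => ‖c‖ ≤ 1) (pointwise E S.B₁) (pointwise E S.B₂) δ'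
      (pointwise E S.B₁) (pointwise E S.B₂) δ' τ r
      (fun k C f _ => IsHomogeneous e₂ k (C * ρ ^ k) f) :=
    { zero := fun k => ⟨0, by simp, by simp⟩
      add := fun {_ _ _ _ _ _ _} hf hg => by
        obtain ⟨p, hp, hpf⟩ := hf
        obtain ⟨q, hq, hqf⟩ := hg
        refine ⟨p + q, ?_, fun x => by simp [hpf, hqf]⟩
        rw [add_mul]
        exact (norm_add_le _ _).trans (add_le_add hp hq)
      smul := fun {c _ _ _ _} hc hf => by
        obtain ⟨p, hp, hpf⟩ := hf
        refine ⟨c • p, ?_, fun x => by simp [hpf]⟩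
        rw [norm_smul]
        exact (mul_le_of_le_one_left (norm_nonneg _) hc).trans hp
      br₁ := fun {k l C D _ _ _ _} hf hg => by
        have := hf.mul hτ h₁ hg
        rw [show τ * (C * D) * ρ ^ (k + l) = τ * (C * ρ ^ k * (D * ρ ^ l)) by ring]
        exact this
      br₂ := fun {k l C D _ _ _ _} hf hg => by
        have := hf.mul hτ h₂ hg
        rw [show τ * (C * D) * ρ ^ (k + l) = τ * (C * ρ ^ k * (D * ρ ^ l)) by ring]
        exact this
      der := fun {k C _ _} hf => by
        have hid : IsHomogeneous e₁ 1 1 fun x : E => e₁.symm x :=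
          isHomogeneous_linear (L := LinearMap.id) zero_le_one fun x => by simp
        have := hf.mul (B := S.δ.flip) hτ (fun y x => by
          rw [mul_comm ‖e₂ y‖]
          exact h₃ x y) hid
        rw [show r * C * ρ ^ (k + 1) = τ * (C * ρ ^ k * 1) by rw [← hrρ]; ring]
        exact this }
  have hv : IsHomogeneous e₂ 1 (r * ρ ^ 1) v := by
    rw [pow_one, hrρ]
    exact isHomogeneous_linear hτ h₄
  have hv' : IsHomogeneous e₂ 1 (r * ρ ^ 1) v' := by
    rw [pow_one, hrρ]
    exact isHomogeneous_linear hτ h₅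
  have key (k : ℕ) : IsHomogeneous e₂ k (U k * ρ ^ k) (Ω k) :=
    hhom.flow norm_coeff_todd_le norm_coeff_toddNeg_le norm_coeff_expNegS_le norm_succ_inv_le
      (v := v) (v' := v') (w := v) (w' := v') hv hv' hU hΩ hΩ k
  choose p hp hpΩ using key
  have hUM := hU.sum_le hτ hr0 hr0 hr0 hM0.le hτM (by nlinarith)
  refine ⟨p, ?_, fun n x => by rw [hpΩ, hflow]⟩
  have hrad := FormalMultilinearSeries.le_radius_of_bound p M (r := (1 / ρ).toNNReal)
    fun n => by
      rw [Real.coe_toNNReal _ (by positivity)]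
      have hUn : U n ≤ M := (single_le_sum (f := U)
        (fun i _ => hU.nonneg hτ hr0 hr0 hr0 i) (self_mem_range_succ n)).trans (hUM (n + 1))
      calc ‖p n‖ * (1 / ρ) ^ n ≤ U n * ρ ^ n * (1 / ρ) ^ n :=
            mul_le_mul_of_nonneg_right (hp n) (by positivity)
        _ = U n := by
            rw [mul_assoc, ← mul_pow, mul_one_div_cancel hρ0.ne', one_pow, mul_one]
        _ ≤ M := hUn
  refine lt_of_lt_of_le ?_ hrad
  rw [ENNReal.coe_pos, Real.toNNReal_pos]
  exact one_div_pos.2 hρ0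

theorem MagnusData.analyticAt (S : MagnusData 𝕜 X V) (e₁ : X ≃ₗ[𝕜] E) (e₂ : V ≃ₗ[𝕜] F) :
    AnalyticAt 𝕜 (fun x => ∑' n, e₂ (S.flow (e₁.symm x) n)) 0 := by
  have := FiniteDimensional.complete 𝕜 F
  obtain ⟨p, hp, hpS⟩ := S.exists_power_series e₁ e₂
  have h := (p.hasFPowerSeriesOnBall hp).analyticAt
  have hs : p.sum = fun x => ∑' n, e₂ (S.flow (e₁.symm x) n) := by
    funext x
    simp only [FormalMultilinearSeries.sum, hpS]
  rwa [hs] at h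

theorem MagnusData.analyticNearZero [FiniteDimensional 𝕜 V] [TopologicalSpace V]
    [IsTopologicalAddGroup V] [ContinuousSMul 𝕜 V] [T2Space V] (S : MagnusData 𝕜 X V) :
    AnalyticNearZero 𝕜 fun x => ∑' n, S.flow x n := fun m n e₁ e₂ => by
  have h := S.analyticAt e₁ e₂
  have hs (x : X) : ∑' n, e₂ (S.flow x n) = e₂ (∑' n, S.flow x n) :=
    (e₂.toContinuousLinearEquiv.map_tsum (f := S.flow x)).symm
  simpa only [hs] using h

end Analytic

/-! ### The equations of the series of a crossed morphism -/

section Data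

variable {K g h : Type*} [Field K] [LieRing g] [LieAlgebra K g] [LieRing h] [LieAlgebra K h]
  {υ : g →ₗ⁅K⁆ LieDerivation K h h}

/-- The equation of the Baker-Campbell-Hausdorff series. -/
def bchData (K g : Type*) [Field K] [LieRing g] [LieAlgebra K g] : MagnusData K (g × g) g where
  B₁ := (envRep K g).br
  B₂ := 0
  δ := 0
  -- In e^x e^y the second argument multiplies from the right, hence enters through v, and the first
  -- one from the left, through v'.
  v := LinearMap.snd K g g
  v' := LinearMap.fst K g g

/-- The equation of the integrated crossed morphism. -/
def phiData (φ : CrossedMorphism υ) : MagnusData K g h where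
  B₁ := (envRep K h).br
  B₂ := 0
  δ := actLin υ
  v := 0
  v' := φ.toLinearMap

/-- The equation of the post-Lie Magnus expansion. -/
def chiData {φ : CrossedMorphism υ} (hφ : Function.Bijective φ.toLinearMap) :
    MagnusData K h g where
  B₁ := (envRep K g).br
  B₂ := actInv hφ
  δ := 0
  v := invLin hφ
  v' := 0

theorem conv_zero {V W X : Type*} [AddCommGroup V] [Module K V] [AddCommGroup W] [Module K W]
    [AddCommGroup X] [Module K X] : conv (0 : V →ₗ[K] W →ₗ[K] X) = 0 := by
  refine LinearMap.ext fun u => LinearMap.ext fun w => funext fun n => ?_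
  simp [conv_apply]

variable [CharZero K]

theorem formal_bchData [FiniteDimensional K g] {x : ℕ → g × g} (hx : x 0 = 0) :
    (bchData K g).formal x = BCH K (fun n => (x n).1) fun n => (x n).2 := by
  have h := (bchData K g).series.isFlow x
  have h2 : (bchData K g).series.B₂ = 0 := conv_zero
  have h3 : (bchData K g).series.δ x = 0 :=
    (congrArg (fun f => f x) (conv_zero (K := K) (V := g × g) (W := g) (X := g)))
  rw [h2, h3] at h
  exact (BCH_eq_seqSum (congrArg Prod.fst hx) (congrArg Prod.snd hx) h).symm

theorem formal_phiData [FiniteDimensional K h] (φ : CrossedMorphism υ) {x : ℕ → g} (hx : x 0 = 0) :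
    (phiData φ).formal x = Phi φ x := by
  have h := (phiData φ).series.isFlow x
  have h2 : (phiData φ).series.B₂ = 0 := conv_zero
  have h3 : (phiData φ).series.v x = 0 := rfl
  rw [h2, h3] at h
  exact (Phi_eq_seqSum φ hx h).symm

theorem formal_chiData [FiniteDimensional K g] [FiniteDimensional K h] {φ : CrossedMorphism υ}
    (hφ : Function.Bijective φ.toLinearMap) {a : ℕ → h} (ha : a 0 = 0) :
    (chiData hφ).formal a = chi φ a := by
  have H := (chiData hφ).series.isFlow a
  have h2 : (chiData hφ).series.v' a = 0 := rfl
  have h3 : (chiData hφ).series.δ a = 0 :=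
    (congrArg (fun f => f a) (conv_zero (K := K) (V := h) (W := g) (X := g)))
  rw [h2, h3] at H
  exact (chi_eq_seqSum hφ ha H).symm

theorem line_zero {V : Type*} [Zero V] (a : V) : line a 0 = 0 := by
  rw [line, Pi.single_apply, if_neg Nat.zero_ne_one]

theorem line_fst {V W : Type*} [Zero V] [Zero W] (a : V × W) :
    (fun n => (line a n).1) = line a.1 := by
  funext n
  rw [line, line, Pi.single_apply, Pi.single_apply]
  split_ifs <;> rfl

theorem line_snd {V W : Type*} [Zero V] [Zero W] (a : V × W) :
    (fun n => (line a n).2) = line a.2 := by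
  funext n
  rw [line, line, Pi.single_apply, Pi.single_apply]
  split_ifs <;> rfl

theorem phiTerm_eq_flow [FiniteDimensional K h] (φ : CrossedMorphism υ) (x : g) :
    phiTerm φ x = (phiData φ).flow x := by
  rw [← (phiData φ).formal_line, formal_phiData φ (line_zero x)]
  rfl

theorem chiTerm_eq_flow [FiniteDimensional K g] [FiniteDimensional K h] {φ : CrossedMorphism υ}
    (hφ : Function.Bijective φ.toLinearMap) (a : h) : chiTerm φ a = (chiData hφ).flow a := by
  rw [← (chiData hφ).formal_line, formal_chiData hφ (line_zero a)]
  rfl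

end Data

/-! ### Evaluation at convergent series -/

section Evaluate

variable {𝕜 X V F₁ F₂ F₃ : Type*} [RCLike 𝕜] [AddCommGroup X] [Module 𝕜 X] [AddCommGroup V]
  [Module 𝕜 V] [NormedAddCommGroup F₁] [NormedSpace 𝕜 F₁]
  [NormedAddCommGroup F₂] [NormedSpace 𝕜 F₂]
  {e₁ : X ≃ₗ[𝕜] F₁} {e₂ : V ≃ₗ[𝕜] F₂}

theorem Near.unique {C D : ℝ} {u : ℕ → X} {w w' : X} (h : Near e₁ C u w) (h' : Near e₁ D u w') :
    w = w' := e₁.injective (h.hasSum.unique h'.hasSum)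

theorem near_line (e : X ≃ₗ[𝕜] F₁) (a : X) : Near e ‖e a‖ (line a) a := near_single e 1 a

theorem Near.prodMk {C D : ℝ} {u : ℕ → X} {u' : ℕ → V} {w : X} {w' : V} (h : Near e₁ C u w)
    (h' : Near e₂ D u' w') : Near (e₁.prodCongr e₂) (C + D) (fun n => (u n, u' n)) (w, w') := by
  refine ⟨fun N => ?_, h.hasSum.prodMk h'.hasSum⟩
  calc _ ≤ ∑ i ∈ range N, (‖e₁ (u i)‖ + ‖e₂ (u' i)‖) := sum_le_sum fun i _ =>
        max_le_add_of_nonneg (norm_nonneg _) (norm_nonneg _)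
    _ ≤ C + D := by
        rw [sum_add_distrib]
        exact add_le_add (h.sum_le N) (h'.sum_le N)

theorem Evaluable.congr {P Q : (ℕ → X) → ℕ → V} (h : Evaluable e₁ e₂ P)
    (hPQ : ∀ x, x 0 = 0 → P x = Q x) : Evaluable e₁ e₂ Q := fun ε hε => by
  obtain ⟨r, hr, H⟩ := h ε hε
  refine ⟨r, hr, fun x a hx hxa => ?_⟩
  rw [← hPQ x hx, ← hPQ _ (line_zero a)]
  exact H x a hx hxa

variable [FiniteDimensional 𝕜 V]
  [TopologicalSpace V] [IsTopologicalAddGroup V] [ContinuousSMul 𝕜 V] [T2Space V]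

theorem hasSum_coordinates (e : V ≃ₗ[𝕜] F₂) {u : ℕ → V} {s : V} :
    HasSum (fun n => e (u n)) (e s) ↔ HasSum u s :=
  e.toContinuousLinearEquiv.hasSum'

theorem summable_coordinates (e : V ≃ₗ[𝕜] F₂) {u : ℕ → V} (h : Summable fun n => e (u n)) :
    HasSum (fun n => e (u n)) (e (∑' n, u n)) ∧ Summable u := by
  obtain ⟨s, hs⟩ := h
  obtain ⟨s, rfl⟩ := e.surjective s
  have hs' := (hasSum_coordinates e).1 hs
  rw [hs'.tsum_eq]
  exact ⟨hs, hs'.summable⟩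

theorem Evaluable.eval {P : (ℕ → X) → ℕ → V} (h : Evaluable e₁ e₂ P) {ε : ℝ} (hε : 0 < ε) :
    ∃ r > 0, ∀ (x : ℕ → X) (a : X), x 0 = 0 → Near e₁ r x a →
      Summable (P (line a)) ∧ Near e₂ ε (P x) (∑' n, P (line a) n) := by
  obtain ⟨r, hr, H⟩ := h ε hε
  refine ⟨r, hr, fun x a hx hxa => ?_⟩
  obtain ⟨h1, h2⟩ := H x a hx hxa
  have h3 := summable_coordinates e₂ h1
  exact ⟨h3.2, h2 _ h3.1⟩

end Evaluate

/-! ### Evaluation of χ, Φ, BCH and Exp(υ) -/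

section EvaluateSeries

variable {𝕜 g h F F' : Type*} [RCLike 𝕜]
  [LieRing g] [LieAlgebra 𝕜 g]
  [LieRing h] [LieAlgebra 𝕜 h] [FiniteDimensional 𝕜 h]
  [NormedAddCommGroup F] [NormedSpace 𝕜 F] [FiniteDimensional 𝕜 F]
  [NormedAddCommGroup F'] [NormedSpace 𝕜 F'] [FiniteDimensional 𝕜 F']
  (e : g ≃ₗ[𝕜] F) (e' : h ≃ₗ[𝕜] F')
  {υ : g →ₗ⁅𝕜⁆ LieDerivation 𝕜 h h} {φ : CrossedMorphism υ}

theorem eval_chi [FiniteDimensional 𝕜 g]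
    [TopologicalSpace g] [IsTopologicalAddGroup g] [ContinuousSMul 𝕜 g] [T2Space g]
    (hφ : Function.Bijective φ.toLinearMap) {ε : ℝ} (hε : 0 < ε) :
    ∃ r > 0, ∀ (x : ℕ → h) (a : h), x 0 = 0 → Near e' r x a →
      Summable (chiTerm φ a) ∧ Near e ε (chi φ x) (chiSum φ a) :=
  (((chiData hφ).evaluable e' e).congr fun _ hx => formal_chiData hφ hx).eval hε

theorem eval_Phi [TopologicalSpace h] [IsTopologicalAddGroup h] [ContinuousSMul 𝕜 h] [T2Space h]
    (φ : CrossedMorphism υ) {ε : ℝ} (hε : 0 < ε) :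
    ∃ r > 0, ∀ (x : ℕ → g) (a : g), x 0 = 0 → Near e r x a →
      Summable (phiTerm φ a) ∧ Near e' ε (Phi φ x) (phiSum φ a) :=
  (((phiData φ).evaluable e e').congr fun _ hx => formal_phiData φ hx).eval hε

theorem eval_BCH [FiniteDimensional 𝕜 g]
    [TopologicalSpace g] [IsTopologicalAddGroup g] [ContinuousSMul 𝕜 g] [T2Space g]
    {ε : ℝ} (hε : 0 < ε) :
    ∃ r > 0, ∀ (x y : ℕ → g) (a b : g), x 0 = 0 → y 0 = 0 → Near e r x a → Near e r y b →
      Summable (bchTerm 𝕜 a b) ∧ Near e ε (BCH 𝕜 x y) (bchSum 𝕜 a b) := by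
  obtain ⟨r, hr, H⟩ := (((bchData 𝕜 g).evaluable (e.prodCongr e) e).congr
    fun _ hx => formal_bchData hx).eval hε
  refine ⟨r / 2, half_pos hr, fun x y a b hx hy hxa hyb => ?_⟩
  have h1 := hxa.prodMk hyb
  rw [add_halves] at h1
  have h2 := H (fun n => (x n, y n)) (a, b) (Prod.ext hx hy) h1
  rw [line_fst, line_snd] at h2
  exact h2

/-- No differential equation is needed: term k is bounded by 2^{-k} r because τr ≤ 1/2, and the sum
2r is at most ε. -/
theorem eval_ExpAct [TopologicalSpace h] [IsTopologicalAddGroup h] [ContinuousSMul 𝕜 h] [T2Space h]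
    (υ : g →ₗ⁅𝕜⁆ LieDerivation 𝕜 h h) {ε : ℝ} (hε : 0 < ε) :
    ∃ r > 0, ∀ (x : ℕ → g) (b : ℕ → h) (a : g) (c : h), x 0 = 0 → Near e r x a → Near e' r b c →
      Summable (expTerm υ a c) ∧ Near e' ε (ExpAct υ x b) (expSum υ a c) := by
  obtain ⟨τ, hτ, hB⟩ := exists_bilin_bound e e' e' (actLin υ)
  refine ⟨min (ε / 2) (1 / (2 * (τ + 1))), by positivity, fun x b a c hx hxa hbc => ?_⟩
  set r := min (ε / 2) (1 / (2 * (τ + 1))) with hr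
  have hr0 : 0 ≤ r := hxa.nonneg
  have hτr : τ * r ≤ 1 / 2 := by
    calc τ * r ≤ τ * (1 / (2 * (τ + 1))) := mul_le_mul_of_nonneg_left (min_le_right _ _) hτ
      _ ≤ 1 / 2 := by
        rw [mul_one_div, div_le_div_iff₀ (by positivity) (by positivity)]
        linarith
  have hpow (k : ℕ) : Near e' ((1 / 2) ^ k * r)
      (((conv (actLin υ) x : Module.End 𝕜 (ℕ → h)) ^ k) b) ((fun c => υ a c)^[k] c) := by
    induction k with
    | zero => simpa using hbc
    | succ k ih =>
      rw [pow_succ' (conv (actLin υ) x : Module.End 𝕜 (ℕ → h)), Module.End.mul_apply, Function.iterate_succ_apply']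
      refine (hxa.conv hτ hB ih).mono ?_
      rw [pow_succ', ← mul_assoc, mul_assoc (1 / 2)]
      exact mul_le_mul_of_nonneg_right hτr (by positivity)
  have hterm (k : ℕ) : Near e' ((1 / 2) ^ k * r) ((k.factorial : 𝕜)⁻¹ •
      ((conv (actLin υ) x : Module.End 𝕜 (ℕ → h)) ^ k) b) (expTerm υ a c k) := by
    have := (hpow k).smul_of_le (c := (k.factorial : 𝕜)⁻¹) (r := 1)
      (by rw [norm_factorial_inv]; exact factorial_inv_le_one k)
    rwa [one_mul] at this
  have hord (k n : ℕ) (hn : n < k) : ((k.factorial : 𝕜)⁻¹ •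
      ((conv (actLin υ) x : Module.End 𝕜 (ℕ → h)) ^ k) b) n = 0 := by
    have : ∀ n < k, ((conv (actLin υ) x : Module.End 𝕜 (ℕ → h)) ^ k) b n = 0 := by
      clear hn n
      induction k with
      | zero => intro n hn; exact absurd hn n.not_lt_zero
      | succ k ih =>
        intro n hn
        rw [pow_succ', Module.End.mul_apply]
        exact conv_order (actLin υ) x _ 1 k (fun m hm => by rwa [Nat.lt_one_iff.1 hm]) ih n
          (by lia)
    rw [Pi.smul_apply, this n hn, smul_zero]
  have hsum (N : ℕ) : ∑ k ∈ range N, (1 / 2 : ℝ) ^ k * r ≤ ε := by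
    rw [← sum_mul]
    have h1 : ∑ k ∈ range N, (1 / 2 : ℝ) ^ k ≤ 2 := by
      exact (summable_geometric_two.sum_le_tsum _ fun _ _ => by positivity).trans_eq
        tsum_geometric_two
    calc _ ≤ 2 * r := mul_le_mul_of_nonneg_right h1 hr0
      _ ≤ 2 * (ε / 2) := mul_le_mul_of_nonneg_left (min_le_left _ _) zero_le_two
      _ = ε := by ring
  have h1 := near_seqSum hord hsum hterm
  have h2 := summable_coordinates e' h1.1
  refine ⟨h2.2, ?_⟩
  have h3 : ExpAct υ x b = seqSum fun k => (k.factorial : 𝕜)⁻¹ •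
      ((conv (actLin υ) x : Module.End 𝕜 (ℕ → h)) ^ k) b := by
    rw [ExpAct_eq]
    funext n
    simp only [opSeries, seqSum, expS, PowerSeries.coeff_mk, Pi.smul_apply]
  rw [h3]
  exact h1.2 _ h2.1

theorem analyticNearZero_chiSum [FiniteDimensional 𝕜 g] [TopologicalSpace g]
    [IsTopologicalAddGroup g] [ContinuousSMul 𝕜 g] [T2Space g] (hφ : Function.Bijective φ.toLinearMap) :
    AnalyticNearZero 𝕜 (chiSum φ) := by
  have h := (chiData hφ).analyticNearZero
  simp only [← chiTerm_eq_flow] at h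
  exact h

theorem analyticNearZero_phiSum [TopologicalSpace h] [IsTopologicalAddGroup h] [ContinuousSMul 𝕜 h]
    [T2Space h] (φ : CrossedMorphism υ) : AnalyticNearZero 𝕜 (phiSum φ) := by
  have h := (phiData φ).analyticNearZero
  simp only [← phiTerm_eq_flow] at h
  exact h

end EvaluateSeries

/-! ### The local identities -/

section LocalIdentities

variable {𝕜 g h : Type*} [RCLike 𝕜]
  [LieRing g] [LieAlgebra 𝕜 g] [FiniteDimensional 𝕜 g]
  [TopologicalSpace g] [IsTopologicalAddGroup g] [ContinuousSMul 𝕜 g] [T2Space g]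
  [LieRing h] [LieAlgebra 𝕜 h] [FiniteDimensional 𝕜 h]
  [TopologicalSpace h] [IsTopologicalAddGroup h] [ContinuousSMul 𝕜 h] [T2Space h]
  {υ : g →ₗ⁅𝕜⁆ LieDerivation 𝕜 h h} {φ : CrossedMorphism υ}

/-- Coordinates of a finite-dimensional space. -/
def coordinates (𝕜 V : Type*) [RCLike 𝕜] [AddCommGroup V] [Module 𝕜 V] [FiniteDimensional 𝕜 V] :
    V ≃ₗ[𝕜] (Fin (Module.finrank 𝕜 V) → 𝕜) := (Module.finBasis 𝕜 V).equivFun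

theorem eventually_near_line {V : Type*} [AddCommGroup V] [Module 𝕜 V] [FiniteDimensional 𝕜 V]
    [TopologicalSpace V] [IsTopologicalAddGroup V] [ContinuousSMul 𝕜 V] [T2Space V] {r : ℝ}
    (hr : 0 < r) : ∀ᶠ a : V in nhds 0, Near (coordinates 𝕜 V) r (line a) a := by
  have h1 : Continuous fun a : V => ‖coordinates 𝕜 V a‖ :=
    (coordinates 𝕜 V).toContinuousLinearEquiv.continuous.norm
  have h2 : ∀ᶠ a : V in nhds 0, ‖coordinates 𝕜 V a‖ < r := by
    refine h1.continuousAt.eventually_lt continuousAt_const ?_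
    simpa using hr
  exact h2.mono fun a ha => (near_line _ a).mono ha.le

theorem eventually_near_line_prod {V : Type*} [AddCommGroup V] [Module 𝕜 V] [FiniteDimensional 𝕜 V]
    [TopologicalSpace V] [IsTopologicalAddGroup V] [ContinuousSMul 𝕜 V] [T2Space V] {r : ℝ}
    (hr : 0 < r) : ∀ᶠ p : V × V in nhds 0, Near (coordinates 𝕜 V) r (line p.1) p.1 ∧
      Near (coordinates 𝕜 V) r (line p.2) p.2 := by
  have h := eventually_near_line (𝕜 := 𝕜) (V := V) hr
  exact (continuous_fst.tendsto (0 : V × V)).eventually h |>.and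
    ((continuous_snd.tendsto (0 : V × V)).eventually h)

/-- The formal identity at ta, tb says that both sides are sums of the same series, and sums are
unique. -/
theorem eventually_bchSum_chiSum (hφ : Function.Bijective φ.toLinearMap) :
    ∀ᶠ p : h × h in nhds 0,
      Summable (chiTerm φ p.1) ∧ Summable (chiTerm φ p.2) ∧
      Summable (bchTerm 𝕜 (chiSum φ p.1) (chiSum φ p.2)) ∧
      Summable (expTerm υ (chiSum φ p.1) p.2) ∧
      Summable (bchTerm 𝕜 p.1 (expSum υ (chiSum φ p.1) p.2)) ∧
      Summable (chiTerm φ (bchSum 𝕜 p.1 (expSum υ (chiSum φ p.1) p.2))) ∧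
      bchSum 𝕜 (chiSum φ p.1) (chiSum φ p.2) =
        chiSum φ (bchSum 𝕜 p.1 (expSum υ (chiSum φ p.1) p.2)) := by
  -- The radii are chosen from the outermost operation inwards, each result having to lie in the
  -- domain of the next; for the outermost ones any bound, here 1, will do.
  obtain ⟨r₅, h₅, H₅⟩ := eval_chi (coordinates 𝕜 g) (coordinates 𝕜 h) hφ one_pos
  obtain ⟨r₄, h₄, H₄⟩ := eval_BCH (coordinates 𝕜 h) h₅
  obtain ⟨r₃, h₃, H₃⟩ := eval_ExpAct (coordinates 𝕜 g) (coordinates 𝕜 h) υ h₄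
  obtain ⟨r₂, h₂, H₂⟩ := eval_BCH (coordinates 𝕜 g) one_pos
  obtain ⟨r₁, h₁, H₁⟩ := eval_chi (coordinates 𝕜 g) (coordinates 𝕜 h) hφ (lt_min h₂ h₃)
  filter_upwards [eventually_near_line_prod (𝕜 := 𝕜) (lt_min h₁ (lt_min h₃ h₄))]
  rintro ⟨a, b⟩ ⟨ha, hb⟩
  dsimp only at ha hb ⊢
  have a0 := line_zero a
  have b0 := line_zero b
  have c0 := (chi_spec hφ a0).1
  have d0 := (chi_spec hφ b0).1
  have e0 : ExpAct υ (chi φ (line a)) (line b) 0 = 0 := ExpAct_zero b0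
  have f0 := (BCH_spec (K := 𝕜) a0 e0).1
  obtain ⟨s₁, n₁⟩ := H₁ _ _ a0 (ha.mono (min_le_left _ _))
  obtain ⟨s₁', n₁'⟩ := H₁ _ _ b0 (hb.mono (min_le_left _ _))
  obtain ⟨s₂, n₂⟩ := H₂ _ _ _ _ c0 d0 (n₁.mono (min_le_left _ _)) (n₁'.mono (min_le_left _ _))
  obtain ⟨s₃, n₃⟩ := H₃ _ _ _ _ c0 (n₁.mono (min_le_right _ _))
    (hb.mono ((min_le_right _ _).trans (min_le_left _ _)))
  obtain ⟨s₄, n₄⟩ := H₄ _ _ _ _ a0 e0 (ha.mono ((min_le_right _ _).trans (min_le_right _ _))) n₃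
  obtain ⟨s₅, n₅⟩ := H₅ _ _ f0 n₄
  rw [BCH_chi hφ a0 b0] at n₂
  exact ⟨s₁, s₁', s₂, s₃, s₄, s₅, n₂.unique n₅⟩

theorem eventually_phiSum_chiSum (hφ : Function.Bijective φ.toLinearMap) :
    ∀ᶠ a : h in nhds 0, Summable (phiTerm φ (chiSum φ a)) ∧ phiSum φ (chiSum φ a) = a := by
  obtain ⟨r₂, h₂, H₂⟩ := eval_Phi (coordinates 𝕜 g) (coordinates 𝕜 h) φ one_pos
  obtain ⟨r₁, h₁, H₁⟩ := eval_chi (coordinates 𝕜 g) (coordinates 𝕜 h) hφ h₂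
  filter_upwards [eventually_near_line (𝕜 := 𝕜) h₁] with a ha
  have a0 := line_zero a
  obtain ⟨-, n₁⟩ := H₁ _ _ a0 ha
  obtain ⟨s₂, n₂⟩ := H₂ _ _ (chi_spec hφ a0).1 n₁
  rw [Phi_chi hφ a0] at n₂
  exact ⟨s₂, n₂.unique ha⟩

theorem eventually_chiSum_phiSum (hφ : Function.Bijective φ.toLinearMap) :
    ∀ᶠ x : g in nhds 0, Summable (chiTerm φ (phiSum φ x)) ∧ chiSum φ (phiSum φ x) = x := by
  obtain ⟨r₂, h₂, H₂⟩ := eval_chi (coordinates 𝕜 g) (coordinates 𝕜 h) hφ one_pos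
  obtain ⟨r₁, h₁, H₁⟩ := eval_Phi (coordinates 𝕜 g) (coordinates 𝕜 h) φ h₂
  filter_upwards [eventually_near_line (𝕜 := 𝕜) h₁] with x hx
  have x0 := line_zero x
  obtain ⟨-, n₁⟩ := H₁ _ _ x0 hx
  obtain ⟨s₂, n₂⟩ := H₂ _ _ (Phi_spec φ x0).1 n₁
  rw [chi_Phi hφ x0] at n₂
  exact ⟨s₂, n₂.unique hx⟩

theorem eventually_phiSum_bchSum (φ : CrossedMorphism υ) :
    ∀ᶠ p : g × g in nhds 0,
      Summable (phiTerm φ p.1) ∧ Summable (phiTerm φ p.2) ∧ Summable (bchTerm 𝕜 p.1 p.2) ∧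
      Summable (phiTerm φ (bchSum 𝕜 p.1 p.2)) ∧
      Summable (expTerm υ p.1 (phiSum φ p.2)) ∧
      Summable (bchTerm 𝕜 (phiSum φ p.1) (expSum υ p.1 (phiSum φ p.2))) ∧
      phiSum φ (bchSum 𝕜 p.1 p.2) =
        bchSum 𝕜 (phiSum φ p.1) (expSum υ p.1 (phiSum φ p.2)) := by
  obtain ⟨r₅, h₅, H₅⟩ := eval_Phi (coordinates 𝕜 g) (coordinates 𝕜 h) φ one_pos
  obtain ⟨r₄, h₄, H₄⟩ := eval_BCH (coordinates 𝕜 g) h₅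
  obtain ⟨r₃, h₃, H₃⟩ := eval_BCH (coordinates 𝕜 h) one_pos
  obtain ⟨r₂, h₂, H₂⟩ := eval_ExpAct (coordinates 𝕜 g) (coordinates 𝕜 h) υ h₃
  obtain ⟨r₁, h₁, H₁⟩ := eval_Phi (coordinates 𝕜 g) (coordinates 𝕜 h) φ (lt_min h₂ h₃)
  filter_upwards [eventually_near_line_prod (𝕜 := 𝕜) (lt_min h₁ (lt_min h₂ h₄))]
  rintro ⟨x, y⟩ ⟨hx, hy⟩
  dsimp only at hx hy ⊢
  have x0 := line_zero x
  have y0 := line_zero y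
  have c0 := (Phi_spec φ x0).1
  have d0 := (Phi_spec φ y0).1
  have e0 : ExpAct υ (line x) (Phi φ (line y)) 0 = 0 := ExpAct_zero d0
  have f0 := (BCH_spec (K := 𝕜) x0 y0).1
  obtain ⟨s₁, n₁⟩ := H₁ _ _ x0 (hx.mono (min_le_left _ _))
  obtain ⟨s₁', n₁'⟩ := H₁ _ _ y0 (hy.mono (min_le_left _ _))
  obtain ⟨s₂, n₂⟩ := H₂ _ _ _ _ x0 (hx.mono ((min_le_right _ _).trans (min_le_left _ _)))
    (n₁'.mono (min_le_left _ _))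
  obtain ⟨s₃, n₃⟩ := H₃ _ _ _ _ c0 e0 (n₁.mono (min_le_right _ _)) n₂
  obtain ⟨s₄, n₄⟩ := H₄ _ _ _ _ x0 y0 (hx.mono ((min_le_right _ _).trans (min_le_right _ _)))
    (hy.mono ((min_le_right _ _).trans (min_le_right _ _)))
  obtain ⟨s₅, n₅⟩ := H₅ _ _ f0 n₄
  rw [Phi_BCH φ x0 y0] at n₅
  exact ⟨s₁, s₁', s₄, s₅, s₂, s₃, n₅.unique n₃⟩

end LocalIdentities

end PostLieMagnus

end

theorem theorem3p7 :
    -- the formal identities, over an arbitrary field of characteristic zero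
    (∀ {K g h : Type*} [Field K] [CharZero K]
      [LieRing g] [LieAlgebra K g] [FiniteDimensional K g]
      [LieRing h] [LieAlgebra K h] [FiniteDimensional K h]
      (υ : g →ₗ⁅K⁆ LieDerivation K h h) (φ : CrossedMorphism υ),
      Function.Bijective φ.toLinearMap →
      -- `Θ` is invertible, and `BCH`, `Φ` and `χ` do take values in series without constant term
      Function.Bijective (Theta φ) ∧
      (∀ x y : ℕ → g, x 0 = 0 → y 0 = 0 → BCH K x y 0 = 0 ∧
        toU K (BCH K x y) =
          logPS K (expU K x * expU K y)) ∧
      (∀ a b : ℕ → h, a 0 = 0 → b 0 = 0 → BCH K a b 0 = 0 ∧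
        toU K (BCH K a b) =
          logPS K (expU K a * expU K b)) ∧
      (∀ a : ℕ → h, a 0 = 0 → chi φ a 0 = 0 ∧
        toU K (chi φ a) =
          logPS K (ThetaInvPS φ (expU K a))) ∧
      (∀ x : ℕ → g, x 0 = 0 → Phi φ x 0 = 0 ∧
        toU K (Phi φ x) =
          logPS K (ThetaPS φ (expU K x))) ∧
      -- the identity for `χ`
      (∀ a b : ℕ → h, a 0 = 0 → b 0 = 0 →
        BCH K (chi φ a) (chi φ b) =
          chi φ (BCH K a
            (ExpAct υ (chi φ a) b))) ∧
      -- `Φ` is the inverse of `χ` and a crossed morphism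
      (∀ a : ℕ → h, a 0 = 0 → Phi φ (chi φ a) = a) ∧
      (∀ x : ℕ → g, x 0 = 0 → chi φ (Phi φ x) = x) ∧
      (∀ x y : ℕ → g, x 0 = 0 → y 0 = 0 →
        Phi φ (BCH K x y) =
          BCH K (Phi φ x)
            (ExpAct υ x (Phi φ y)))) ∧
    -- the identities between the local groups, over the real or complex numbers
    (∀ {𝕜 g h : Type*} [RCLike 𝕜]
      [LieRing g] [LieAlgebra 𝕜 g] [FiniteDimensional 𝕜 g]
      [TopologicalSpace g] [IsTopologicalAddGroup g] [ContinuousSMul 𝕜 g] [T2Space g]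
      [LieRing h] [LieAlgebra 𝕜 h] [FiniteDimensional 𝕜 h]
      [TopologicalSpace h] [IsTopologicalAddGroup h] [ContinuousSMul 𝕜 h] [T2Space h]
      (υ : g →ₗ⁅𝕜⁆ LieDerivation 𝕜 h h) (φ : CrossedMorphism υ),
      Function.Bijective φ.toLinearMap →
      AnalyticNearZero 𝕜 (chiSum φ) ∧
      AnalyticNearZero 𝕜 (phiSum φ) ∧
      (∀ᶠ p : h × h in nhds 0,
        Summable (chiTerm φ p.1) ∧
        Summable (chiTerm φ p.2) ∧
        Summable (bchTerm 𝕜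
          (chiSum φ p.1) (chiSum φ p.2)) ∧
        Summable (expTerm υ (chiSum φ p.1) p.2) ∧
        Summable (bchTerm 𝕜 p.1
          (expSum υ (chiSum φ p.1) p.2)) ∧
        Summable (chiTerm φ (bchSum 𝕜 p.1
          (expSum υ (chiSum φ p.1) p.2))) ∧
        bchSum 𝕜 (chiSum φ p.1) (chiSum φ p.2) =
          chiSum φ (bchSum 𝕜 p.1
            (expSum υ (chiSum φ p.1) p.2))) ∧
      (∀ᶠ a : h in nhds 0, Summable (phiTerm φ (chiSum φ a)) ∧ phiSum φ (chiSum φ a) = a) ∧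
      (∀ᶠ x : g in nhds 0, Summable (chiTerm φ (phiSum φ x)) ∧ chiSum φ (phiSum φ x) = x) ∧
      (∀ᶠ p : g × g in nhds 0,
        Summable (phiTerm φ p.1) ∧
        Summable (phiTerm φ p.2) ∧
        Summable (bchTerm 𝕜 p.1 p.2) ∧
        Summable (phiTerm φ (bchSum 𝕜 p.1 p.2)) ∧
        Summable (expTerm υ p.1 (phiSum φ p.2)) ∧
        Summable (bchTerm 𝕜 (phiSum φ p.1)
          (expSum υ p.1 (phiSum φ p.2))) ∧
        phiSum φ (bchSum 𝕜 p.1 p.2) =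
          bchSum 𝕜 (phiSum φ p.1)
            (expSum υ p.1 (phiSum φ p.2)))) := by
  refine ⟨?_, ?_⟩
  · intro K g h _ _ _ _ _ _ _ _ υ φ hφ
    refine ⟨Theta_bijective φ hφ, fun x y hx hy => ?_, fun a b ha hb => ?_, fun a ha => ?_,
      fun x hx => ?_, fun a b => BCH_chi hφ, fun a => Phi_chi hφ, fun x => chi_Phi hφ,
      fun x y => Phi_BCH φ⟩
    · have := BCH_spec (K := K) hx hy
      exact ⟨this.1, by rw [← this.2, logPS_expU this.1]⟩
    · have := BCH_spec (K := K) ha hb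
      exact ⟨this.1, by rw [← this.2, logPS_expU this.1]⟩
    · have := chi_spec hφ ha
      refine ⟨this.1, ?_⟩
      rw [← this.2, ThetaInvPS_ThetaPS (Theta_bijective φ hφ).1, logPS_expU this.1]
    · have := Phi_spec φ hx
      exact ⟨this.1, by rw [← this.2, logPS_expU this.1]⟩
  · intro 𝕜 g h _ _ _ _ _ _ _ _ _ _ _ _ _ _ _ υ φ hφ
    exact ⟨analyticNearZero_chiSum hφ, analyticNearZero_phiSum φ, eventually_bchSum_chiSum hφ,
      eventually_phiSum_chiSum hφ, eventually_chiSum_phiSum hφ, eventually_phiSum_bchSum φ⟩
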